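/- **Setting.** Let $G\rightrightarrows M$ be a Lie groupoid (Hausdorff, finite-dimensional smooth manifolds) with source $\alpha$, target $\beta$, identities $\epsilon$, inversion $i$, and multiplication $gh$ defined when $\beta(g)=\alpha(h)$. Let $\tau:AG\to M$ be its Lie algebroid, $A_xG=\ker T_{\epsilon(x)}\alpha$. A section $X$ of $AG$ defines the left- and right-invariant vector fields $\overleftarrow X(g)=T l_g(X(\beta(g)))$ and $\overrightarrow X(g)=-T r_g(Ti(X(\alpha(g))))$, where $l_g(h)=gh$ and $r_g(h)=hg$. Let $L_d:G\to\mathbb R$ be smooth. A pair $(g,h)$ solves the discrete Euler–Lagrange equations if $\beta(g)=\alpha(h)$ and $\overleftarrow X(g)(L_d)=\overrightarrow X(h)(L_d)$ for every smooth section $X$ of $AG$. A local discrete Euler–Lagrange evolution operator $\Psi:A\to B$ ($A,B\subseteq G$ open) is a smooth map such that $(g,\Psi(g))$ is a solution for every $g\in A$. The Poincaré–Cartan 2-section is $\Omega_{L_d}=-d\Theta^+$, where $d$ is the differential of the Lie algebroid $P^\tau G=\ker T\beta\oplus\ker T\alpha\to G$ with anchor $(X_g,Y_g)\mapsto X_g+Y_g$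 and bracket determined by $[\![(\overrightarrow X,\overleftarrow Y),(\overrightarrow{X'},\overleftarrow{Y'})]\!]=([\overrightarrow X,\overrightarrow{X'}],[\overleftarrow Y,\overleftarrow{Y'}])$, and $\Theta^+(g)(X_g,Y_g)=Y_g(L_d)$. The discrete Legendre transformations $\mathbb F^\pm L_d:G\to A^*G$ are $$(\mathbb F^+L_d)(g)(v)=v(L_d\circ l_g)\ \ (v\in A_{\beta(g)}G),\qquad (\mathbb F^-L_d)(h)(v)=-v(L_d\circ r_h\circ i)\ \ (v\in A_{\alpha(h)}G).$$ **Local data.** Let $(g_0,h_0)$ be a solution and $x_0=\beta(g_0)=\alpha(h_0)$. Let $(x^i,u^\gamma)$ be coordinates on an open set $\mathcal U\subseteq G$ adapted to $\alpha$: $(x^i)$ are the coordinates of $\alpha(g)$ in a chart of $M$, and the identities in $\mathcal U$ have coordinates $(x,0)$. Let $\mathcal W\subseteq\mathcal U$ be an open set containing $\epsilon(x_0)$ with $\epsilon(\alpha(\mathcal W))\subseteq\mathcal W$, $\epsilon(\beta(\mathcal W))\subseteq\mathcal W$, $i(\mathcal W)=\mathcal W$, and $gh\in\mathcal U$ for all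 composable $g,h\in\mathcal W$. Near $\epsilon(x_0)$ write $\beta$ as $\mathsf b(x,u)$ and the product as $(x,u)\cdot(\mathsf b(x,u),v)=(x,\mathsf p(x,u,v))$, and set $$\rho^i_\mu(x)=\frac{\partial \mathsf b^i}{\partial u^\mu}(x,0),\qquad R^\gamma_\mu(x,v)=\frac{\partial\mathsf p^\gamma}{\partial u^\mu}(x,0,v).$$ A local bisection is an embedded submanifold $\Sigma\subseteq G$ on which $\alpha$ and $\beta$ restrict to diffeomorphisms onto open subsets of $M$, with inverses $\Sigma_\alpha,\Sigma_\beta$; put $L_\Sigma(g)=\Sigma_\beta(\alpha(g))\,g$ and $R_\Sigma(g)=g\,\Sigma_\alpha(\beta(g))$. Let $\Sigma_0\ni g_0$ and $\Upsilon_0\ni h_0$ be local bisections such that $(\Sigma_0)_\beta$ and $(\Upsilon_0)_\alpha$ are defined on $\alpha(\mathcal W)$, and set $\mathcal W_{\Sigma_0}=L_{\Sigma_0}(\mathcal W)$, $\mathcal W_{\Upsilon_0}=R_{\Upsilon_0}(\mathcal W)$. For a function $F$ of coordinates $(x,u)$ let $$\mathcal M(F)^\gamma_\mu=\rho^i_\mu\frac{\partial^2F}{\partial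 x^i\partial u^\gamma}-\frac{\partial R^\nu_\mu}{\partial u^\gamma}\frac{\partial F}{\partial u^\nu}-R^\nu_\mu\frac{\partial^2F}{\partial u^\nu\partial u^\gamma}.$$ Let $\mathbb FL_d=\mathcal M(F)$ for $F$ the expression of $L_d\circ R_{\Upsilon_0}$ in the coordinates $(x,u)$, and let $\overline{\mathbb FL}=\mathcal M(\bar F)$ for $\bar F$ the expression of $L_d\circ L_{\Sigma_0}$ in the coordinates $(\bar x,\bar u)=(x,u)\circ i$. Below, $(x_0,0)$ stands for the coordinates of $\epsilon(x_0)$. **Theorem.** The following statements are equivalent. 1. The matrices $\mathbb FL_d(x_0,0)$ and $\overline{\mathbb FL}(x_0,0)$ are regular. 2. $\Omega_{L_d}$ is nondegenerate at $g_0$ and at $h_0$. 3. $\mathbb F^+L_d$ is a local diffeomorphism at $g_0$ and $\mathbb F^-L_d$ is a local diffeomorphism at $h_0$. Any of them implies the following: there exist open neighbourhoods $\widetilde{\mathcal W}_{\Sigma_0}\subseteq\mathcal W_{\Sigma_0}$ of $g_0$ and $\widetilde{\mathcal W}_{\Upsilon_0}\subseteq\mathcal W_{\Upsilon_0}$ of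 $h_0$ and a unique local discrete Euler–Lagrange evolution operator $\Psi:\widetilde{\mathcal W}_{\Sigma_0}\to\widetilde{\mathcal W}_{\Upsilon_0}$ with $\Psi(g_0)=h_0$. In addition, $\Psi$ is a diffeomorphism from $\widetilde{\mathcal W}_{\Sigma_0}$ onto $\widetilde{\mathcal W}_{\Upsilon_0}$. -/

import Mathlib

open Set Topology
open scoped Manifold ContDiff

noncomputable section

/-- A Lie groupoid `G ⇉ M` with source `α`, target `β`, identities `ε`, inversion `inv` and
partial multiplication `mul`.  `mul g h` is meaningful only for `β g = α h`; its other values are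
irrelevant.  Smoothness of the multiplication is smoothness on the embedded submanifold
`G₂ = {(g, h) | β g = α h}` of `G × G`. -/
structure LieGroupoid
    (EG : Type*) [NormedAddCommGroup EG] [NormedSpace ℝ EG]
    (EM : Type*) [NormedAddCommGroup EM] [NormedSpace ℝ EM]
    (G : Type*) [TopologicalSpace G] [ChartedSpace EG G]
    (M : Type*) [TopologicalSpace M] [ChartedSpace EM M] where
  α : G → M
  β : G → M
  ε : M → G
  inv : G → G
  mul : G → G → G
  α_mul : ∀ g h, β g = α h → α (mul g h) = α g
  β_mul : ∀ g h, β g = α h → β (mul g h) = β h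
  mul_assoc : ∀ g h k, β g = α h → β h = α k → mul g (mul h k) = mul (mul g h) k
  α_ε : ∀ x, α (ε x) = x
  β_ε : ∀ x, β (ε x) = x
  ε_mul : ∀ g, mul (ε (α g)) g = g
  mul_ε : ∀ g, mul g (ε (β g)) = g
  α_inv : ∀ g, α (inv g) = β g
  β_inv : ∀ g, β (inv g) = α g
  inv_mul : ∀ g, mul (inv g) g = ε (β g)
  mul_inv : ∀ g, mul g (inv g) = ε (α g)
  smooth_α : ContMDiff 𝓘(ℝ, EG) 𝓘(ℝ, EM) ∞ α
  smooth_β : ContMDiff 𝓘(ℝ, EG) 𝓘(ℝ, EM) ∞ β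
  smooth_ε : ContMDiff 𝓘(ℝ, EM) 𝓘(ℝ, EG) ∞ ε
  smooth_inv : ContMDiff 𝓘(ℝ, EG) 𝓘(ℝ, EG) ∞ inv
  smooth_mul : ContMDiffOn (𝓘(ℝ, EG).prod 𝓘(ℝ, EG)) 𝓘(ℝ, EG) ∞
    (fun p : G × G => mul p.1 p.2) {p : G × G | β p.1 = α p.2}
  submersion_α : ∀ g, Function.Surjective (mfderiv 𝓘(ℝ, EG) 𝓘(ℝ, EM) α g)
  submersion_β : ∀ g, Function.Surjective (mfderiv 𝓘(ℝ, EG) 𝓘(ℝ, EM) β g)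

namespace LieGroupoid

section Smooth

variable {EG : Type*} [NormedAddCommGroup EG] [NormedSpace ℝ EG]
  {EM : Type*} [NormedAddCommGroup EM] [NormedSpace ℝ EM]
  {G : Type*} [TopologicalSpace G] [ChartedSpace EG G]
  {M : Type*} [TopologicalSpace M] [ChartedSpace EM M]

/-- The derivative `v(f)` of a function `f` on `G` along a tangent vector `v` at `g`. -/
def vecDeriv (g : G) (v : TangentSpace 𝓘(ℝ, EG) g) (f : G → ℝ) : ℝ :=
  mfderiv 𝓘(ℝ, EG) 𝓘(ℝ, ℝ) f g v

/-! ### The Lie algebroid and invariant vector fields -/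

/-- The fibre `A_x G = ker (T_{ε(x)} α)` of the Lie algebroid of the groupoid. -/
def algebroidFiber (Γ : LieGroupoid EG EM G M) (x : M) :
    Submodule ℝ (TangentSpace 𝓘(ℝ, EG) (Γ.ε x)) :=
  LinearMap.ker (mfderiv 𝓘(ℝ, EG) 𝓘(ℝ, EM) Γ.α (Γ.ε x)).toLinearMap

/-- Smoothness, over a set `V ⊆ M`, of a section of `AG ⊆ TG`. -/
def IsSmoothSectionOn [IsManifold 𝓘(ℝ, EG) ∞ G] (Γ : LieGroupoid EG EM G M)
    (X : ∀ x : M, Γ.algebroidFiber x) (V : Set M) : Prop :=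
  ContMDiffOn 𝓘(ℝ, EM) 𝓘(ℝ, EG).tangent ∞
    (fun x => (⟨Γ.ε x, (X x : TangentSpace 𝓘(ℝ, EG) (Γ.ε x))⟩ : TangentBundle 𝓘(ℝ, EG) G)) V

/-- Smooth sections of the Lie algebroid `τ : AG → M`. -/
structure AlgebroidSection [IsManifold 𝓘(ℝ, EG) ∞ G] (Γ : LieGroupoid EG EM G M) where
  toFun : ∀ x : M, Γ.algebroidFiber x
  smooth : Γ.IsSmoothSectionOn toFun univ

/-- The tangent map at `ε(β g)` of the left translation `l_g : α⁻¹(β g) → α⁻¹(α g)`, `h ↦ g h`;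
only its values on vectors tangent to the `α`-fibre, i.e. in `A_{β(g)} G`, are relevant. -/
def tangentLeft (Γ : LieGroupoid EG EM G M) (g : G)
    (v : TangentSpace 𝓘(ℝ, EG) (Γ.ε (Γ.β g))) : TangentSpace 𝓘(ℝ, EG) g :=
  mfderivWithin 𝓘(ℝ, EG) 𝓘(ℝ, EG) (fun h => Γ.mul g h) (Γ.α ⁻¹' {Γ.β g}) (Γ.ε (Γ.β g)) v

/-- The tangent map at `ε(α g)` of the right translation `r_g : β⁻¹(α g) → β⁻¹(β g)`, `h ↦ h g`;
only its values on vectors tangent to the `β`-fibre are relevant. -/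
def tangentRight (Γ : LieGroupoid EG EM G M) (g : G)
    (v : TangentSpace 𝓘(ℝ, EG) (Γ.ε (Γ.α g))) : TangentSpace 𝓘(ℝ, EG) g :=
  mfderivWithin 𝓘(ℝ, EG) 𝓘(ℝ, EG) (fun h => Γ.mul h g) (Γ.β ⁻¹' {Γ.α g}) (Γ.ε (Γ.α g)) v

/-- The tangent map at `ε(x)` of the inversion (which fixes `ε(x)`). -/
def tangentInv (Γ : LieGroupoid EG EM G M) (x : M)
    (v : TangentSpace 𝓘(ℝ, EG) (Γ.ε x)) : TangentSpace 𝓘(ℝ, EG) (Γ.ε x) :=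
  mfderiv 𝓘(ℝ, EG) 𝓘(ℝ, EG) Γ.inv (Γ.ε x) v

variable [IsManifold 𝓘(ℝ, EG) ∞ G]

/-- The left-invariant vector field of a section `X` of `AG`: `g ↦ (T l_g) (X (β g))`. -/
def leftVF (Γ : LieGroupoid EG EM G M) (X : Γ.AlgebroidSection) (g : G) :
    TangentSpace 𝓘(ℝ, EG) g :=
  Γ.tangentLeft g (X.toFun (Γ.β g))

/-- The right-invariant vector field of a section `X` of `AG`: `g ↦ -(T r_g) (T i (X (α g)))`. -/
def rightVF (Γ : LieGroupoid EG EM G M) (X : Γ.AlgebroidSection) (g : G) :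
    TangentSpace 𝓘(ℝ, EG) g :=
  -Γ.tangentRight g (Γ.tangentInv (Γ.α g) (X.toFun (Γ.α g)))

/-! ### Discrete Euler–Lagrange equations -/

/-- `(g, h)` is composable and solves the discrete Euler–Lagrange equations for `L`. -/
def IsDELSolution (Γ : LieGroupoid EG EM G M) (L : G → ℝ) (g h : G) : Prop :=
  Γ.β g = Γ.α h ∧
    ∀ X : Γ.AlgebroidSection, vecDeriv g (Γ.leftVF X g) L - vecDeriv h (Γ.rightVF X h) L = 0

/-- `Ψ : A → B` is a (local) discrete Euler–Lagrange evolution operator for `L`. -/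
def IsEvolutionOperator (Γ : LieGroupoid EG EM G M) (L : G → ℝ) (A B : Set G) (Ψ : G → G) :
    Prop :=
  ContMDiffOn 𝓘(ℝ, EG) 𝓘(ℝ, EG) ∞ Ψ A ∧ MapsTo Ψ A B ∧ ∀ g ∈ A, Γ.IsDELSolution L g (Ψ g)

/-! ### The Poincaré–Cartan 2-section

The Lie algebroid `P^τ G = Vβ ⊕ Vα → G` has anchor `(X, Y) ↦ X + Y`.  Its sections
`X^{(1,0)} + Y^{(0,1)} = (rightVF X, leftVF Y)`, for `X, Y` sections of `AG`, take every value in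
every fibre, and its bracket is characterized on them. -/

/-- A section `(rightVF X, leftVF Y)` of `P^τ G = Vβ ⊕ Vα`. -/
structure PSection (Γ : LieGroupoid EG EM G M) where
  X : Γ.AlgebroidSection
  Y : Γ.AlgebroidSection

/-- The value at `g` of a section of `P^τ G`, as a pair of tangent vectors in `V_gβ × V_gα`. -/
def PSection.val {Γ : LieGroupoid EG EM G M} (ξ : Γ.PSection) (g : G) :
    TangentSpace 𝓘(ℝ, EG) g × TangentSpace 𝓘(ℝ, EG) g :=
  (Γ.rightVF ξ.X g, Γ.leftVF ξ.Y g)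

/-- The anchor of `P^τ G`. -/
def anchorP (g : G) (w : TangentSpace 𝓘(ℝ, EG) g × TangentSpace 𝓘(ℝ, EG) g) :
    TangentSpace 𝓘(ℝ, EG) g :=
  w.1 + w.2

/-- The bracket of `P^τ G`: since `[rX, rX'] = -r⟦X, X'⟧` and `[lY, lY'] = l⟦Y, Y'⟧`, it is
`⟦(rX, lY), (rX', lY')⟧ = (-r⟦X, X'⟧, l⟦Y, Y'⟧) = ([rX, rX'], [lY, lY'])`. -/
def bracketP {Γ : LieGroupoid EG EM G M} (ξ η : Γ.PSection) (g : G) :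
    TangentSpace 𝓘(ℝ, EG) g × TangentSpace 𝓘(ℝ, EG) g :=
  (VectorField.mlieBracket 𝓘(ℝ, EG) (Γ.rightVF ξ.X) (Γ.rightVF η.X) g,
    VectorField.mlieBracket 𝓘(ℝ, EG) (Γ.leftVF ξ.Y) (Γ.leftVF η.Y) g)

/-- The Poincaré–Cartan 1-section `Θ⁺(g)(X_g, Y_g) = Y_g(L)`. -/
def thetaPlus (L : G → ℝ) (g : G) (w : TangentSpace 𝓘(ℝ, EG) g × TangentSpace 𝓘(ℝ, EG) g) : ℝ :=
  vecDeriv g w.2 L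

/-- The Poincaré–Cartan 2-section `Ω_L = -dΘ⁺`, with `d` the Lie algebroid differential:
`dΘ(ξ, η) = ρ(ξ)(Θ(η)) - ρ(η)(Θ(ξ)) - Θ(⟦ξ, η⟧)`. -/
def poincareCartan {Γ : LieGroupoid EG EM G M} (L : G → ℝ) (ξ η : Γ.PSection) (g : G) : ℝ :=
  -(vecDeriv g (anchorP g (ξ.val g)) (fun k => thetaPlus L k (η.val k))
    - vecDeriv g (anchorP g (η.val g)) (fun k => thetaPlus L k (ξ.val k))
    - thetaPlus L g (bracketP ξ η g))

/-- `Ω_L` is nondegenerate at `g`. -/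
def PoincareCartanNondegenerateAt (Γ : LieGroupoid EG EM G M) (L : G → ℝ) (g : G) : Prop :=
  ∀ ξ : Γ.PSection, (∀ η : Γ.PSection, poincareCartan L ξ η g = 0) → ξ.val g = 0

/-! ### The dual bundle and the discrete Legendre transformations -/

/-- The total space of the dual bundle `A^*G → M`. -/
def DualAlgebroid (Γ : LieGroupoid EG EM G M) : Type _ :=
  Σ x : M, Module.Dual ℝ (Γ.algebroidFiber x)

/-- `f : G → A^*G` is a local diffeomorphism at `g`.  The smooth structure of the vector bundle
`A^*G` is the one in which, for a smooth local frame `(e_γ)` of `AG` over an open set `V`, the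
trivialization `A^*G|_V → V × ℝ^k`, `ξ ∈ A_x^*G ↦ (x, (ξ(e_γ(x)))_γ)`, is a diffeomorphism. -/
def IsLocalDiffeoToDualAt (Γ : LieGroupoid EG EM G M) (f : G → Γ.DualAlgebroid) (g : G) : Prop :=
  ∃ (k : ℕ) (V : Set M) (e : Fin k → ∀ x : M, Γ.algebroidFiber x),
    IsOpen V ∧ (f g).1 ∈ V ∧ (∀ γ, Γ.IsSmoothSectionOn (e γ) V) ∧
    (∀ x ∈ V, LinearIndependent ℝ (fun γ => e γ x) ∧
      Submodule.span ℝ (range fun γ => e γ x) = ⊤) ∧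
    IsLocalDiffeomorphAt 𝓘(ℝ, EG) (𝓘(ℝ, EM).prod 𝓘(ℝ, Fin k → ℝ)) ∞
      (fun h => ((f h).1, fun γ => (f h).2 (e γ (f h).1))) g

/-- The discrete Legendre transformation `F⁺L : G → A^*G`: `F⁺L(g) ∈ A^*_{β(g)}G` is
`v ↦ v(L ∘ l_g)`, where `l_g : h ↦ g h` is defined on the fibre `α⁻¹(β g)`. -/
def legendrePlus (Γ : LieGroupoid EG EM G M) (L : G → ℝ) (g : G) : Γ.DualAlgebroid :=
  let D : TangentSpace 𝓘(ℝ, EG) (Γ.ε (Γ.β g)) →L[ℝ] ℝ :=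
    mfderivWithin 𝓘(ℝ, EG) 𝓘(ℝ, ℝ) (fun h => L (Γ.mul g h)) (Γ.α ⁻¹' {Γ.β g}) (Γ.ε (Γ.β g))
  ⟨Γ.β g, D.toLinearMap.comp (Γ.algebroidFiber (Γ.β g)).subtype⟩

/-- The discrete Legendre transformation `F⁻L : G → A^*G`: `F⁻L(h) ∈ A^*_{α(h)}G` is
`v ↦ -v(L ∘ r_h ∘ i)`, where `r_h ∘ i : k ↦ k⁻¹ h` is defined on the fibre `α⁻¹(α h)`. -/
def legendreMinus (Γ : LieGroupoid EG EM G M) (L : G → ℝ) (h : G) : Γ.DualAlgebroid :=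
  let D : TangentSpace 𝓘(ℝ, EG) (Γ.ε (Γ.α h)) →L[ℝ] ℝ :=
    mfderivWithin 𝓘(ℝ, EG) 𝓘(ℝ, ℝ) (fun k => L (Γ.mul (Γ.inv k) h)) (Γ.α ⁻¹' {Γ.α h})
      (Γ.ε (Γ.α h))
  ⟨Γ.α h, -(D.toLinearMap.comp (Γ.algebroidFiber (Γ.α h)).subtype)⟩

/-! ### Symmetric neighbourhoods, local bisections -/

/-- `W` is a symmetric neighbourhood associated with the open set `U` and the point `x₀`. -/
structure IsSymmetricNeighborhood (Γ : LieGroupoid EG EM G M) (U : Set G) (x₀ : M) (W : Set G) :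
    Prop where
  isOpen : IsOpen W
  subset : W ⊆ U
  mem : Γ.ε x₀ ∈ W
  ε_α : ∀ g ∈ W, Γ.ε (Γ.α g) ∈ W
  ε_β : ∀ g ∈ W, Γ.ε (Γ.β g) ∈ W
  inv_image : Γ.inv '' W = W
  mul_mem : ∀ g ∈ W, ∀ h ∈ W, Γ.β g = Γ.α h → Γ.mul g h ∈ U

/-- A local bisection: a set `Σ ⊆ G` such that `α` and `β` restrict to bijections of `Σ` onto open
sets `src` and `tgt` of `M`, whose inverses `secα` and `secβ` are smooth as maps into `G`;
equivalently, an embedded submanifold `Σ` such that `α` and `β` restrict to diffeomorphisms of `Σ`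
onto open sets.  The values of `secα` and `secβ` off `src` and `tgt` are irrelevant. -/
structure LocalBisection (Γ : LieGroupoid EG EM G M) where
  carrier : Set G
  src : Set M
  tgt : Set M
  secα : M → G
  secβ : M → G
  isOpen_src : IsOpen src
  isOpen_tgt : IsOpen tgt
  mapsTo_α : MapsTo Γ.α carrier src
  mapsTo_β : MapsTo Γ.β carrier tgt
  mapsTo_secα : MapsTo secα src carrier
  mapsTo_secβ : MapsTo secβ tgt carrier
  invOn_α : InvOn secα Γ.α carrier src
  invOn_β : InvOn secβ Γ.β carrier tgt
  smooth_secα : ContMDiffOn 𝓘(ℝ, EM) 𝓘(ℝ, EG) ∞ secα src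
  smooth_secβ : ContMDiffOn 𝓘(ℝ, EM) 𝓘(ℝ, EG) ∞ secβ tgt

/-- The local left translation `α⁻¹(tgt) → α⁻¹(src)`, `g ↦ h g` with `h ∈ Σ`, `β h = α g`. -/
def LocalBisection.leftTrans {Γ : LieGroupoid EG EM G M} (S : Γ.LocalBisection) (g : G) : G :=
  Γ.mul (S.secβ (Γ.α g)) g

/-- The local right translation `β⁻¹(src) → β⁻¹(tgt)`, `g ↦ g h` with `h ∈ Σ`, `α h = β g`. -/
def LocalBisection.rightTrans {Γ : LieGroupoid EG EM G M} (S : Γ.LocalBisection) (g : G) : G :=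
  Γ.mul g (S.secα (Γ.β g))

/-! ### Adapted coordinates and the local matrices -/

/-- Smooth coordinates `φ = (x^i)` on an open set of `M` and `ψ = (x^i, u^γ)` on an open set of `G`,
adapted to the fibration `α` and such that the identities have coordinates `(x, 0)`. -/
structure AdaptedCoordinates (Γ : LieGroupoid EG EM G M) (n m : ℕ) where
  φ : OpenPartialHomeomorph M (Fin n → ℝ)
  ψ : OpenPartialHomeomorph G ((Fin n → ℝ) × (Fin m → ℝ))
  smooth_φ : ContMDiffOn 𝓘(ℝ, EM) 𝓘(ℝ, Fin n → ℝ) ∞ φ φ.source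
  smooth_φ_symm : ContMDiffOn 𝓘(ℝ, Fin n → ℝ) 𝓘(ℝ, EM) ∞ φ.symm φ.target
  smooth_ψ : ContMDiffOn 𝓘(ℝ, EG) 𝓘(ℝ, (Fin n → ℝ) × (Fin m → ℝ)) ∞ ψ ψ.source
  smooth_ψ_symm : ContMDiffOn 𝓘(ℝ, (Fin n → ℝ) × (Fin m → ℝ)) 𝓘(ℝ, EG) ∞ ψ.symm ψ.target
  mapsTo_α : MapsTo Γ.α ψ.source φ.source
  fst_ψ : ∀ g ∈ ψ.source, (ψ g).1 = φ (Γ.α g)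
  snd_ψ_ε : ∀ y, Γ.ε y ∈ ψ.source → (ψ (Γ.ε y)).2 = 0

/-- `∂F/∂x^i`. -/
def pdx {n m : ℕ} (F : (Fin n → ℝ) × (Fin m → ℝ) → ℝ) (i : Fin n)
    (z : (Fin n → ℝ) × (Fin m → ℝ)) : ℝ :=
  fderiv ℝ F z (Pi.single i 1, 0)

/-- `∂F/∂u^γ`. -/
def pdu {n m : ℕ} (F : (Fin n → ℝ) × (Fin m → ℝ) → ℝ) (γ : Fin m)
    (z : (Fin n → ℝ) × (Fin m → ℝ)) : ℝ :=
  fderiv ℝ F z (0, Pi.single γ 1)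

namespace AdaptedCoordinates

variable {Γ : LieGroupoid EG EM G M} {n m : ℕ} (C : Γ.AdaptedCoordinates n m)

/-- The local expression `b(x, u)` of the target map. -/
def b (z : (Fin n → ℝ) × (Fin m → ℝ)) : Fin n → ℝ :=
  C.φ (Γ.β (C.ψ.symm z))

/-- The local expression of the product: `(x, u) · (b(x, u), v) = (x, p(x, u, v))`. -/
def p (x : Fin n → ℝ) (u v : Fin m → ℝ) : Fin m → ℝ :=
  (C.ψ (Γ.mul (C.ψ.symm (x, u)) (C.ψ.symm (C.b (x, u), v)))).2

/-- `ρ^i_μ(x) = ∂b^i/∂u^μ (x, 0)`. -/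
def rho (i : Fin n) (μ : Fin m) (x : Fin n → ℝ) : ℝ :=
  pdu (fun z => C.b z i) μ (x, 0)

/-- `R^γ_μ(x, v) = ∂p^γ/∂u^μ (x, 0, v)`. -/
def R (γ μ : Fin m) (z : (Fin n → ℝ) × (Fin m → ℝ)) : ℝ :=
  fderiv ℝ (fun u => C.p z.1 u z.2 γ) 0 (Pi.single μ 1)

/-- For a function `F` of the coordinates `(x, u)`, the matrix with entries
`ρ^i_μ ∂²F/∂x^i∂u^γ - (∂R^ν_μ/∂u^γ) ∂F/∂u^ν - R^ν_μ ∂²F/∂u^ν∂u^γ`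
(row `γ`, column `μ`, summation over `i` and `ν`). -/
def localMatrix (F : (Fin n → ℝ) × (Fin m → ℝ) → ℝ) (z : (Fin n → ℝ) × (Fin m → ℝ)) :
    Matrix (Fin m) (Fin m) ℝ :=
  Matrix.of fun γ μ =>
    (∑ i, C.rho i μ z.1 * pdx (pdu F γ) i z)
      - (∑ ν, pdu (C.R ν μ) γ z * pdu F ν z)
      - ∑ ν, C.R ν μ z * pdu (pdu F γ) ν z

/-- The matrix `FL(x, u)`: here `F` is `L ∘ R_Υ` in the coordinates `(x, u) = ψ`. -/
def FL (L : G → ℝ) (Y : Γ.LocalBisection) :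
    (Fin n → ℝ) × (Fin m → ℝ) → Matrix (Fin m) (Fin m) ℝ :=
  C.localMatrix (fun z => L (Y.rightTrans (C.ψ.symm z)))

/-- The matrix `\overline{FL}(x̄, ū)`: here `F` is `L ∘ L_Σ` in the coordinates
`(x̄, ū) = ψ ∘ i` adapted to `β`. -/
def FLbar (L : G → ℝ) (S : Γ.LocalBisection) :
    (Fin n → ℝ) × (Fin m → ℝ) → Matrix (Fin m) (Fin m) ℝ :=
  C.localMatrix (fun z => L (S.leftTrans (Γ.inv (C.ψ.symm z))))

end AdaptedCoordinates

end Smooth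

end LieGroupoid

end

/-! All three conditions say the same thing about one bilinear form. At an arrow `g`,
right-invariant vectors fill `ker T_gβ` and left-invariant vectors fill `ker T_gα`; both kernels
have dimension `dim G - dim M`. Pair the value at `g` of the right-invariant field of `X` with that
of the left-invariant field of `Y` by differentiating `L` first along the field of `Y`, then along
the field of `X`. Left and right translations commute, so the two derivatives can be exchanged
(`modelDeriv_leftDeriv_rightVec`). Hence the result depends only on the two vectors at `g`. Because
the dimensions agree, the form has trivial kernel on one side iff it has on the other
(`mixedNondegenerateAt_iff_left`). `MixedNondegenerateAt` expresses this nondegeneracy.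

The Poincaré–Cartan section reduces to the form because the bracket term cancels the derivatives
along two left-invariant fields. What remains pairs only the right component of one argument with
the left component of the other (`poincareCartan_eq`). In a local frame the Legendre transformations
are `β`, respectively `α`, together with the left, respectively right, derivatives of `L` along the
frame. The kernel of their differential is thus one kernel of the form, and equality of dimensions
with the inverse function theorem does the rest.

For the matrices, the coordinates of a right-invariant field are `(-ρ, R)`. The local matrix
therefore contains, up to sign, the fibre derivatives of the right derivatives of `L` after
translation by a bisection (`FL_apply`). The barred matrix is the unbarred one for `L ∘ i` and the
inverse bisection, and inversion transposes the form.

In a frame, the discrete Euler–Lagrange equations say that `F⁺L` at the first arrow equals `F⁻L` at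
the second. When both transformations are local diffeomorphisms, the evolution operator is forced to
be the local inverse of `F⁻L` composed with `F⁺L`, which is a diffeomorphism.

Tangent vectors are handled as velocities of curves with values in the model space, so that
identities between differentials become identities between products of arrows. -/

noncomputable section

open Filter

set_option linter.unusedSectionVars false

/-! ### Velocities of curves in manifolds. -/

section Velocity

variable {E : Type*} [NormedAddCommGroup E] [NormedSpace ℝ E]
  {H : Type*} [TopologicalSpace H] {I : ModelWithCorners ℝ E H}
  {N : Type*} [TopologicalSpace N] [ChartedSpace H N]
  {E' : Type*} [NormedAddCommGroup E'] [NormedSpace ℝ E']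
  {H' : Type*} [TopologicalSpace H'] {I' : ModelWithCorners ℝ E' H'}
  {N' : Type*} [TopologicalSpace N'] [ChartedSpace H' N']

variable (I I') in
/-- The derivative of a map between manifolds, as a map between the model spaces. -/
def modelDeriv (f : N → N') (x : N) : E →L[ℝ] E' := mfderiv I I' f x

variable (I I') in
/-- The derivative within a set of a map between manifolds, as a map between the model spaces. -/
def modelDerivWithin (f : N → N') (s : Set N) (x : N) : E →L[ℝ] E' := mfderivWithin I I' f s x

theorem hasFDerivAt_modelDeriv [I.Boundaryless] {f : N → N'} {x : N}
    (hf : MDifferentiableAt I I' f x) :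
    HasFDerivAt (fun z => extChartAt I' (f x) (f ((extChartAt I x).symm z)))
      (modelDeriv I I' f x) (extChartAt I x x) := by
  have h : HasFDerivWithinAt (fun z => extChartAt I' (f x) (f ((extChartAt I x).symm z)))
      (modelDeriv I I' f x) (range I) (extChartAt I x x) := hf.hasMFDerivAt.2
  rwa [I.range_eq_univ, hasFDerivWithinAt_univ] at h

theorem hasFDerivWithinAt_modelDerivWithin [I.Boundaryless] {f : N → N'} {s : Set N} {x : N}
    (hf : MDifferentiableWithinAt I I' f s x) :
    HasFDerivWithinAt (fun z => extChartAt I' (f x) (f ((extChartAt I x).symm z)))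
      (modelDerivWithin I I' f s x) ((extChartAt I x).symm ⁻¹' s) (extChartAt I x x) := by
  have h : HasFDerivWithinAt (fun z => extChartAt I' (f x) (f ((extChartAt I x).symm z)))
      (modelDerivWithin I I' f s x) ((extChartAt I x).symm ⁻¹' s ∩ range I) (extChartAt I x x) :=
    hf.hasMFDerivWithinAt.2
  rwa [I.range_eq_univ, inter_univ] at h

theorem modelDeriv_comp {E'' : Type*} [NormedAddCommGroup E''] [NormedSpace ℝ E'']
    {H'' : Type*} [TopologicalSpace H''] {I'' : ModelWithCorners ℝ E'' H''}
    {N'' : Type*} [TopologicalSpace N''] [ChartedSpace H'' N'']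
    {g : N' → N''} {f : N → N'} {x : N} {y : N'} (hy : f x = y)
    (hg : MDifferentiableAt I' I'' g y) (hf : MDifferentiableAt I I' f x) :
    modelDeriv I I'' (fun z => g (f z)) x = (modelDeriv I' I'' g y).comp (modelDeriv I I' f x) := by
  subst hy
  exact mfderiv_comp x hg hf

theorem modelDeriv_id (x : N) : modelDeriv I I (fun y : N => y) x = ContinuousLinearMap.id ℝ E :=
  mfderiv_id

theorem modelDeriv_congr {f g : N → N'} {x : N} (h : f =ᶠ[𝓝 x] g) :
    modelDeriv I I' f x = modelDeriv I I' g x :=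
  h.mfderiv_eq

theorem modelDeriv_eq_fderiv {f : E → E'} {x : E} :
    modelDeriv 𝓘(ℝ, E) 𝓘(ℝ, E') f x = fderiv ℝ f x :=
  mfderiv_eq_fderiv

variable (I) in
/-- The curve `c` passes through `x` at time `0` with velocity `v`, read in the preferred chart
at `x`. -/
structure HasVelocity (c : ℝ → N) (x : N) (v : E) : Prop where
  zero : c 0 = x
  continuousAt : ContinuousAt c 0
  hasDerivAt : HasDerivAt (fun t => extChartAt I x (c t)) v 0

namespace HasVelocity

theorem unique {c : ℝ → N} {x : N} {v w : E} (hv : HasVelocity I c x v) (hw : HasVelocity I c x w) :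
    v = w :=
  hv.hasDerivAt.unique hw.hasDerivAt

theorem congr {c d : ℝ → N} {x : N} {v : E} (hv : HasVelocity I c x v) (h : d =ᶠ[𝓝 0] c) :
    HasVelocity I d x v :=
  ⟨h.eq_of_nhds.trans hv.zero, hv.continuousAt.congr h.symm,
    hv.hasDerivAt.congr_of_eventuallyEq (h.mono fun t ht => by simp only [ht])⟩

theorem const (x : N) : HasVelocity I (fun _ : ℝ => x) x (0 : E) :=
  ⟨rfl, continuousAt_const, hasDerivAt_const _ _⟩

theorem eventually_left_inv {c : ℝ → N} {x : N} {v : E} (hv : HasVelocity I c x v) :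
    ∀ᶠ t in 𝓝 0, (extChartAt I x).symm (extChartAt I x (c t)) = c t := by
  have h : (extChartAt I x).source ∈ 𝓝 (c 0) := by
    rw [hv.zero]; exact extChartAt_source_mem_nhds x
  exact (hv.continuousAt.eventually_mem h).mono fun t ht => (extChartAt I x).left_inv ht

theorem comp [I.Boundaryless] {c : ℝ → N} {x : N} {v : E} (hv : HasVelocity I c x v) {f : N → N'}
    (hf : MDifferentiableAt I I' f x) :
    HasVelocity I' (fun t => f (c t)) (f x) (modelDeriv I I' f x v) := by
  have h0 := hv.zero
  refine ⟨by rw [h0], ?_, ?_⟩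
  · exact ContinuousAt.comp (f := c) (g := f) (by rw [h0]; exact hf.continuousAt) hv.continuousAt
  · have h := hasFDerivAt_modelDeriv hf
    rw [← h0] at h
    refine ((h0 ▸ h).comp_hasDerivAt_of_eq (0 : ℝ) hv.hasDerivAt (by rw [h0])).congr_of_eventuallyEq
      (hv.eventually_left_inv.mono fun t ht => ?_)
    simp only [Function.comp_apply, ht]

/-- The `α`- and `β`-fibres have in general no unique differentiability inside `G`, so the
derivative within a fibre involves a choice. Any choice takes the correct value on the velocity of a
curve that stays in the fibre, and no other value is needed. -/
theorem comp_within [I.Boundaryless] {c : ℝ → N} {x : N} {v : E} (hv : HasVelocity I c x v)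
    {f : N → N'} {s : Set N} (hf : MDifferentiableWithinAt I I' f s x)
    (hs : ∀ᶠ t in 𝓝 0, c t ∈ s) :
    HasVelocity I' (fun t => f (c t)) (f x) (modelDerivWithin I I' f s x v) := by
  have h0 := hv.zero
  refine ⟨by rw [h0], ?_, ?_⟩
  · have h1 : Tendsto c (𝓝 0) (𝓝[s] x) :=
      tendsto_nhdsWithin_iff.2 ⟨h0 ▸ hv.continuousAt, hs⟩
    have h2 := hf.continuousWithinAt.tendsto.comp h1
    rw [ContinuousAt, h0]
    exact h2
  · have h := hasFDerivWithinAt_modelDerivWithin hf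
    have h3 : ∀ᶠ t in 𝓝 (0:ℝ), extChartAt I x (c t) ∈ (extChartAt I x).symm ⁻¹' s := by
      filter_upwards [hv.eventually_left_inv, hs] with t h1 h2
      rwa [mem_preimage, h1]
    have h4 := h.comp_hasDerivWithinAt_of_eq (0 : ℝ) (hv.hasDerivAt.hasDerivWithinAt
      (s := {t | extChartAt I x (c t) ∈ (extChartAt I x).symm ⁻¹' s})) (fun t ht => ht)
      (by rw [h0])
    refine (h4.hasDerivAt h3).congr_of_eventuallyEq (hv.eventually_left_inv.mono fun t ht => ?_)
    simp only [Function.comp_apply, ht]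

theorem prodMk {c : ℝ → N} {x : N} {v : E} (hv : HasVelocity I c x v) {d : ℝ → N'} {y : N'} {w : E'}
    (hw : HasVelocity I' d y w) :
    HasVelocity (I.prod I') (fun t => (c t, d t)) (x, y) (v, w) := by
  refine ⟨by rw [hv.zero, hw.zero], hv.continuousAt.prodMk hw.continuousAt, ?_⟩
  simp only [extChartAt_prod, PartialEquiv.prod_coe]
  exact hv.hasDerivAt.prodMk hw.hasDerivAt

end HasVelocity

theorem hasVelocity_of_mdifferentiableAt {c : ℝ → N} {x : N} (h0 : c 0 = x)
    (hc : MDifferentiableAt 𝓘(ℝ, ℝ) I c 0) : HasVelocity I c x (modelDeriv 𝓘(ℝ, ℝ) I c 0 1) := by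
  subst h0
  refine ⟨rfl, hc.continuousAt, ?_⟩
  have h := (hasFDerivAt_modelDeriv hc).hasDerivAt
  exact h

theorem hasVelocity_iff_hasDerivAt {c : ℝ → E} {x v : E} :
    HasVelocity 𝓘(ℝ, E) c x v ↔ c 0 = x ∧ HasDerivAt c v 0 := by
  constructor
  · intro h
    exact ⟨h.zero, h.hasDerivAt⟩
  · rintro ⟨h, h'⟩
    exact ⟨h, h'.continuousAt, h'⟩

end Velocity

/-! ### Local diffeomorphisms and the inverse function theorem on manifolds. -/

section LocalDiffeo

variable {E : Type*} [NormedAddCommGroup E] [NormedSpace ℝ E]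
  {H : Type*} [TopologicalSpace H] {I : ModelWithCorners ℝ E H}
  {N : Type*} [TopologicalSpace N] [ChartedSpace H N]
  {E' : Type*} [NormedAddCommGroup E'] [NormedSpace ℝ E']
  {H' : Type*} [TopologicalSpace H'] {I' : ModelWithCorners ℝ E' H'}
  {N' : Type*} [TopologicalSpace N'] [ChartedSpace H' N']

theorem IsLocalDiffeomorphAt.congr {f g : N → N'} {x : N} (hf : IsLocalDiffeomorphAt I I' ∞ f x)
    (h : g =ᶠ[𝓝 x] f) : IsLocalDiffeomorphAt I I' ∞ g x := by
  obtain ⟨Φ, hx, hΦ⟩ := hf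
  obtain ⟨U, hU, hUo, hxU⟩ := eventually_nhds_iff.1 h
  let R := Φ.toOpenPartialHomeomorph.restrOpen U hUo
  have hsub : R.source ⊆ Φ.source := inter_subset_left
  have hsubt : R.target ⊆ Φ.target := inter_subset_left
  exact ⟨{ toPartialEquiv := R.toPartialEquiv
           open_source := R.open_source
           open_target := R.open_target
           contMDiffOn_toFun := Φ.contMDiffOn_toFun.mono hsub
           contMDiffOn_invFun := Φ.contMDiffOn_invFun.mono hsubt }, ⟨hx, hxU⟩,
    fun y hy => (hU y hy.2).trans (hΦ hy.1)⟩

theorem isLocalDiffeomorphAt_extChartAt [I.Boundaryless] [IsManifold I ∞ N] (x : N) :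
    IsLocalDiffeomorphAt I 𝓘(ℝ, E) ∞ (extChartAt I x) x :=
  ⟨{ toPartialEquiv := extChartAt I x
     open_source := isOpen_extChartAt_source x
     open_target := isOpen_extChartAt_target x
     contMDiffOn_toFun := by rw [extChartAt_source]; exact contMDiffOn_extChartAt
     contMDiffOn_invFun := contMDiffOn_extChartAt_symm x }, mem_extChartAt_source x, fun _ _ => rfl⟩

theorem isLocalDiffeomorphAt_extChartAt_symm [I.Boundaryless] [IsManifold I ∞ N] (x : N) :
    IsLocalDiffeomorphAt 𝓘(ℝ, E) I ∞ (extChartAt I x).symm (extChartAt I x x) :=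
  ⟨{ toPartialEquiv := (extChartAt I x).symm
     open_source := isOpen_extChartAt_target x
     open_target := isOpen_extChartAt_source x
     contMDiffOn_toFun := contMDiffOn_extChartAt_symm x
     contMDiffOn_invFun := by
       rw [PartialEquiv.symm_target, extChartAt_source]; exact contMDiffOn_extChartAt },
    mem_extChartAt_target x, fun _ _ => rfl⟩

/-- Smoothness of the local inverse is needed on a whole open set. Invertible operators form an open
set, so after shrinking the domain the derivative is invertible at each of its points, and the
inverse is smooth at each image. -/
theorem isLocalDiffeomorphAt_of_hasFDerivAt [CompleteSpace E] {F : E → E'} {z : E} {e : E ≃L[ℝ] E'}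
    (hF : ∀ᶠ y in 𝓝 z, ContDiffAt ℝ ∞ F y) (he : HasFDerivAt F (e : E →L[ℝ] E') z) :
    IsLocalDiffeomorphAt 𝓘(ℝ, E) 𝓘(ℝ, E') ∞ F z := by
  have hFz := hF.self_of_nhds
  let R := hFz.toOpenPartialHomeomorph F he (by simp)
  have hR : ⇑R = F := rfl
  have hzR : z ∈ R.source := hFz.mem_toOpenPartialHomeomorph_source he (by simp)
  have hinv : ∀ᶠ y in 𝓝 z, ∃ e' : E ≃L[ℝ] E', HasFDerivAt F (e' : E →L[ℝ] E') y := by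
    have hc : ContinuousAt (fderiv ℝ F) z := by
      exact (hFz.fderiv_right (m := 0) (by simp)).continuousAt
    have h1 : range ((↑) : (E ≃L[ℝ] E') → (E →L[ℝ] E')) ∈ 𝓝 (fderiv ℝ F z) := by
      rw [he.fderiv]; exact ContinuousLinearEquiv.nhds e
    filter_upwards [hc h1, hF] with y hy hy'
    obtain ⟨e', he'⟩ := hy
    exact ⟨e', he' ▸ (hy'.differentiableAt (by simp)).hasFDerivAt⟩
  obtain ⟨U, hU, hUo, hzU⟩ := eventually_nhds_iff.1 (hF.and hinv)
  let Q := R.restrOpen U hUo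
  refine ⟨{ toPartialEquiv := Q.toPartialEquiv
            open_source := Q.open_source
            open_target := Q.open_target
            contMDiffOn_toFun := ?_
            contMDiffOn_invFun := ?_ }, ⟨hzR, hzU⟩, fun _ _ => rfl⟩
  · exact fun y hy => (hU y hy.2).1.contMDiffAt.contMDiffWithinAt
  · intro y hy
    have hy' := Q.map_target hy
    obtain ⟨e', he'⟩ := (hU _ hy'.2).2
    exact (Q.contDiffAt_symm hy he' (hU _ hy'.2).1).contMDiffAt.contMDiffWithinAt

/-- The inverse function theorem on manifolds. -/
theorem isLocalDiffeomorphAt_of_modelDeriv_bijective [CompleteSpace E] [CompleteSpace E']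
    [I.Boundaryless] [I'.Boundaryless] [IsManifold I ∞ N] [IsManifold I' ∞ N']
    {f : N → N'} {x : N} (hf : ∀ᶠ y in 𝓝 x, ContMDiffAt I I' ∞ f y)
    (hb : Function.Bijective (modelDeriv I I' f x)) : IsLocalDiffeomorphAt I I' ∞ f x := by
  have hfx := hf.self_of_nhds
  let e : E ≃L[ℝ] E' := ContinuousLinearEquiv.ofBijective (modelDeriv I I' f x)
    (LinearMap.ker_eq_bot.2 hb.1) (LinearMap.range_eq_top.2 hb.2)
  have hd : HasFDerivAt (fun z => extChartAt I' (f x) (f ((extChartAt I x).symm z)))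
      (e : E →L[ℝ] E') (extChartAt I x x) :=
    hasFDerivAt_modelDeriv (hfx.mdifferentiableAt (by simp))
  have hsymm := isLocalDiffeomorphAt_extChartAt_symm (I := I) x
  have hx0 : (extChartAt I x).symm (extChartAt I x x) = x := extChartAt_to_inv x
  have hs : ContinuousAt (extChartAt I x).symm (extChartAt I x x) := hsymm.contMDiffAt.continuousAt
  have hc : ∀ᶠ z in 𝓝 (extChartAt I x x),
      ContDiffAt ℝ ∞ (fun z => extChartAt I' (f x) (f ((extChartAt I x).symm z))) z := by
    have h1 : ∀ᶠ z in 𝓝 (extChartAt I x x), ContMDiffAt I I' ∞ f ((extChartAt I x).symm z) :=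
      hs.eventually (by rwa [hx0])
    have h2 : ∀ᶠ z in 𝓝 (extChartAt I x x), z ∈ (extChartAt I x).target :=
      (isOpen_extChartAt_target x).mem_nhds (mem_extChartAt_target x)
    have h3 : ∀ᶠ z in 𝓝 (extChartAt I x x),
        f ((extChartAt I x).symm z) ∈ (extChartAt I' (f x)).source := by
      refine (ContinuousAt.comp (f := (extChartAt I x).symm) (g := f) ?_ hs).eventually_mem ?_
      · rw [hx0]; exact hfx.continuousAt
      · simp only [Function.comp_apply, hx0]
        exact extChartAt_source_mem_nhds (f x)
    filter_upwards [h1, h2, h3] with z hz1 hz2 hz3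
    rw [← contMDiffAt_iff_contDiffAt]
    have h4 : ContMDiffAt 𝓘(ℝ, E) I ∞ (extChartAt I x).symm z :=
      (contMDiffOn_extChartAt_symm x).contMDiffAt ((isOpen_extChartAt_target x).mem_nhds hz2)
    have h5 : ContMDiffAt I' 𝓘(ℝ, E') ∞ (extChartAt I' (f x)) (f ((extChartAt I x).symm z)) :=
      contMDiffAt_extChartAt' (by rwa [extChartAt_source] at hz3)
    exact h5.comp z (hz1.comp z h4)
  have h1 := isLocalDiffeomorphAt_of_hasFDerivAt hc hd
  have h2 := isLocalDiffeomorphAt_extChartAt (I := I) x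
  have h3 := isLocalDiffeomorphAt_extChartAt_symm (I := I') (f x)
  have h12 := IsLocalDiffeomorphAt.comp (K := 𝓘(ℝ, E')) (hf := h2) (hg := h1)
  have h123 := IsLocalDiffeomorphAt.comp (K := I') (hf := h12) (g := (extChartAt I' (f x)).symm)
    (hg := by simp only [Function.comp_apply, hx0]; exact h3)
  refine h123.congr ?_
  have h4 : ∀ᶠ y in 𝓝 x, y ∈ (extChartAt I x).source := extChartAt_source_mem_nhds x
  have h5 : ∀ᶠ y in 𝓝 x, f y ∈ (extChartAt I' (f x)).source :=
    hfx.continuousAt.eventually_mem (extChartAt_source_mem_nhds (f x))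
  filter_upwards [h4, h5] with y hy hy'
  simp only [Function.comp_apply, (extChartAt I x).left_inv hy, (extChartAt I' (f x)).left_inv hy']

theorem IsLocalDiffeomorphAt.modelDeriv_bijective [IsManifold I ∞ N] [IsManifold I' ∞ N']
    {f : N → N'} {x : N} (hf : IsLocalDiffeomorphAt I I' ∞ f x) :
    Function.Bijective (modelDeriv I I' f x) := by
  have := (hf.mfderivToContinuousLinearEquiv (by simp)).bijective
  rw [← ContinuousLinearEquiv.coe_coe, hf.mfderivToContinuousLinearEquiv_coe] at this
  exact this

end LocalDiffeo

/-! ### Smooth dependence of velocities on parameters. -/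

section SmoothVelocity

variable {E : Type*} [NormedAddCommGroup E] [NormedSpace ℝ E]
  {H : Type*} [TopologicalSpace H] {I : ModelWithCorners ℝ E H}
  {N : Type*} [TopologicalSpace N] [ChartedSpace H N] [IsManifold I ∞ N]
  {E' : Type*} [NormedAddCommGroup E'] [NormedSpace ℝ E']
  {H' : Type*} [TopologicalSpace H'] {J : ModelWithCorners ℝ E' H'}
  {B : Type*} [TopologicalSpace B] [ChartedSpace H' B]

/-- The velocity is the parametric derivative applied to the constant vector `1`. This turns a
smooth family of curves into a smooth vector field, and is how sections and invariant fields are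
shown to be smooth. -/
theorem ContMDiffAt.velocity [IsManifold J ∞ B] {f : B → ℝ → N} {v : B → E} {b₁ : B}
    (hf : ContMDiffAt (J.prod 𝓘(ℝ, ℝ)) I ∞ (Function.uncurry f) (b₁, 0))
    (hv : ∀ᶠ b in 𝓝 b₁, HasVelocity I (f b) (f b 0) (v b)) :
    ContMDiffAt J I.tangent ∞
      (fun b => (⟨f b 0, v b⟩ : TangentBundle I N)) b₁ := by
  have : IsManifold I 1 N := IsManifold.of_le (n := ∞) (by simp)
  have : IsManifold J 1 B := IsManifold.of_le (n := ∞) (by simp)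
  have h1 := hf.mfderiv (m := ∞) f (fun _ => (0 : ℝ)) contMDiffAt_const (by simp)
  have hone : ContMDiffAt J (𝓘(ℝ, ℝ).tangent) ∞
      (fun _ : B => (⟨0, (1 : ℝ)⟩ : TangentBundle 𝓘(ℝ, ℝ) ℝ)) b₁ := contMDiffAt_const
  have h0 : ContMDiffAt J I ∞ (fun b => f b 0) b₁ :=
    ContMDiffAt.comp b₁ (g := Function.uncurry f) (f := fun b => (b, (0 : ℝ))) hf
      (contMDiffAt_id.prodMk contMDiffAt_const)
  have h2 := ContMDiffAt.clm_apply_of_inCoordinates (n := ∞) (b₁ := fun _ : B => (0 : ℝ))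
    (b₂ := fun b => f b 0) (v := fun _ => (1 : ℝ)) h1 hone h0
  refine h2.congr_of_eventuallyEq ?_
  have h3 : ∀ᶠ b in 𝓝 b₁, MDifferentiableAt 𝓘(ℝ, ℝ) I (f b) 0 := by
    have h4 : ∀ᶠ p in 𝓝 (b₁, (0 : ℝ)),
        ContMDiffAt (J.prod 𝓘(ℝ, ℝ)) I 1 (Function.uncurry f) p :=
      (contMDiffAt_iff_contMDiffAt_nhds (n := 1) (by decide)).1 (hf.of_le (by simp))
    have h5 : ContinuousAt (fun b : B => (b, (0 : ℝ))) b₁ := by fun_prop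
    filter_upwards [h5.eventually h4] with b hb
    exact (hb.comp (0 : ℝ) (f := fun t : ℝ => (b, t))
      (contMDiffAt_const.prodMk contMDiffAt_id)).mdifferentiableAt (by simp)
  filter_upwards [hv, h3] with b hb hb3
  have h4 := hb.unique (hasVelocity_of_mdifferentiableAt rfl hb3)
  rw [h4]
  rfl

theorem ContMDiffAt.deriv_zero [IsManifold J ∞ B] {f : B → ℝ → ℝ} {b₁ : B}
    (hf : ContMDiffAt (J.prod 𝓘(ℝ, ℝ)) 𝓘(ℝ, ℝ) ∞ (Function.uncurry f) (b₁, 0)) :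
    ContMDiffAt J 𝓘(ℝ, ℝ) ∞ (fun b => deriv (f b) 0) b₁ := by
  have h1 := hf.mfderiv_apply (m := ∞) f (fun _ => (0 : ℝ)) id (fun _ => (1 : ℝ)) contMDiffAt_const
    contMDiffAt_id contMDiffAt_const (by simp)
  simpa [inTangentCoordinates_model_space] using h1

end SmoothVelocity

/-! ### Lie brackets as commutators, and symmetry of mixed derivatives. -/

section LieBracket

variable {E : Type*} [NormedAddCommGroup E] [NormedSpace ℝ E]
  {N : Type*} [TopologicalSpace N] [ChartedSpace E N] [IsManifold 𝓘(ℝ, E) ∞ N]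

/-- In the difference of the iterated derivatives the second-order terms in `F` cancel by symmetry
of the second derivative. -/
theorem fderiv_lieBracket_apply {V W : E → E} {F : E → ℝ} {z : E} (hV : DifferentiableAt ℝ V z)
    (hW : DifferentiableAt ℝ W z) (hF : ContDiffAt ℝ 2 F z) :
    fderiv ℝ F z (VectorField.lieBracket ℝ V W z) =
      fderiv ℝ (fun y => fderiv ℝ F y (W y)) z (V z) -
        fderiv ℝ (fun y => fderiv ℝ F y (V y)) z (W z) := by
  have hd : DifferentiableAt ℝ (fderiv ℝ F) z :=
    (hF.fderiv_right (m := 1) (by norm_num)).differentiableAt (by norm_num)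
  have hs : IsSymmSndFDerivAt ℝ F z := hF.isSymmSndFDerivAt (by simp)
  rw [fderiv_clm_apply hd hW, fderiv_clm_apply hd hV, VectorField.lieBracket]
  simp only [map_sub, _root_.add_apply, ContinuousLinearMap.comp_apply,
    ContinuousLinearMap.flip_apply]
  rw [hs (V z) (W z)]
  ring

/-- The Lie bracket of vector fields on a manifold acts on functions as a commutator. -/
theorem modelDeriv_mlieBracket_apply [CompleteSpace E]
    {V W : ∀ x : N, TangentSpace 𝓘(ℝ, E) x} {F : N → ℝ} {x : N}
    (hV : MDifferentiableAt 𝓘(ℝ, E) 𝓘(ℝ, E).tangent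
      (fun y => (⟨y, V y⟩ : TangentBundle 𝓘(ℝ, E) N)) x)
    (hW : MDifferentiableAt 𝓘(ℝ, E) 𝓘(ℝ, E).tangent
      (fun y => (⟨y, W y⟩ : TangentBundle 𝓘(ℝ, E) N)) x)
    (hF : ContMDiff 𝓘(ℝ, E) 𝓘(ℝ, ℝ) ∞ F) :
    modelDeriv 𝓘(ℝ, E) 𝓘(ℝ, ℝ) F x (VectorField.mlieBracket 𝓘(ℝ, E) V W x) =
      modelDeriv 𝓘(ℝ, E) 𝓘(ℝ, ℝ) (fun y => modelDeriv 𝓘(ℝ, E) 𝓘(ℝ, ℝ) F y (W y)) x (V x) -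
        modelDeriv 𝓘(ℝ, E) 𝓘(ℝ, ℝ) (fun y => modelDeriv 𝓘(ℝ, E) 𝓘(ℝ, ℝ) F y (V y)) x (W x) := by
  have : IsManifold 𝓘(ℝ, E) 1 N := IsManifold.of_le (n := ∞) (by simp)
  have : IsManifold 𝓘(ℝ, E) 2 N := IsManifold.of_le (n := ∞) (by decide)
  let χ := extChartAt 𝓘(ℝ, E) x
  -- The coordinate expression of a field in the chart at `x`. The identity then follows from its
  -- vector-space version.
  let pull : (∀ y : N, TangentSpace 𝓘(ℝ, E) y) → E → E := fun U =>
    VectorField.mpullbackWithin 𝓘(ℝ, E) 𝓘(ℝ, E) χ.symm U (range 𝓘(ℝ, E))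
  have hxs : χ.symm (χ x) = x := extChartAt_to_inv x
  have hdiff : ∀ U : (∀ y : N, TangentSpace 𝓘(ℝ, E) y), MDifferentiableAt 𝓘(ℝ, E) 𝓘(ℝ, E).tangent
      (fun y => (⟨y, U y⟩ : TangentBundle 𝓘(ℝ, E) N)) x → DifferentiableAt ℝ (pull U) (χ x) := by
    intro U hU
    have h := (hU.mdifferentiableWithinAt
      (s := univ)).differentiableWithinAt_mpullbackWithin_vectorField
    rw [preimage_univ, univ_inter, ModelWithCorners.range_eq_univ] at h
    have h' : DifferentiableWithinAt ℝ (pull U) univ (χ x) := by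
      simp only [pull, ModelWithCorners.range_eq_univ]
      exact h
    exact differentiableWithinAt_univ.1 h'
  have hpx : ∀ U : (∀ y : N, TangentSpace 𝓘(ℝ, E) y), pull U (χ x) = U x := by
    intro U
    change (mfderivWithin 𝓘(ℝ, E) 𝓘(ℝ, E) χ.symm (range 𝓘(ℝ, E)) (χ x)).inverse (U (χ.symm (χ x)))
      = U x
    rw [hxs]
    exact mfderivWithin_extChartAt_symm_inverse_apply (U x)
  have hFs : ∀ z ∈ χ.target, ContMDiffAt 𝓘(ℝ, E) 𝓘(ℝ, E) ∞ χ.symm z := fun z hz =>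
    (contMDiffOn_extChartAt_symm x).contMDiffAt ((isOpen_extChartAt_target x).mem_nhds hz)
  have hFz : ContDiffAt ℝ 2 (fun z => F (χ.symm z)) (χ x) := by
    rw [← contMDiffAt_iff_contDiffAt]
    exact ((hF (χ.symm (χ x))).comp (χ x) (hFs _ (mem_extChartAt_target x))).of_le (by decide)
  have happ : ∀ U : (∀ y : N, TangentSpace 𝓘(ℝ, E) y), ∀ z ∈ χ.target,
      fderiv ℝ (fun z => F (χ.symm z)) z (pull U z) =
        modelDeriv 𝓘(ℝ, E) 𝓘(ℝ, ℝ) F (χ.symm z) (U (χ.symm z)) := by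
    intro U z hz
    have hinv : (mfderivWithin 𝓘(ℝ, E) 𝓘(ℝ, E) χ.symm (range 𝓘(ℝ, E)) z).IsInvertible :=
      isInvertible_mfderivWithin_extChartAt_symm hz
    rw [← modelDeriv_eq_fderiv, modelDeriv_comp rfl ((hF _).mdifferentiableAt (by simp))
      ((hFs z hz).mdifferentiableAt (by simp)), ContinuousLinearMap.comp_apply]
    congr 1
    change mfderiv 𝓘(ℝ, E) 𝓘(ℝ, E) χ.symm z
      ((mfderivWithin 𝓘(ℝ, E) 𝓘(ℝ, E) χ.symm (range 𝓘(ℝ, E)) z).inverse (U (χ.symm z))) = _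
    rw [ModelWithCorners.range_eq_univ, mfderivWithin_univ] at hinv ⊢
    exact hinv.self_apply_inverse _
  -- The preferred chart at `x` has the identity as differential at its own centre, so transporting
  -- the bracket back does not change it.
  have hbr : VectorField.mlieBracket 𝓘(ℝ, E) V W x =
      VectorField.lieBracket ℝ (pull V) (pull W) (χ x) := by
    have hid : modelDeriv 𝓘(ℝ, E) 𝓘(ℝ, E) χ x = ContinuousLinearMap.id ℝ E :=
      mfderiv_extChartAt_self
    rw [VectorField.mlieBracket, VectorField.mlieBracketWithin_apply, preimage_univ, univ_inter]
    change (modelDeriv 𝓘(ℝ, E) 𝓘(ℝ, E) χ x).inverse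
      (VectorField.lieBracketWithin ℝ (pull V) (pull W) (range 𝓘(ℝ, E)) (χ x)) = _
    rw [hid, ContinuousLinearMap.inverse_id, ModelWithCorners.range_eq_univ,
      VectorField.lieBracketWithin_univ]
    rfl
  have hdF : DifferentiableAt ℝ (fderiv ℝ (fun z => F (χ.symm z))) (χ x) :=
    (hFz.fderiv_right (m := 1) (by norm_num)).differentiableAt (by norm_num)
  have key : ∀ U : (∀ y : N, TangentSpace 𝓘(ℝ, E) y), ∀ v : E, DifferentiableAt ℝ (pull U) (χ x) →
      fderiv ℝ (fun z => fderiv ℝ (fun z => F (χ.symm z)) z (pull U z)) (χ x) v =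
        modelDeriv 𝓘(ℝ, E) 𝓘(ℝ, ℝ) (fun y => modelDeriv 𝓘(ℝ, E) 𝓘(ℝ, ℝ) F y (U y)) x v := by
    intro U v hU
    have h1 : (fun z => fderiv ℝ (fun z => F (χ.symm z)) z (pull U z)) =ᶠ[𝓝 (χ x)]
        fun z => modelDeriv 𝓘(ℝ, E) 𝓘(ℝ, ℝ) F (χ.symm z) (U (χ.symm z)) := by
      filter_upwards [(isOpen_extChartAt_target x).mem_nhds (mem_extChartAt_target x)] with z hz
      exact happ U z hz
    have h0 : DifferentiableAt ℝ (fun z => fderiv ℝ (fun z => F (χ.symm z)) z (pull U z)) (χ x) :=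
      hdF.clm_apply hU
    have h3 : MDifferentiableAt 𝓘(ℝ, E) 𝓘(ℝ, ℝ)
        (fun y => fderiv ℝ (fun z => F (χ.symm z)) (χ y) (pull U (χ y))) x :=
      h0.mdifferentiableAt.comp x (mdifferentiableAt_extChartAt (mem_chart_source E x))
    have h4 : MDifferentiableAt 𝓘(ℝ, E) 𝓘(ℝ, ℝ)
        (fun y => modelDeriv 𝓘(ℝ, E) 𝓘(ℝ, ℝ) F y (U y)) x := by
      refine h3.congr_of_eventuallyEq ?_
      filter_upwards [extChartAt_source_mem_nhds (I := 𝓘(ℝ, E)) x] with y hy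
      rw [happ U _ (χ.map_source hy), χ.left_inv hy]
    rw [h1.fderiv_eq]
    have h2 := (hasFDerivAt_modelDeriv h4).fderiv
    rw [← h2]
    rfl
  have e1 : modelDeriv 𝓘(ℝ, E) 𝓘(ℝ, ℝ) F x (VectorField.lieBracket ℝ (pull V) (pull W) (χ x)) =
      fderiv ℝ (fun z => F (χ.symm z)) (χ x)
        (VectorField.lieBracket ℝ (pull V) (pull W) (χ x)) := by
    have := (hasFDerivAt_modelDeriv ((hF x).mdifferentiableAt (by simp))).fderiv
    rw [← this]
    rfl
  rw [hbr, e1, fderiv_lieBracket_apply (hdiff V hV) (hdiff W hW) hFz, hpx, hpx]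
  exact congrArg₂ (· - ·) (key W (V x) (hdiff W hW)) (key V (W x) (hdiff V hV))

end LieBracket

theorem deriv_deriv_comm {H : ℝ × ℝ → ℝ} (hH : ContDiffAt ℝ 2 H (0, 0)) :
    deriv (fun s => deriv (fun t => H (s, t)) 0) 0 =
      deriv (fun t => deriv (fun s => H (s, t)) 0) 0 := by
  have hd : DifferentiableAt ℝ (fderiv ℝ H) (0, 0) :=
    (hH.fderiv_right (m := 1) (by norm_num)).differentiableAt (by norm_num)
  have hs : IsSymmSndFDerivAt ℝ H (0, 0) := hH.isSymmSndFDerivAt (by simp)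
  have hev : ∀ᶠ p in 𝓝 ((0 : ℝ), (0 : ℝ)), DifferentiableAt ℝ H p :=
    (hH.eventually (by simp)).mono fun p hp => hp.differentiableAt (by simp)
  have h1 : ∀ᶠ s in 𝓝 (0 : ℝ), deriv (fun t => H (s, t)) 0 = fderiv ℝ H (s, 0) (0, 1) := by
    have hc : ContinuousAt (fun s : ℝ => (s, (0 : ℝ))) 0 := by fun_prop
    filter_upwards [hc.eventually hev] with s hs
    have h := hs.hasFDerivAt.comp_hasDerivAt (0 : ℝ)
      ((hasDerivAt_const (0 : ℝ) s).prodMk (hasDerivAt_id (0 : ℝ)))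
    exact h.deriv
  have h2 : ∀ᶠ t in 𝓝 (0 : ℝ), deriv (fun s => H (s, t)) 0 = fderiv ℝ H (0, t) (1, 0) := by
    have hc : ContinuousAt (fun t : ℝ => ((0 : ℝ), t)) 0 := by fun_prop
    filter_upwards [hc.eventually hev] with t ht
    have h := ht.hasFDerivAt.comp_hasDerivAt (0 : ℝ)
      ((hasDerivAt_id (0 : ℝ)).prodMk (hasDerivAt_const (0 : ℝ) t))
    exact h.deriv
  have h3 : HasDerivAt (fun s : ℝ => fderiv ℝ H (s, 0) (0, 1))
      (fderiv ℝ (fderiv ℝ H) (0, 0) (1, 0) (0, 1)) 0 := by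
    have h := HasFDerivAt.comp_hasDerivAt (f := fun s : ℝ => (s, (0 : ℝ))) (0 : ℝ) hd.hasFDerivAt
      ((hasDerivAt_id (0 : ℝ)).prodMk (hasDerivAt_const (0 : ℝ) (0 : ℝ)))
    simpa using h.clm_apply (hasDerivAt_const (0 : ℝ) ((0 : ℝ), (1 : ℝ)))
  have h4 : HasDerivAt (fun t : ℝ => fderiv ℝ H (0, t) (1, 0))
      (fderiv ℝ (fderiv ℝ H) (0, 0) (0, 1) (1, 0)) 0 := by
    have h := HasFDerivAt.comp_hasDerivAt (f := fun t : ℝ => ((0 : ℝ), t)) (0 : ℝ) hd.hasFDerivAt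
      ((hasDerivAt_const (0 : ℝ) (0 : ℝ)).prodMk (hasDerivAt_id (0 : ℝ)))
    simpa using h.clm_apply (hasDerivAt_const (0 : ℝ) ((1 : ℝ), (0 : ℝ)))
  rw [Filter.EventuallyEq.deriv_eq h1, Filter.EventuallyEq.deriv_eq h2, h3.deriv, h4.deriv,
    hs (1, 0) (0, 1)]

/-! ### Vector fields and straight lines in a fixed chart. -/

section ChartVector

variable {E : Type*} [NormedAddCommGroup E] [NormedSpace ℝ E]
  {H : Type*} [TopologicalSpace H] {I : ModelWithCorners ℝ E H}
  {N : Type*} [TopologicalSpace N] [ChartedSpace H N] [IsManifold I ∞ N]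
  {E' : Type*} [NormedAddCommGroup E'] [NormedSpace ℝ E']
  {H' : Type*} [TopologicalSpace H'] {J : ModelWithCorners ℝ E' H'}
  {B : Type*} [TopologicalSpace B] [ChartedSpace H' B]

/-- Smoothness of a vector field along a map, in terms of its components in a chart. -/
theorem contMDiffAt_tangentBundle_iff {f : B → N} {v : B → E} {b₀ : B} {x₁ : N}
    (hx : f b₀ ∈ (extChartAt I x₁).source) :
    ContMDiffAt J I.tangent ∞ (fun b => (⟨f b, v b⟩ : TangentBundle I N)) b₀ ↔
      ContMDiffAt J I ∞ f b₀ ∧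
      ContMDiffAt J 𝓘(ℝ, E) ∞
        (fun b => modelDeriv I 𝓘(ℝ, E) (extChartAt I x₁) (f b) (v b)) b₀ := by
  have : IsManifold I 1 N := IsManifold.of_le (n := ∞) (by simp)
  have hx' : f b₀ ∈ (chartAt H x₁).source := by rwa [extChartAt_source] at hx
  let e := trivializationAt E (TangentSpace I) x₁
  have he : (⟨f b₀, v b₀⟩ : TangentBundle I N) ∈ e.source := by
    rw [e.mem_source]
    exact hx'
  have he' := e.contMDiffAt_iff (n := ∞) (IB := I) (IM := J)
    (f := fun b => (⟨f b, v b⟩ : TangentBundle I N)) (x₀ := b₀) he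
  refine he'.trans (and_congr_right fun hf => ?_)
  refine Filter.EventuallyEq.contMDiffAt_iff ?_
  filter_upwards [hf.continuousAt.eventually_mem ((chartAt H x₁).open_source.mem_nhds hx')]
    with b hb
  have h1 : modelDeriv I 𝓘(ℝ, E) (extChartAt I x₁) (f b) =
      (trivializationAt E (TangentSpace I) x₁).continuousLinearMapAt ℝ (f b) :=
    (TangentBundle.continuousLinearMapAt_trivializationAt hb).symm
  rw [h1]
  exact (congrFun ((trivializationAt E (TangentSpace I) x₁).coe_linearMapAt_of_mem (R := ℝ) hb)
    (v b)).symm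

/-- The chart is centred at `x₁`, not at the base point `h`. Keeping one chart while `h` varies
makes these lines a smooth family. -/
theorem hasVelocity_chart_line [I.Boundaryless] {x₁ h : N} (hh : h ∈ (extChartAt I x₁).source)
    (v : E) :
    HasVelocity I (fun t : ℝ => (extChartAt I x₁).symm
      (extChartAt I x₁ h + t • modelDeriv I 𝓘(ℝ, E) (extChartAt I x₁) h v)) h v := by
  let χ := extChartAt I x₁
  have hs : MDifferentiableAt 𝓘(ℝ, E) I χ.symm (χ h) :=
    ((contMDiffOn_extChartAt_symm (n := ∞) x₁).contMDiffAt
      ((isOpen_extChartAt_target x₁).mem_nhds (χ.map_source hh))).mdifferentiableAt (by simp)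
  have hc : MDifferentiableAt I 𝓘(ℝ, E) χ h :=
    (contMDiffAt_extChartAt' (n := ∞) (by rwa [extChartAt_source] at hh)).mdifferentiableAt
      (by simp)
  have h1 : HasVelocity 𝓘(ℝ, E) (fun t : ℝ => χ h + t • modelDeriv I 𝓘(ℝ, E) χ h v) (χ h)
      (modelDeriv I 𝓘(ℝ, E) χ h v) := by
    refine hasVelocity_iff_hasDerivAt.2 ⟨by simp, ?_⟩
    simpa using ((hasDerivAt_id (0 : ℝ)).smul_const (modelDeriv I 𝓘(ℝ, E) χ h v)).const_add (χ h)
  have h2 := h1.comp hs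
  have h3 : modelDeriv 𝓘(ℝ, E) I χ.symm (χ h) (modelDeriv I 𝓘(ℝ, E) χ h v) = v := by
    have h4 := modelDeriv_comp rfl hs hc
    have h5 : (fun z => χ.symm (χ z)) =ᶠ[𝓝 h] fun z => z := by
      filter_upwards [(isOpen_extChartAt_source x₁).mem_nhds hh] with z hz
      exact χ.left_inv hz
    rw [modelDeriv_congr h5, modelDeriv_id] at h4
    exact (DFunLike.congr_fun h4 v).symm
  rw [h3, χ.left_inv hh] at h2
  exact h2

end ChartVector

/-! ### Groupoid algebra, smoothness of products, and retractions onto fibres. -/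

namespace LieGroupoid

variable {EG : Type*} [NormedAddCommGroup EG] [NormedSpace ℝ EG]
  {EM : Type*} [NormedAddCommGroup EM] [NormedSpace ℝ EM]
  {G : Type*} [TopologicalSpace G] [ChartedSpace EG G]
  {M : Type*} [TopologicalSpace M] [ChartedSpace EM M]

section Mul

variable {E' : Type*} [NormedAddCommGroup E'] [NormedSpace ℝ E']
  {H' : Type*} [TopologicalSpace H'] {J : ModelWithCorners ℝ E' H'}
  {B : Type*} [TopologicalSpace B] [ChartedSpace H' B]

theorem contMDiffAt_mul (Γ : LieGroupoid EG EM G M) {a b : B → G} {p : B}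
    (ha : ContMDiffAt J 𝓘(ℝ, EG) ∞ a p) (hb : ContMDiffAt J 𝓘(ℝ, EG) ∞ b p)
    (h : ∀ᶠ q in 𝓝 p, Γ.β (a q) = Γ.α (b q)) :
    ContMDiffAt J 𝓘(ℝ, EG) ∞ (fun q => Γ.mul (a q) (b q)) p := by
  have h1 := (Γ.smooth_mul (a p, b p) h.self_of_nhds).comp p
    (ha.prodMk hb).contMDiffWithinAt (s := {q | Γ.β (a q) = Γ.α (b q)}) (fun q hq => hq)
  exact h1.contMDiffAt h

theorem mdifferentiableWithinAt_mul_left (Γ : LieGroupoid EG EM G M) (g : G) {h : G}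
    (hh : Γ.α h = Γ.β g) :
    MDifferentiableWithinAt 𝓘(ℝ, EG) 𝓘(ℝ, EG) (fun k => Γ.mul g k) (Γ.α ⁻¹' {Γ.β g}) h := by
  have h1 := (Γ.smooth_mul (g, h) hh.symm).comp h (f := fun k : G => (g, k))
    (contMDiffWithinAt_const.prodMk contMDiffWithinAt_id) (s := Γ.α ⁻¹' {Γ.β g})
    (fun q hq => Eq.symm hq)
  exact h1.mdifferentiableWithinAt (by simp)

theorem mdifferentiableWithinAt_mul_right (Γ : LieGroupoid EG EM G M) (g : G) {h : G}
    (hh : Γ.β h = Γ.α g) :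
    MDifferentiableWithinAt 𝓘(ℝ, EG) 𝓘(ℝ, EG) (fun k => Γ.mul k g) (Γ.β ⁻¹' {Γ.α g}) h := by
  have h1 := (Γ.smooth_mul (h, g) hh).comp h (f := fun k : G => (k, g))
    (contMDiffWithinAt_id.prodMk contMDiffWithinAt_const) (s := Γ.β ⁻¹' {Γ.α g})
    (fun q hq => hq)
  exact h1.mdifferentiableWithinAt (by simp)

end Mul

section Algebra

variable (Γ : LieGroupoid EG EM G M)

theorem inv_mul_cancel_left {g h : G} (hgh : Γ.β g = Γ.α h) :
    Γ.mul (Γ.inv g) (Γ.mul g h) = h := by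
  rw [Γ.mul_assoc _ _ _ (Γ.β_inv g) hgh, Γ.inv_mul, hgh, Γ.ε_mul]

theorem mul_inv_cancel_left {g h : G} (hgh : Γ.α g = Γ.α h) :
    Γ.mul g (Γ.mul (Γ.inv g) h) = h := by
  rw [Γ.mul_assoc _ _ _ (Γ.α_inv g).symm (by rw [Γ.β_inv, hgh]), Γ.mul_inv, hgh, Γ.ε_mul]

theorem mul_inv_cancel_right {g h : G} (hgh : Γ.β g = Γ.α h) :
    Γ.mul (Γ.mul g h) (Γ.inv h) = g := by
  rw [← Γ.mul_assoc _ _ _ hgh (Γ.α_inv h).symm, Γ.mul_inv, ← hgh, Γ.mul_ε]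

theorem inv_mul_cancel_right {g h : G} (hgh : Γ.β g = Γ.β h) :
    Γ.mul (Γ.mul g (Γ.inv h)) h = g := by
  rw [← Γ.mul_assoc _ _ _ (by rw [Γ.α_inv, hgh]) (Γ.β_inv h), Γ.inv_mul, ← hgh, Γ.mul_ε]

theorem eq_inv_of_mul_eq {g h : G} (hgh : Γ.β g = Γ.α h) (h1 : Γ.mul g h = Γ.ε (Γ.α g)) :
    h = Γ.inv g := by
  rw [← Γ.inv_mul_cancel_left hgh, h1, ← Γ.β_inv, Γ.mul_ε]

theorem inv_inv (g : G) : Γ.inv (Γ.inv g) = g :=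
  (Γ.eq_inv_of_mul_eq (Γ.β_inv g) (by rw [Γ.inv_mul, Γ.α_inv])).symm

theorem inv_ε (x : M) : Γ.inv (Γ.ε x) = Γ.ε x := by
  refine (Γ.eq_inv_of_mul_eq (by rw [Γ.β_ε, Γ.α_ε]) ?_).symm
  have := Γ.ε_mul (Γ.ε x)
  rwa [Γ.α_ε] at this ⊢

theorem inv_mul_rev {g h : G} (hgh : Γ.β g = Γ.α h) :
    Γ.inv (Γ.mul g h) = Γ.mul (Γ.inv h) (Γ.inv g) := by
  refine (Γ.eq_inv_of_mul_eq ?_ ?_).symm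
  · rw [Γ.β_mul _ _ hgh, Γ.α_mul _ _ (by rw [Γ.β_inv, Γ.α_inv, hgh]), Γ.α_inv]
  · rw [Γ.mul_assoc _ _ _ (by rw [Γ.β_mul _ _ hgh, Γ.α_inv]) (by rw [Γ.β_inv, Γ.α_inv, hgh]),
      Γ.mul_inv_cancel_right hgh, Γ.mul_inv, Γ.α_mul _ _ hgh]

end Algebra

/-- Near every arrow there is a smooth family of retractions onto the `α`-fibres. -/
theorem exists_retraction [FiniteDimensional ℝ EG] [FiniteDimensional ℝ EM]
    [IsManifold 𝓘(ℝ, EG) ∞ G] [IsManifold 𝓘(ℝ, EM) ∞ M] (Γ : LieGroupoid EG EM G M) (h₁ : G) :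
    ∃ r : M × G → G,
      (∀ᶠ p in 𝓝 (Γ.α h₁, h₁), ContMDiffAt (𝓘(ℝ, EM).prod 𝓘(ℝ, EG)) 𝓘(ℝ, EG) ∞ r p) ∧
      (∀ᶠ p in 𝓝 (Γ.α h₁, h₁), Γ.α (r p) = p.1) ∧
      (∀ᶠ h in 𝓝 h₁, r (Γ.α h, h) = h) := by
  have : CompleteSpace EG := FiniteDimensional.complete ℝ EG
  have : CompleteSpace EM := FiniteDimensional.complete ℝ EM
  let χ := extChartAt 𝓘(ℝ, EG) h₁
  let κ := extChartAt 𝓘(ℝ, EM) (Γ.α h₁)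
  let D : EG →L[ℝ] EM := modelDeriv 𝓘(ℝ, EG) 𝓘(ℝ, EM) Γ.α h₁
  have hDs : Function.Surjective D := Γ.submersion_α h₁
  obtain ⟨σ₀, hσ₀⟩ := D.toLinearMap.exists_rightInverse_of_surjective (LinearMap.range_eq_top.2 hDs)
  let σ : EM →L[ℝ] EG := LinearMap.toContinuousLinearMap σ₀
  have hσ : ∀ w, D (σ w) = w := fun w => LinearMap.congr_fun hσ₀ w
  let a : EG → EM := fun z => κ (Γ.α (χ.symm z))
  have hda : HasFDerivAt a D (χ h₁) :=
    hasFDerivAt_modelDeriv (Γ.smooth_α.mdifferentiable (by simp) h₁)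
  have hχs : χ.symm (χ h₁) = h₁ := extChartAt_to_inv h₁
  have hχc : ContinuousAt χ.symm (χ h₁) := continuousAt_extChartAt_symm h₁
  have hχsm : ∀ᶠ z in 𝓝 (χ h₁), ContMDiffAt 𝓘(ℝ, EG) 𝓘(ℝ, EG) ∞ χ.symm z := by
    filter_upwards [(isOpen_extChartAt_target (I := 𝓘(ℝ, EG)) h₁).mem_nhds
      (mem_extChartAt_target h₁)] with z hz
    exact (contMDiffOn_extChartAt_symm h₁).contMDiffAt
      ((isOpen_extChartAt_target h₁).mem_nhds hz)
  have hασ : ∀ᶠ z in 𝓝 (χ h₁), Γ.α (χ.symm z) ∈ κ.source := by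
    refine (ContinuousAt.comp (f := χ.symm) (g := Γ.α)
      Γ.smooth_α.continuous.continuousAt hχc).eventually_mem ?_
    simp only [Function.comp_apply, hχs]
    exact extChartAt_source_mem_nhds _
  have haC : ∀ᶠ z in 𝓝 (χ h₁), ContDiffAt ℝ ∞ a z := by
    filter_upwards [hχsm, hασ] with z h1 h2
    rw [← contMDiffAt_iff_contDiffAt]
    have h5 : ContMDiffAt 𝓘(ℝ, EM) 𝓘(ℝ, EM) ∞ κ (Γ.α (χ.symm z)) :=
      contMDiffAt_extChartAt' (by simpa [κ] using h2)
    exact h5.comp z ((Γ.smooth_α _).comp z h1)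
  -- The equation `a (z + σ w) = y` is to be solved for `w`. The differential of `Θ` at the base
  -- point is `(v, w) ↦ (v, D v + w)`, which is bijective because `D σ = id`. The solution is `w =
  -- 0` when `y = a z`, so arrows already in the prescribed fibre are not moved.
  let Θ : EG × EM → EG × EM := fun p => (p.1, a (p.1 + σ p.2))
  have hadd : ContinuousAt (fun p : EG × EM => p.1 + σ p.2) (χ h₁, 0) := by fun_prop
  have hadd0 : χ h₁ + σ 0 = χ h₁ := by simp
  have hΘC : ∀ᶠ p in 𝓝 (χ h₁, (0 : EM)), ContDiffAt ℝ ∞ Θ p := by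
    have h1 : ∀ᶠ p in 𝓝 (χ h₁, (0 : EM)), ContDiffAt ℝ ∞ a (p.1 + σ p.2) :=
      hadd.eventually (by simpa using haC)
    filter_upwards [h1] with p hp
    exact contDiffAt_fst.prodMk (ContDiffAt.comp (g := a) p hp (by fun_prop))
  have hΘD : HasFDerivAt Θ ((ContinuousLinearMap.fst ℝ EG EM).prod
      (D.comp (ContinuousLinearMap.fst ℝ EG EM + σ.comp (ContinuousLinearMap.snd ℝ EG EM))))
      (χ h₁, 0) := by
    have h1 : HasFDerivAt (fun p : EG × EM => p.1 + σ p.2)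
        (ContinuousLinearMap.fst ℝ EG EM + σ.comp (ContinuousLinearMap.snd ℝ EG EM)) (χ h₁, 0) :=
      hasFDerivAt_fst.add (σ.hasFDerivAt.comp _ hasFDerivAt_snd)
    refine hasFDerivAt_fst.prodMk (HasFDerivAt.comp (g := a) _ ?_ h1)
    simpa using hda
  have hbij : Function.Bijective ((ContinuousLinearMap.fst ℝ EG EM).prod
      (D.comp (ContinuousLinearMap.fst ℝ EG EM + σ.comp (ContinuousLinearMap.snd ℝ EG EM)))) := by
    constructor
    · rw [injective_iff_map_eq_zero]
      rintro ⟨v, w⟩ h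
      simp only [ContinuousLinearMap.prod_apply, Prod.mk_eq_zero] at h
      obtain ⟨h1, h2⟩ := h
      simp at h1 h2
      subst h1
      simp [hσ] at h2
      simp [h2]
    · rintro ⟨v, w⟩
      refine ⟨(v, w - D v), ?_⟩
      simp [hσ]
  obtain ⟨Φ, hΦm, hΦ⟩ := isLocalDiffeomorphAt_of_hasFDerivAt
    (e := ContinuousLinearEquiv.ofBijective _ (LinearMap.ker_eq_bot.2 hbij.1)
      (LinearMap.range_eq_top.2 hbij.2)) hΘC hΘD
  have hΦv : ∀ p ∈ Φ.source, Φ.invFun (Θ p) = p := fun p hp => by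
    rw [hΦ hp]; exact Φ.left_inv' hp
  have hΦt : Θ (χ h₁, 0) ∈ Φ.target := by rw [hΦ hΦm]; exact Φ.map_source' hΦm
  have hΘ0 : Θ (χ h₁, 0) = (χ h₁, κ (Γ.α h₁)) := by simp [Θ, a, hχs]
  let q : M × G → EG × EM := fun p => Φ.invFun (χ p.2, κ p.1)
  have hch : ∀ᶠ p in 𝓝 (Γ.α h₁, h₁), p.1 ∈ κ.source ∧ p.2 ∈ χ.source :=
    prod_mem_nhds (extChartAt_source_mem_nhds _) (extChartAt_source_mem_nhds _)
  have hpairC : ∀ᶠ p in 𝓝 (Γ.α h₁, h₁),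
      ContMDiffAt (𝓘(ℝ, EM).prod 𝓘(ℝ, EG)) 𝓘(ℝ, EG × EM) ∞ (fun p : M × G => (χ p.2, κ p.1)) p := by
    filter_upwards [hch] with p hp
    have h1 : ContMDiffAt 𝓘(ℝ, EG) 𝓘(ℝ, EG) ∞ χ p.2 :=
      contMDiffAt_extChartAt' (by simpa [χ] using hp.2)
    have h2 : ContMDiffAt 𝓘(ℝ, EM) 𝓘(ℝ, EM) ∞ κ p.1 :=
      contMDiffAt_extChartAt' (by simpa [κ] using hp.1)
    exact (h1.comp p contMDiffAt_snd).prodMk_space (h2.comp p contMDiffAt_fst)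
  have htgt : ∀ᶠ p in 𝓝 (Γ.α h₁, h₁), (χ p.2, κ p.1) ∈ Φ.target := by
    refine hpairC.self_of_nhds.continuousAt.eventually_mem (Φ.open_target.mem_nhds ?_)
    rw [hΘ0] at hΦt
    exact hΦt
  have hqC : ∀ᶠ p in 𝓝 (Γ.α h₁, h₁), ContMDiffAt (𝓘(ℝ, EM).prod 𝓘(ℝ, EG)) 𝓘(ℝ, EG × EM) ∞ q p := by
    filter_upwards [hpairC, htgt] with p h1 h2
    exact (Φ.contMDiffOn_invFun.contMDiffAt (Φ.open_target.mem_nhds h2)).comp p h1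
  have hq0 : q (Γ.α h₁, h₁) = (χ h₁, 0) := by
    change Φ.invFun (χ h₁, κ (Γ.α h₁)) = _
    rw [← hΘ0, hΦv _ hΦm]
  have hqc : ContinuousAt (fun p => χ p.2 + σ (q p).2) (Γ.α h₁, h₁) := by
    have h1 := hqC.self_of_nhds.continuousAt
    have h2 := hpairC.self_of_nhds.continuousAt
    exact (continuous_fst.continuousAt.comp h2).add
      (σ.continuous.continuousAt.comp (continuous_snd.continuousAt.comp h1))
  have hval : χ (Γ.α h₁, h₁).2 + σ (q (Γ.α h₁, h₁)).2 = χ h₁ := by rw [hq0]; simp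
  have hqt : Tendsto (fun p => χ p.2 + σ (q p).2) (𝓝 (Γ.α h₁, h₁)) (𝓝 (χ h₁)) := by
    rw [← hval]; exact hqc
  refine ⟨fun p => χ.symm (χ p.2 + σ (q p).2), ?_, ?_, ?_⟩
  · filter_upwards [hqC, hpairC, hqt.eventually hχsm] with p h1 h2 h3
    have h4 : ContMDiffAt (𝓘(ℝ, EM).prod 𝓘(ℝ, EG)) 𝓘(ℝ, EG) ∞ (fun p => χ p.2 + σ (q p).2) p := by
      have h5 : ContDiff ℝ ∞ (fun s : (EG × EM) × (EG × EM) => s.1.1 + σ s.2.2) := by fun_prop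
      exact h5.contMDiff.contMDiffAt.comp p (h2.prodMk_space h1)
    exact h3.comp p h4
  · filter_upwards [hch, htgt, hqt.eventually hασ] with p h1 h2 h3
    have h4 : Θ (q p) = (χ p.2, κ p.1) := by
      rw [hΦ (Φ.map_target' h2)]; exact Φ.right_inv' h2
    have h5 : (q p).1 = χ p.2 := congrArg Prod.fst h4
    have h6 : a ((q p).1 + σ (q p).2) = κ p.1 := congrArg Prod.snd h4
    rw [h5] at h6
    exact κ.injOn h3 h1.1 h6
  · have hcont : ContinuousAt (fun h => (χ h, (0 : EM))) h₁ :=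
      (continuousAt_extChartAt h₁).prodMk continuousAt_const
    filter_upwards [hcont.eventually_mem (Φ.open_source.mem_nhds hΦm),
      extChartAt_source_mem_nhds (I := 𝓘(ℝ, EG)) h₁] with h h1 h2
    have h3 : Θ (χ h, 0) = (χ h, κ (Γ.α h)) := by
      simp only [Θ, a, map_zero, add_zero]
      rw [χ.left_inv h2]
    have h4 : q (Γ.α h, h) = (χ h, 0) := by
      change Φ.invFun (χ h, κ (Γ.α h)) = _
      rw [← h3, hΦv _ h1]
    simp only [h4, map_zero, add_zero]
    exact χ.left_inv h2

end LieGroupoid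

/-! ### Deformations of the identities and the supply of sections of the Lie algebroid. -/

namespace LieGroupoid

variable {EG : Type*} [NormedAddCommGroup EG] [NormedSpace ℝ EG]
  {EM : Type*} [NormedAddCommGroup EM] [NormedSpace ℝ EM]
  {G : Type*} [TopologicalSpace G] [ChartedSpace EG G]
  {M : Type*} [TopologicalSpace M] [ChartedSpace EM M]

variable [IsManifold 𝓘(ℝ, EG) ∞ G]

/-- Retract `q (x, t)` onto the fibre over `x`. When `Tα` kills the initial velocity `v`, the pairs
`(x, q (x, t))` and `(α (q (x, t)), q (x, t))` have the same velocity `(0, v)`. The retraction sends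
the second pair to `q (x, t)` itself, so retracting does not alter `v`. -/
theorem exists_fibred_deformation [FiniteDimensional ℝ EG] [FiniteDimensional ℝ EM]
    [IsManifold 𝓘(ℝ, EM) ∞ M] (Γ : LieGroupoid EG EM G M) {q : M × ℝ → G} {x₁ : M}
    (hq : ∀ᶠ p in 𝓝 (x₁, (0 : ℝ)), ContMDiffAt (𝓘(ℝ, EM).prod 𝓘(ℝ, ℝ)) 𝓘(ℝ, EG) ∞ q p)
    (hα : ∀ᶠ x in 𝓝 x₁, Γ.α (q (x, 0)) = x) :
    ∃ s : M × ℝ → G,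
      (∀ᶠ p in 𝓝 (x₁, (0 : ℝ)), ContMDiffAt (𝓘(ℝ, EM).prod 𝓘(ℝ, ℝ)) 𝓘(ℝ, EG) ∞ s p) ∧
      (∀ᶠ p in 𝓝 (x₁, (0 : ℝ)), Γ.α (s p) = p.1) ∧
      (∀ᶠ x in 𝓝 x₁, s (x, 0) = q (x, 0)) ∧
      (∀ᶠ x in 𝓝 x₁, ∀ v, HasVelocity 𝓘(ℝ, EG) (fun t => q (x, t)) (q (x, 0)) v →
        modelDeriv 𝓘(ℝ, EG) 𝓘(ℝ, EM) Γ.α (q (x, 0)) v = 0 →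
        HasVelocity 𝓘(ℝ, EG) (fun t => s (x, t)) (q (x, 0)) v) := by
  obtain ⟨r, hr, hrα, hrid⟩ := Γ.exists_retraction (q (x₁, 0))
  have hx₁ : Γ.α (q (x₁, 0)) = x₁ := hα.self_of_nhds
  rw [hx₁] at hr hrα
  have hqc : ContinuousAt q (x₁, 0) := hq.self_of_nhds.continuousAt
  have hpc : Tendsto (fun p : M × ℝ => (p.1, q p)) (𝓝 (x₁, 0)) (𝓝 (x₁, q (x₁, 0))) :=
    (continuousAt_fst.prodMk hqc)
  have hic : Tendsto (fun x : M => (x, (0 : ℝ))) (𝓝 x₁) (𝓝 (x₁, 0)) := by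
    exact (continuous_id.prodMk continuous_const).continuousAt
  refine ⟨fun p => r (p.1, q p), ?_, hpc.eventually hrα, ?_, ?_⟩
  · filter_upwards [hpc.eventually hr, hq] with p h1 h2
    exact h1.comp p (contMDiffAt_fst.prodMk h2)
  · filter_upwards [(hqc.tendsto.comp hic).eventually hrid, hα] with x h1 h2
    simp only [Function.comp_apply, h2] at h1
    exact h1
  · filter_upwards [(hqc.tendsto.comp hic).eventually hrid.eventually_nhds, hα,
      (hpc.comp hic).eventually hr] with x h1 h2 h3 v hv hv0
    have hd : MDifferentiableAt (𝓘(ℝ, EM).prod 𝓘(ℝ, EG)) 𝓘(ℝ, EG) r (x, q (x, 0)) :=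
      h3.mdifferentiableAt (by simp)
    have e1 : HasVelocity (𝓘(ℝ, EM).prod 𝓘(ℝ, EG)) (fun t => (x, q (x, t))) (x, q (x, 0))
        ((0 : EM), v) := (HasVelocity.const x).prodMk hv
    have e2 : HasVelocity (𝓘(ℝ, EM).prod 𝓘(ℝ, EG)) (fun t => (Γ.α (q (x, t)), q (x, t)))
        (x, q (x, 0)) ((0 : EM), v) := by
      have := (hv.comp (Γ.smooth_α.mdifferentiable (by simp) _)).prodMk hv
      rwa [hv0, h2] at this
    have f1 := e1.comp hd
    have f2 := e2.comp hd
    have f3 : HasVelocity 𝓘(ℝ, EG) (fun t => r (Γ.α (q (x, t)), q (x, t))) (q (x, 0)) v := by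
      refine hv.congr ?_
      have hc := hv.continuousAt.tendsto
      exact hc.eventually h1
    have h4 : r (x, q (x, 0)) = q (x, 0) := by
      have := f3.zero
      rwa [h2] at this
    rw [h4] at f1 f2
    rwa [f2.unique f3] at f1

variable {Γ : LieGroupoid EG EM G M}

/-- The inclusion of a fibre of the Lie algebroid into the model space of the groupoid. -/
def fiberVec {x : M} : Γ.algebroidFiber x →ₗ[ℝ] EG := (Γ.algebroidFiber x).subtype

/-- The value of a section of the Lie algebroid, as an element of the model space. -/
def AlgebroidSection.vec (X : Γ.AlgebroidSection) (x : M) : EG := fiberVec (X.toFun x)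

theorem AlgebroidSection.modelDeriv_α_vec (X : Γ.AlgebroidSection) (x : M) :
    modelDeriv 𝓘(ℝ, EG) 𝓘(ℝ, EM) Γ.α (Γ.ε x) (X.vec x) = 0 :=
  LinearMap.mem_ker.1 (X.toFun x).2

theorem contMDiffAt_chart_line {x₁ : M} {y : M → EG}
    (hy : ∀ᶠ x in 𝓝 x₁, ContMDiffAt 𝓘(ℝ, EM) 𝓘(ℝ, EG) ∞ y x) :
    ∀ᶠ p in 𝓝 (x₁, (0 : ℝ)), ContMDiffAt (𝓘(ℝ, EM).prod 𝓘(ℝ, ℝ)) 𝓘(ℝ, EG) ∞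
      (fun p : M × ℝ => (extChartAt 𝓘(ℝ, EG) (Γ.ε x₁)).symm
        (extChartAt 𝓘(ℝ, EG) (Γ.ε x₁) (Γ.ε p.1) + p.2 • y p.1)) p := by
  let χ := extChartAt 𝓘(ℝ, EG) (Γ.ε x₁)
  have hεs : ∀ᶠ x in 𝓝 x₁, Γ.ε x ∈ χ.source :=
    Γ.smooth_ε.continuous.continuousAt.eventually_mem (extChartAt_source_mem_nhds _)
  have hl : ∀ᶠ p in 𝓝 (x₁, (0 : ℝ)), ContMDiffAt (𝓘(ℝ, EM).prod 𝓘(ℝ, ℝ)) 𝓘(ℝ, EG) ∞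
      (fun p : M × ℝ => χ (Γ.ε p.1) + p.2 • y p.1) p := by
    filter_upwards [continuousAt_fst.eventually hεs, continuousAt_fst.eventually hy] with p h1 h2
    have h3 : ContMDiffAt 𝓘(ℝ, EG) 𝓘(ℝ, EG) ∞ χ (Γ.ε p.1) :=
      contMDiffAt_extChartAt' (by rwa [extChartAt_source] at h1)
    exact (h3.comp p ((Γ.smooth_ε p.1).comp p contMDiffAt_fst)).add
      (contMDiffAt_snd.smul (h2.comp p contMDiffAt_fst))
  have hm : ∀ᶠ p in 𝓝 (x₁, (0 : ℝ)), χ (Γ.ε p.1) + p.2 • y p.1 ∈ χ.target := by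
    refine hl.self_of_nhds.continuousAt.eventually_mem
      ((isOpen_extChartAt_target _).mem_nhds ?_)
    simp only [zero_smul, add_zero]
    exact mem_extChartAt_target (I := 𝓘(ℝ, EG)) (Γ.ε x₁)
  filter_upwards [hl, hm] with p h1 h2
  exact ((contMDiffOn_extChartAt_symm _).contMDiffAt
    ((isOpen_extChartAt_target _).mem_nhds h2)).comp p h1

/-- Every section of the Lie algebroid is locally the velocity of a smooth deformation of the
identities along the `α`-fibres. -/
theorem AlgebroidSection.exists_deformation [FiniteDimensional ℝ EG] [FiniteDimensional ℝ EM]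
    [IsManifold 𝓘(ℝ, EM) ∞ M] (X : Γ.AlgebroidSection) (x₁ : M) :
    ∃ s : M × ℝ → G,
      (∀ᶠ p in 𝓝 (x₁, (0 : ℝ)), ContMDiffAt (𝓘(ℝ, EM).prod 𝓘(ℝ, ℝ)) 𝓘(ℝ, EG) ∞ s p) ∧
      (∀ᶠ p in 𝓝 (x₁, (0 : ℝ)), Γ.α (s p) = p.1) ∧
      (∀ᶠ x in 𝓝 x₁, HasVelocity 𝓘(ℝ, EG) (fun t => s (x, t)) (Γ.ε x) (X.vec x)) := by
  let χ := extChartAt 𝓘(ℝ, EG) (Γ.ε x₁)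
  let y : M → EG := fun x => modelDeriv 𝓘(ℝ, EG) 𝓘(ℝ, EG) χ (Γ.ε x) (X.vec x)
  have hεs : ∀ᶠ x in 𝓝 x₁, Γ.ε x ∈ χ.source :=
    Γ.smooth_ε.continuous.continuousAt.eventually_mem (extChartAt_source_mem_nhds _)
  have hy : ∀ᶠ x in 𝓝 x₁, ContMDiffAt 𝓘(ℝ, EM) 𝓘(ℝ, EG) ∞ y x := by
    filter_upwards [hεs] with x hx
    exact ((contMDiffAt_tangentBundle_iff (v := X.vec) hx).1
      (X.smooth.contMDiffAt univ_mem)).2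
  have hq0 : ∀ᶠ x in 𝓝 x₁, χ.symm (χ (Γ.ε x) + (0 : ℝ) • y x) = Γ.ε x := by
    filter_upwards [hεs] with x hx
    rw [zero_smul, add_zero]
    exact χ.left_inv hx
  obtain ⟨s, hs, hsα, hs0, hsv⟩ := Γ.exists_fibred_deformation (contMDiffAt_chart_line (Γ := Γ) hy)
    (hq0.mono fun x hx => by simp only; rw [hx, Γ.α_ε])
  refine ⟨s, hs, hsα, ?_⟩
  filter_upwards [hq0, hsv, hεs] with x h1 h2 h3
  rw [h1] at h2
  exact h2 _ (hasVelocity_chart_line h3 _) (X.modelDeriv_α_vec x)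

/-- Multiplication of a section of the Lie algebroid by a bump function. -/
theorem exists_algebroidSection_eventuallyEq [FiniteDimensional ℝ EM] [IsManifold 𝓘(ℝ, EM) ∞ M]
    [T2Space M] {e : ∀ x : M, Γ.algebroidFiber x} {x₁ : M} {V : Set M} (hV : V ∈ 𝓝 x₁)
    (he : Γ.IsSmoothSectionOn e V) :
    ∃ X : Γ.AlgebroidSection, ∀ᶠ x in 𝓝 x₁, X.toFun x = e x := by
  obtain ⟨f, -, hf⟩ := (SmoothBumpFunction.nhds_basis_tsupport (I := 𝓘(ℝ, EM)) x₁).mem_iff.1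
    (interior_mem_nhds.2 hV)
  refine ⟨⟨fun x => f x • e x, fun x _ => ?_⟩, ?_⟩
  · rw [contMDiffWithinAt_univ]
    have hεx : Γ.ε x ∈ (extChartAt 𝓘(ℝ, EG) (Γ.ε x)).source := mem_extChartAt_source _
    refine (contMDiffAt_tangentBundle_iff (v := fun x => fiberVec (f x • e x)) hεx).2
      ⟨Γ.smooth_ε x, ?_⟩
    by_cases hx : x ∈ tsupport f
    · have h1 := ((contMDiffAt_tangentBundle_iff (v := fun x => fiberVec (e x)) hεx).1
        (he.contMDiffAt (mem_interior_iff_mem_nhds.1 (hf hx)))).2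
      simp only [map_smul]
      exact f.contMDiffAt.smul h1
    · refine (contMDiffAt_const (c := (0 : EG))).congr_of_eventuallyEq ?_
      filter_upwards [(isClosed_tsupport f).isOpen_compl.mem_nhds hx] with z hz
      rw [image_eq_zero_of_notMem_tsupport hz, zero_smul, map_zero, map_zero]
  · filter_upwards [f.eventuallyEq_one] with x hx
    simp only [hx, Pi.one_apply, one_smul]

/-- Sections of the Lie algebroid take every value. -/
theorem exists_algebroidSection_vec_eq [FiniteDimensional ℝ EG] [FiniteDimensional ℝ EM]
    [IsManifold 𝓘(ℝ, EM) ∞ M] [T2Space M] {x₁ : M} {v : EG}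
    (hv : modelDeriv 𝓘(ℝ, EG) 𝓘(ℝ, EM) Γ.α (Γ.ε x₁) v = 0) :
    ∃ X : Γ.AlgebroidSection, X.vec x₁ = v := by
  let χ := extChartAt 𝓘(ℝ, EG) (Γ.ε x₁)
  have hεs : ∀ᶠ x in 𝓝 x₁, Γ.ε x ∈ χ.source :=
    Γ.smooth_ε.continuous.continuousAt.eventually_mem (extChartAt_source_mem_nhds _)
  let w : EG := modelDeriv 𝓘(ℝ, EG) 𝓘(ℝ, EG) χ (Γ.ε x₁) v
  have hq0 : ∀ᶠ x in 𝓝 x₁, χ.symm (χ (Γ.ε x) + (0 : ℝ) • w) = Γ.ε x := by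
    filter_upwards [hεs] with x hx
    rw [zero_smul, add_zero]
    exact χ.left_inv hx
  obtain ⟨s, hs, hsα, hs0, hsv⟩ := Γ.exists_fibred_deformation
    (contMDiffAt_chart_line (Γ := Γ) (y := fun _ => w)
      (Eventually.of_forall fun _ => contMDiffAt_const))
    (hq0.mono fun x hx => by simp only; rw [hx, Γ.α_ε])
  -- The line with constant coordinate direction `w` is tangent to the `α`-fibre only at `x₁` in
  -- general. After retraction it lies in the fibre for every nearby `x`, and its velocity extends
  -- `v` to a local section.
  let u : M → EG := fun x => modelDeriv 𝓘(ℝ, ℝ) 𝓘(ℝ, EG) (fun t => s (x, t)) 0 1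
  have hic : Tendsto (fun x : M => (x, (0 : ℝ))) (𝓝 x₁) (𝓝 (x₁, 0)) :=
    (continuous_id.prodMk continuous_const).continuousAt
  have hsε : ∀ᶠ x in 𝓝 x₁, s (x, 0) = Γ.ε x := by
    filter_upwards [hs0, hq0] with x h1 h2
    rw [h1, h2]
  have hu : ∀ᶠ x in 𝓝 x₁, HasVelocity 𝓘(ℝ, EG) (fun t => s (x, t)) (Γ.ε x) (u x) := by
    filter_upwards [hic.eventually hs, hsε] with x h1 h2
    refine hasVelocity_of_mdifferentiableAt h2 ?_
    exact (h1.comp (0 : ℝ) (f := fun t : ℝ => (x, t))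
      (contMDiffAt_const.prodMk contMDiffAt_id)).mdifferentiableAt (by simp)
  have huα : ∀ᶠ x in 𝓝 x₁, modelDeriv 𝓘(ℝ, EG) 𝓘(ℝ, EM) Γ.α (Γ.ε x) (u x) = 0 := by
    filter_upwards [hu, hic.eventually hsα.eventually_nhds] with x h1 h2
    have h3 := h1.comp (Γ.smooth_α.mdifferentiable (by simp) (Γ.ε x))
    refine h3.unique ((HasVelocity.const (Γ.α (Γ.ε x))).congr ?_)
    have h4 : Tendsto (fun t : ℝ => (x, t)) (𝓝 0) (𝓝 (x, 0)) :=
      (continuous_const.prodMk continuous_id).continuousAt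
    filter_upwards [h4.eventually h2] with t ht
    rw [ht, Γ.α_ε]
  have hux : u x₁ = v := by
    have h1 := hsv.self_of_nhds v
    rw [hq0.self_of_nhds] at h1
    exact hu.self_of_nhds.unique (h1 (hasVelocity_chart_line hεs.self_of_nhds v) hv)
  classical
  -- Vertical velocities are only guaranteed near `x₁`; the default value `0` elsewhere is removed
  -- by the bump function.
  let e : ∀ x : M, Γ.algebroidFiber x := fun x =>
    if h : modelDeriv 𝓘(ℝ, EG) 𝓘(ℝ, EM) Γ.α (Γ.ε x) (u x) = 0 then ⟨u x, h⟩ else 0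
  have heu : ∀ᶠ x in 𝓝 x₁, fiberVec (e x) = u x := by
    filter_upwards [huα] with x hx
    simp only [e, dif_pos hx]
    rfl
  have hes : ∀ᶠ x in 𝓝 x₁, ContMDiffAt 𝓘(ℝ, EM) 𝓘(ℝ, EG).tangent ∞
      (fun x => (⟨Γ.ε x, (e x).1⟩ : TangentBundle 𝓘(ℝ, EG) G)) x := by
    filter_upwards [hic.eventually hs, hsε.eventually_nhds, hu.eventually_nhds,
      heu.eventually_nhds] with x h1 h2 h3 h4
    have h5 : ContMDiffAt 𝓘(ℝ, EM) 𝓘(ℝ, EG).tangent ∞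
      (fun x => (⟨s (x, 0), u x⟩ : TangentBundle 𝓘(ℝ, EG) G)) x := by
      refine ContMDiffAt.velocity (f := fun x t => s (x, t)) h1 ?_
      filter_upwards [h2, h3] with z hz1 hz2
      rwa [hz1]
    refine h5.congr_of_eventuallyEq ?_
    filter_upwards [h2, h4] with z hz1 hz2
    rw [hz1]
    exact congrArg (fun w : EG => (⟨Γ.ε z, w⟩ : TangentBundle 𝓘(ℝ, EG) G)) hz2
  obtain ⟨X, hX⟩ := exists_algebroidSection_eventuallyEq (Γ := Γ) (e := e) hes
    (fun x hx => ContMDiffAt.contMDiffWithinAt hx)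
  refine ⟨X, ?_⟩
  rw [← hux, ← heu.self_of_nhds, AlgebroidSection.vec, hX.self_of_nhds]

end LieGroupoid

/-! ### Invariant vector fields: curves, smoothness, and commutation. -/

namespace LieGroupoid

variable {EG : Type*} [NormedAddCommGroup EG] [NormedSpace ℝ EG]
  {EM : Type*} [NormedAddCommGroup EM] [NormedSpace ℝ EM]
  {G : Type*} [TopologicalSpace G] [ChartedSpace EG G]
  {M : Type*} [TopologicalSpace M] [ChartedSpace EM M]

variable [IsManifold 𝓘(ℝ, EG) ∞ G] {Γ : LieGroupoid EG EM G M}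

/-- The left-invariant vector field of a section, with values in the model space. -/
def leftVec (X : Γ.AlgebroidSection) (g : G) : EG := Γ.leftVF X g

/-- The right-invariant vector field of a section, with values in the model space. -/
def rightVec (X : Γ.AlgebroidSection) (g : G) : EG := Γ.rightVF X g

/-- The derivative of a function along a left-invariant vector field. -/
def leftDeriv (L : G → ℝ) (X : Γ.AlgebroidSection) (g : G) : ℝ :=
  modelDeriv 𝓘(ℝ, EG) 𝓘(ℝ, ℝ) L g (leftVec X g)

/-- The derivative of a function along a right-invariant vector field. -/
def rightDeriv (L : G → ℝ) (X : Γ.AlgebroidSection) (g : G) : ℝ :=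
  modelDeriv 𝓘(ℝ, EG) 𝓘(ℝ, ℝ) L g (rightVec X g)

theorem leftVec_eq (X : Γ.AlgebroidSection) (g : G) :
    leftVec X g = modelDerivWithin 𝓘(ℝ, EG) 𝓘(ℝ, EG) (fun h => Γ.mul g h) (Γ.α ⁻¹' {Γ.β g})
      (Γ.ε (Γ.β g)) (X.vec (Γ.β g)) :=
  rfl

theorem rightVec_eq (X : Γ.AlgebroidSection) (g : G) :
    rightVec X g = -modelDerivWithin 𝓘(ℝ, EG) 𝓘(ℝ, EG) (fun h => Γ.mul h g) (Γ.β ⁻¹' {Γ.α g})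
      (Γ.ε (Γ.α g)) (modelDeriv 𝓘(ℝ, EG) 𝓘(ℝ, EG) Γ.inv (Γ.ε (Γ.α g)) (X.vec (Γ.α g))) :=
  rfl

theorem hasVelocity_mul_left {c : ℝ → G} {g : G} {v : EG}
    (hc : HasVelocity 𝓘(ℝ, EG) c (Γ.ε (Γ.β g)) v) (hα : ∀ᶠ t in 𝓝 0, Γ.α (c t) = Γ.β g) :
    HasVelocity 𝓘(ℝ, EG) (fun t => Γ.mul g (c t)) g
      (modelDerivWithin 𝓘(ℝ, EG) 𝓘(ℝ, EG) (fun h => Γ.mul g h) (Γ.α ⁻¹' {Γ.β g})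
        (Γ.ε (Γ.β g)) v) := by
  have h := hc.comp_within (Γ.mdifferentiableWithinAt_mul_left g (Γ.α_ε _)) hα
  rwa [Γ.mul_ε] at h

theorem hasVelocity_leftVec {X : Γ.AlgebroidSection} {c : ℝ → G} {g : G}
    (hc : HasVelocity 𝓘(ℝ, EG) c (Γ.ε (Γ.β g)) (X.vec (Γ.β g)))
    (hα : ∀ᶠ t in 𝓝 0, Γ.α (c t) = Γ.β g) :
    HasVelocity 𝓘(ℝ, EG) (fun t => Γ.mul g (c t)) g (leftVec X g) :=
  hasVelocity_mul_left hc hα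

/-- The minus sign in the right-invariant field is carried along: the natural curve through `g` is
`c(t)⁻¹ g`, and its velocity is the opposite of the field. -/
theorem hasVelocity_rightVec {X : Γ.AlgebroidSection} {c : ℝ → G} {g : G}
    (hc : HasVelocity 𝓘(ℝ, EG) c (Γ.ε (Γ.α g)) (X.vec (Γ.α g)))
    (hα : ∀ᶠ t in 𝓝 0, Γ.α (c t) = Γ.α g) :
    HasVelocity 𝓘(ℝ, EG) (fun t => Γ.mul (Γ.inv (c t)) g) g (-rightVec X g) := by
  have h1 := hc.comp (Γ.smooth_inv.mdifferentiable (by simp) _)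
  rw [Γ.inv_ε] at h1
  have h := h1.comp_within (Γ.mdifferentiableWithinAt_mul_right g (Γ.β_ε _))
    (hα.mono fun t ht => (Γ.β_inv _).trans ht)
  rwa [Γ.ε_mul, ← neg_neg (modelDerivWithin _ _ _ _ _ _), ← rightVec_eq] at h

section FiniteDimensional

variable [FiniteDimensional ℝ EG] [FiniteDimensional ℝ EM] [IsManifold 𝓘(ℝ, EM) ∞ M]

theorem AlgebroidSection.exists_curve (X : Γ.AlgebroidSection) (x : M) :
    ∃ c : ℝ → G, (∀ᶠ t in 𝓝 0, ContMDiffAt 𝓘(ℝ, ℝ) 𝓘(ℝ, EG) ∞ c t) ∧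
      (∀ᶠ t in 𝓝 0, Γ.α (c t) = x) ∧ HasVelocity 𝓘(ℝ, EG) c (Γ.ε x) (X.vec x) := by
  obtain ⟨s, hs, hα, hv⟩ := X.exists_deformation x
  have h4 : Tendsto (fun t : ℝ => (x, t)) (𝓝 0) (𝓝 (x, 0)) :=
    (continuous_const.prodMk continuous_id).continuousAt
  refine ⟨fun t => s (x, t), ?_, h4.eventually hα, hv.self_of_nhds⟩
  filter_upwards [h4.eventually hs] with t ht
  exact ht.comp t (f := fun t : ℝ => (x, t)) (contMDiffAt_const.prodMk contMDiffAt_id)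

/-- Since `(g⁻¹ c)⁻¹ = c⁻¹ g`, inversion exchanges left- and right-invariant fields up to sign.
Facts about right-invariant fields are deduced from those about left-invariant ones in this way. -/
theorem rightVec_eq_neg_modelDeriv_inv (X : Γ.AlgebroidSection) (g : G) :
    rightVec X g = -modelDeriv 𝓘(ℝ, EG) 𝓘(ℝ, EG) Γ.inv (Γ.inv g) (leftVec X (Γ.inv g)) := by
  obtain ⟨c, -, hα, hv⟩ := X.exists_curve (Γ.α g)
  have h1 := hasVelocity_rightVec hv hα
  have hα' : ∀ᶠ t in 𝓝 0, Γ.α (c t) = Γ.β (Γ.inv g) := by simpa only [Γ.β_inv] using hα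
  have h2 := hasVelocity_leftVec (X := X) (g := Γ.inv g) (by rwa [Γ.β_inv]) hα'
  have h3 := h2.comp (Γ.smooth_inv.mdifferentiable (by simp) _)
  rw [Γ.inv_inv] at h3
  have h4 := h3.unique (h1.congr (hα'.mono fun t ht => by
    simp only
    rw [Γ.inv_mul_rev ht.symm, Γ.inv_inv]))
  rw [h4, neg_neg]

theorem modelDeriv_inv_comp_self (g : G) :
    (modelDeriv 𝓘(ℝ, EG) 𝓘(ℝ, EG) Γ.inv (Γ.inv g)).comp
      (modelDeriv 𝓘(ℝ, EG) 𝓘(ℝ, EG) Γ.inv g) = ContinuousLinearMap.id ℝ EG := by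
  rw [← modelDeriv_comp rfl (Γ.smooth_inv.mdifferentiable (by simp) _)
    (Γ.smooth_inv.mdifferentiable (by simp) _), ← modelDeriv_id (I := 𝓘(ℝ, EG)) g]
  congr 1
  funext h
  exact Γ.inv_inv h

theorem modelDeriv_inv_rightVec (X : Γ.AlgebroidSection) (g : G) :
    modelDeriv 𝓘(ℝ, EG) 𝓘(ℝ, EG) Γ.inv g (rightVec X g) = -leftVec X (Γ.inv g) := by
  have h := modelDeriv_inv_comp_self (Γ := Γ) (Γ.inv g)
  rw [Γ.inv_inv] at h
  rw [rightVec_eq_neg_modelDeriv_inv, map_neg]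
  exact congrArg Neg.neg (DFunLike.congr_fun h (leftVec X (Γ.inv g)))

theorem rightDeriv_eq_neg_leftDeriv_inv {L : G → ℝ} (hL : ContMDiff 𝓘(ℝ, EG) 𝓘(ℝ, ℝ) ∞ L)
    (X : Γ.AlgebroidSection) (g : G) :
    rightDeriv L X g = -leftDeriv (fun k => L (Γ.inv k)) X (Γ.inv g) := by
  rw [rightDeriv, leftDeriv, rightVec_eq_neg_modelDeriv_inv, map_neg,
    modelDeriv_comp (Γ.inv_inv g) (hL.mdifferentiable (by simp) _)
      (Γ.smooth_inv.mdifferentiable (by simp) _)]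
  rfl

/-- Multiplying `g` by the deformation of the identity at `β g` moves all nearby arrows at once.
Joint smoothness is what gives smooth left-invariant fields and smooth derivatives of `L` along
them. -/
theorem AlgebroidSection.exists_leftDeformation (X : Γ.AlgebroidSection) (g₁ : G) :
    ∃ N : G × ℝ → G,
      (∀ᶠ p in 𝓝 (g₁, (0 : ℝ)), ContMDiffAt (𝓘(ℝ, EG).prod 𝓘(ℝ, ℝ)) 𝓘(ℝ, EG) ∞ N p) ∧
      (∀ᶠ g in 𝓝 g₁, HasVelocity 𝓘(ℝ, EG) (fun t => N (g, t)) g (leftVec X g)) := by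
  obtain ⟨s, hs, hα, hv⟩ := X.exists_deformation (Γ.β g₁)
  have hβ : Tendsto (fun p : G × ℝ => (Γ.β p.1, p.2)) (𝓝 (g₁, 0)) (𝓝 (Γ.β g₁, 0)) :=
    ((Γ.smooth_β.continuous.comp continuous_fst).prodMk continuous_snd).continuousAt
  have hβ1 : Tendsto Γ.β (𝓝 g₁) (𝓝 (Γ.β g₁)) := Γ.smooth_β.continuous.continuousAt
  refine ⟨fun p => Γ.mul p.1 (s (Γ.β p.1, p.2)), ?_, ?_⟩
  · filter_upwards [hβ.eventually hs, (hβ.eventually hα).eventually_nhds] with p h1 h2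
    refine Γ.contMDiffAt_mul contMDiffAt_fst ?_ (h2.mono fun q hq => hq.symm)
    exact h1.comp p (((Γ.smooth_β _).comp p contMDiffAt_fst).prodMk contMDiffAt_snd)
  · have hα' := hβ1.eventually hα.curry_nhds
    filter_upwards [hβ1.eventually hv, hα'] with g h1 h2
    exact hasVelocity_leftVec h1 h2

theorem contMDiff_leftVF (X : Γ.AlgebroidSection) :
    ContMDiff 𝓘(ℝ, EG) 𝓘(ℝ, EG).tangent ∞
      (fun g => (⟨g, Γ.leftVF X g⟩ : TangentBundle 𝓘(ℝ, EG) G)) := by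
  intro g₁
  obtain ⟨N, hN, hv⟩ := X.exists_leftDeformation g₁
  let v : G → EG := leftVec X
  have h5 : ContMDiffAt 𝓘(ℝ, EG) 𝓘(ℝ, EG).tangent ∞
      (fun g => (⟨N (g, 0), v g⟩ : TangentBundle 𝓘(ℝ, EG) G)) g₁ := by
    refine ContMDiffAt.velocity (f := fun g t => N (g, t)) hN.self_of_nhds ?_
    filter_upwards [hv] with g hg
    rwa [hg.zero]
  refine h5.congr_of_eventuallyEq ?_
  filter_upwards [hv] with g hg
  rw [hg.zero]
  rfl

theorem contMDiff_leftDeriv {L : G → ℝ} (hL : ContMDiff 𝓘(ℝ, EG) 𝓘(ℝ, ℝ) ∞ L)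
    (X : Γ.AlgebroidSection) : ContMDiff 𝓘(ℝ, EG) 𝓘(ℝ, ℝ) ∞ (leftDeriv L X) := by
  intro g₁
  obtain ⟨N, hN, hv⟩ := X.exists_leftDeformation g₁
  have h5 := ContMDiffAt.deriv_zero (f := fun g t => L (N (g, t)))
    ((hL _).comp (g₁, (0 : ℝ)) hN.self_of_nhds)
  refine h5.congr_of_eventuallyEq ?_
  filter_upwards [hv] with g hg
  exact (hasVelocity_iff_hasDerivAt.1
    (hg.comp (hL.mdifferentiable (by simp) g))).2.deriv.symm

theorem contMDiff_rightDeriv {L : G → ℝ} (hL : ContMDiff 𝓘(ℝ, EG) 𝓘(ℝ, ℝ) ∞ L)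
    (X : Γ.AlgebroidSection) : ContMDiff 𝓘(ℝ, EG) 𝓘(ℝ, ℝ) ∞ (rightDeriv L X) := by
  have h : rightDeriv L X = fun g => -leftDeriv (fun k => L (Γ.inv k)) X (Γ.inv g) :=
    funext (rightDeriv_eq_neg_leftDeriv_inv hL X)
  rw [h]
  exact ((contMDiff_leftDeriv (hL.comp Γ.smooth_inv) X).comp Γ.smooth_inv).neg

/-- Left- and right-invariant vector fields commute. -/
theorem modelDeriv_leftDeriv_rightVec {L : G → ℝ} (hL : ContMDiff 𝓘(ℝ, EG) 𝓘(ℝ, ℝ) ∞ L)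
    (X Y : Γ.AlgebroidSection) (g : G) :
    modelDeriv 𝓘(ℝ, EG) 𝓘(ℝ, ℝ) (leftDeriv L Y) g (rightVec X g) =
      modelDeriv 𝓘(ℝ, EG) 𝓘(ℝ, ℝ) (rightDeriv L X) g (leftVec Y g) := by
  obtain ⟨c, hc, hcα, hcv⟩ := X.exists_curve (Γ.α g)
  obtain ⟨d, hd, hdα, hdv⟩ := Y.exists_curve (Γ.β g)
  have hLd : ∀ k, MDifferentiableAt 𝓘(ℝ, EG) 𝓘(ℝ, ℝ) L k := hL.mdifferentiable (by simp)
  have hβ : ∀ s, Γ.α (c s) = Γ.α g → Γ.β (Γ.mul (Γ.inv (c s)) g) = Γ.β g := fun s hs =>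
    Γ.β_mul _ _ (by rw [Γ.β_inv, hs])
  -- By associativity `(c(s)⁻¹ g) d(t) = c(s)⁻¹ (g d(t))`. One `t`-derivative of `H` is a left
  -- derivative of `L`, one `s`-derivative is minus a right derivative. Symmetry of the mixed
  -- partials gives the claim, with the same sign on both sides.
  let H : ℝ × ℝ → ℝ := fun p => L (Γ.mul (Γ.mul (Γ.inv (c p.1)) g) (d p.2))
  have hH : ContDiffAt ℝ 2 H (0, 0) := by
    have h1 : ContMDiffAt 𝓘(ℝ, ℝ × ℝ) 𝓘(ℝ, EG) ∞ (fun p : ℝ × ℝ => c p.1) (0, 0) :=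
      hc.self_of_nhds.comp ((0, 0) : ℝ × ℝ) contDiffAt_fst.contMDiffAt
    have h2 : ContMDiffAt 𝓘(ℝ, ℝ × ℝ) 𝓘(ℝ, EG) ∞ (fun p : ℝ × ℝ => d p.2) (0, 0) :=
      hd.self_of_nhds.comp ((0, 0) : ℝ × ℝ) contDiffAt_snd.contMDiffAt
    have e1 : ∀ᶠ p : ℝ × ℝ in 𝓝 (0, 0), Γ.α (c p.1) = Γ.α g :=
      (continuous_fst.tendsto ((0 : ℝ), (0 : ℝ))).eventually hcα
    have e2 : ∀ᶠ p : ℝ × ℝ in 𝓝 (0, 0), Γ.α (d p.2) = Γ.β g :=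
      (continuous_snd.tendsto ((0 : ℝ), (0 : ℝ))).eventually hdα
    have h3 := Γ.contMDiffAt_mul ((Γ.smooth_inv _).comp ((0, 0) : ℝ × ℝ) h1)
      (contMDiffAt_const (c := g)) (e1.mono fun p hp => (Γ.β_inv _).trans hp)
    have h4 := Γ.contMDiffAt_mul h3 h2 (by
      filter_upwards [e1, e2] with p h5 h6
      rw [h6]
      exact hβ _ h5)
    exact (contMDiffAt_iff_contDiffAt.1 ((hL _).comp ((0, 0) : ℝ × ℝ) h4)).of_le (by decide)
  have h1 : ∀ᶠ s in 𝓝 (0 : ℝ), deriv (fun t => H (s, t)) 0 =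
      leftDeriv L Y (Γ.mul (Γ.inv (c s)) g) := by
    filter_upwards [hcα] with s hs
    have h := (hasVelocity_leftVec (X := Y) (g := Γ.mul (Γ.inv (c s)) g)
      (by rwa [hβ s hs]) (by rwa [hβ s hs])).comp (hLd _)
    exact (hasVelocity_iff_hasDerivAt.1 h).2.deriv
  have h2 : ∀ᶠ t in 𝓝 (0 : ℝ), deriv (fun s => H (s, t)) 0 =
      -rightDeriv L X (Γ.mul g (d t)) := by
    filter_upwards [hdα] with t ht
    have hα : Γ.α (Γ.mul g (d t)) = Γ.α g := Γ.α_mul _ _ ht.symm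
    have h := (hasVelocity_rightVec (X := X) (g := Γ.mul g (d t))
      (by rwa [hα]) (by rwa [hα])).comp (hLd _)
    rw [map_neg] at h
    refine (hasVelocity_iff_hasDerivAt.1 (h.congr ?_)).2.deriv
    filter_upwards [hcα] with s hs
    simp only [H]
    rw [Γ.mul_assoc _ _ _ (by rw [Γ.β_inv, hs]) ht.symm]
  have h3 : deriv (fun s => leftDeriv L Y (Γ.mul (Γ.inv (c s)) g)) 0 =
      -modelDeriv 𝓘(ℝ, EG) 𝓘(ℝ, ℝ) (leftDeriv L Y) g (rightVec X g) := by
    rw [← map_neg]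
    exact (hasVelocity_iff_hasDerivAt.1 ((hasVelocity_rightVec hcv hcα).comp
      ((contMDiff_leftDeriv hL Y).mdifferentiable (by simp) g))).2.deriv
  have h4 : deriv (fun t => -rightDeriv L X (Γ.mul g (d t))) 0 =
      -modelDeriv 𝓘(ℝ, EG) 𝓘(ℝ, ℝ) (rightDeriv L X) g (leftVec Y g) := by
    rw [deriv.fun_neg]
    exact congrArg Neg.neg (hasVelocity_iff_hasDerivAt.1 ((hasVelocity_leftVec hdv hdα).comp
      ((contMDiff_rightDeriv hL X).mdifferentiable (by simp) g))).2.deriv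
  have := deriv_deriv_comm hH
  rw [Filter.EventuallyEq.deriv_eq h1, Filter.EventuallyEq.deriv_eq h2, h3, h4] at this
  exact neg_injective this

end FiniteDimensional

end LieGroupoid

/-- Injectivity of the flip is surjectivity onto the dual, which for equal dimensions is the same as
injectivity. -/
theorem LinearMap.injective_iff_injective_flip {K : Type*} [Field K] {V₁ V₂ : Type*}
    [AddCommGroup V₁] [AddCommGroup V₂] [Module K V₁] [Module K V₂] [FiniteDimensional K V₁]
    [FiniteDimensional K V₂] (h : Module.finrank K V₁ = Module.finrank K V₂)
    (B : V₁ →ₗ[K] V₂ →ₗ[K] K) : Function.Injective B ↔ Function.Injective B.flip := by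
  rw [LinearMap.flip_injective_iff₁]
  exact LinearMap.injective_iff_surjective_of_finrank_eq_finrank
    (h.trans Subspace.dual_finrank_eq.symm)

/-! ### The mixed derivative form and the Poincaré–Cartan section. -/

namespace LieGroupoid

variable {EG : Type*} [NormedAddCommGroup EG] [NormedSpace ℝ EG]
  {EM : Type*} [NormedAddCommGroup EM] [NormedSpace ℝ EM]
  {G : Type*} [TopologicalSpace G] [ChartedSpace EG G]
  {M : Type*} [TopologicalSpace M] [ChartedSpace EM M]
  [IsManifold 𝓘(ℝ, EG) ∞ G] [FiniteDimensional ℝ EG] [FiniteDimensional ℝ EM]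
  [IsManifold 𝓘(ℝ, EM) ∞ M]

/-- A coordinate line has velocity `w` but may leave the fibre. Its retraction stays there and keeps
the velocity, because `w` is vertical. -/
theorem exists_fibre_curve (Γ : LieGroupoid EG EM G M) {g : G} {w : EG}
    (hw : modelDeriv 𝓘(ℝ, EG) 𝓘(ℝ, EM) Γ.α g w = 0) :
    ∃ c : ℝ → G, (∀ᶠ t in 𝓝 0, Γ.α (c t) = Γ.α g) ∧ HasVelocity 𝓘(ℝ, EG) c g w := by
  obtain ⟨r, hr, hrα, hrid⟩ := Γ.exists_retraction g
  have hg : g ∈ (extChartAt 𝓘(ℝ, EG) g).source := mem_extChartAt_source g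
  have hq := hasVelocity_chart_line hg w
  set q : ℝ → G := fun t => (extChartAt 𝓘(ℝ, EG) g).symm
    (extChartAt 𝓘(ℝ, EG) g g + t • modelDeriv 𝓘(ℝ, EG) 𝓘(ℝ, EG) (extChartAt 𝓘(ℝ, EG) g) g w)
  have hq0 := hq.continuousAt
  rw [ContinuousAt, hq.zero] at hq0
  have hrd : MDifferentiableAt (𝓘(ℝ, EM).prod 𝓘(ℝ, EG)) 𝓘(ℝ, EG) r (Γ.α g, g) :=
    hr.self_of_nhds.mdifferentiableAt (by simp)
  have h1 := ((hq.comp (Γ.smooth_α.mdifferentiable (by simp) g)).prodMk hq).comp hrd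
  have h2 := ((HasVelocity.const (I := 𝓘(ℝ, EM)) (Γ.α g)).prodMk hq).comp hrd
  rw [hw] at h1
  have hr0 : r (Γ.α g, g) = g := hrid.self_of_nhds
  rw [hr0] at h1 h2
  have h3 := hq.unique (h1.congr ((hq0.eventually hrid).mono fun t ht => ht.symm))
  rw [← h3] at h2
  refine ⟨_, ?_, h2⟩
  have h4 : Tendsto (fun t => (Γ.α g, q t)) (𝓝 0) (𝓝 (Γ.α g, g)) :=
    tendsto_const_nhds.prodMk_nhds hq0
  exact h4.eventually hrα

section Invariant

variable {Γ : LieGroupoid EG EM G M}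

theorem modelDeriv_α_leftVec (X : Γ.AlgebroidSection) (g : G) :
    modelDeriv 𝓘(ℝ, EG) 𝓘(ℝ, EM) Γ.α g (leftVec X g) = 0 := by
  obtain ⟨c, -, hα, hv⟩ := X.exists_curve (Γ.β g)
  have h := (hasVelocity_leftVec hv hα).comp (Γ.smooth_α.mdifferentiable (by simp) g)
  exact (h.congr (hα.mono fun t ht => (Γ.α_mul _ _ ht.symm).symm)).unique
    (HasVelocity.const (I := 𝓘(ℝ, EM)) (Γ.α g))

/-- Left translation by `g⁻¹` undoes left translation by `g` on curves in the fibre. -/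
theorem leftVec_eq_zero_iff {X : Γ.AlgebroidSection} {g : G} :
    leftVec X g = 0 ↔ X.vec (Γ.β g) = 0 := by
  constructor
  · intro h
    obtain ⟨c, -, hα, hv⟩ := X.exists_curve (Γ.β g)
    have h1 := hasVelocity_leftVec hv hα
    rw [h] at h1
    have h2 := h1.comp_within (Γ.mdifferentiableWithinAt_mul_left (Γ.inv g) (h := g)
      (Γ.β_inv g).symm) (hα.mono fun t ht => by
        rw [mem_preimage, Γ.α_mul _ _ ht.symm, Γ.β_inv]; rfl)
    rw [map_zero, Γ.inv_mul] at h2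
    exact (h2.congr (hα.mono fun t ht => (Γ.inv_mul_cancel_left ht.symm).symm)).unique hv |>.symm
  · intro h
    rw [leftVec_eq, h, map_zero]

/-- Translate a fibre curve with velocity `w` back by `g⁻¹` to the identity at `β g` and extend its
velocity there to a section. -/
theorem exists_leftVec_eq [T2Space M] {g : G} {w : EG}
    (hw : modelDeriv 𝓘(ℝ, EG) 𝓘(ℝ, EM) Γ.α g w = 0) :
    ∃ X : Γ.AlgebroidSection, leftVec X g = w := by
  obtain ⟨c, hα, hv⟩ := Γ.exists_fibre_curve hw
  have h1 := hv.comp_within (Γ.mdifferentiableWithinAt_mul_left (Γ.inv g) (h := g)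
      (Γ.β_inv g).symm) (hα.mono fun t ht => by rw [mem_preimage, ht, Γ.β_inv]; rfl)
  rw [Γ.inv_mul] at h1
  have hα' : ∀ᶠ t in 𝓝 0, Γ.α (Γ.mul (Γ.inv g) (c t)) = Γ.β g :=
    hα.mono fun t ht => by rw [Γ.α_mul _ _ (by rw [Γ.β_inv, ht]), Γ.α_inv]
  have h2 := h1.comp (Γ.smooth_α.mdifferentiable (by simp) (Γ.ε (Γ.β g)))
  rw [Γ.α_ε] at h2
  obtain ⟨X, hX⟩ := exists_algebroidSection_vec_eq ((h2.congr (hα'.mono fun t ht =>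
    ht.symm)).unique (HasVelocity.const (I := 𝓘(ℝ, EM)) (Γ.β g)))
  refine ⟨X, ?_⟩
  have h3 := hasVelocity_leftVec (X := X) (g := g) (hX ▸ h1) hα'
  exact (h3.congr (hα.mono fun t ht => (Γ.mul_inv_cancel_left ht.symm).symm)).unique hv

theorem modelDeriv_inv_injective (g : G) :
    Function.Injective (modelDeriv 𝓘(ℝ, EG) 𝓘(ℝ, EG) Γ.inv g) := fun v w h => by
  have h1 := DFunLike.congr_fun (modelDeriv_inv_comp_self (Γ := Γ) g)
  have hv := h1 v
  have hw := h1 w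
  simp only [ContinuousLinearMap.comp_apply, ContinuousLinearMap.id_apply] at hv hw
  rw [← hv, ← hw, h]

theorem modelDeriv_α_modelDeriv_inv (g : G) (w : EG) :
    modelDeriv 𝓘(ℝ, EG) 𝓘(ℝ, EM) Γ.α (Γ.inv g) (modelDeriv 𝓘(ℝ, EG) 𝓘(ℝ, EG) Γ.inv g w) =
      modelDeriv 𝓘(ℝ, EG) 𝓘(ℝ, EM) Γ.β g w := by
  have h := modelDeriv_comp (x := g) rfl (Γ.smooth_α.mdifferentiable (by simp) (Γ.inv g))
    (Γ.smooth_inv.mdifferentiable (by simp) g)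
  simp only [Γ.α_inv] at h
  rw [h]
  rfl

theorem modelDeriv_β_rightVec (X : Γ.AlgebroidSection) (g : G) :
    modelDeriv 𝓘(ℝ, EG) 𝓘(ℝ, EM) Γ.β g (rightVec X g) = 0 := by
  rw [← modelDeriv_α_modelDeriv_inv, modelDeriv_inv_rightVec, map_neg, modelDeriv_α_leftVec,
    neg_zero]

theorem rightVec_eq_zero_iff {X : Γ.AlgebroidSection} {g : G} :
    rightVec X g = 0 ↔ X.vec (Γ.α g) = 0 := by
  rw [← Γ.β_inv, ← leftVec_eq_zero_iff, ← neg_eq_zero (a := leftVec X _),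
    ← modelDeriv_inv_rightVec, map_eq_zero_iff _ (modelDeriv_inv_injective g)]

theorem exists_rightVec_eq [T2Space M] {g : G} {w : EG}
    (hw : modelDeriv 𝓘(ℝ, EG) 𝓘(ℝ, EM) Γ.β g w = 0) :
    ∃ X : Γ.AlgebroidSection, rightVec X g = w := by
  rw [← modelDeriv_α_modelDeriv_inv, ← neg_eq_zero, ← map_neg] at hw
  obtain ⟨X, hX⟩ := exists_leftVec_eq hw
  refine ⟨X, modelDeriv_inv_injective (Γ := Γ) g ?_⟩
  rw [modelDeriv_inv_rightVec, hX, neg_neg]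

theorem finrank_ker_modelDeriv_α (g : G) :
    Module.finrank ℝ EM + Module.finrank ℝ
      (LinearMap.ker (modelDeriv 𝓘(ℝ, EG) 𝓘(ℝ, EM) Γ.α g).toLinearMap) = Module.finrank ℝ EG := by
  have h := LinearMap.finrank_range_add_finrank_ker
    (modelDeriv 𝓘(ℝ, EG) 𝓘(ℝ, EM) Γ.α g).toLinearMap
  have hs : Function.Surjective (modelDeriv 𝓘(ℝ, EG) 𝓘(ℝ, EM) Γ.α g).toLinearMap :=
    Γ.submersion_α g
  rwa [LinearMap.range_eq_top.2 hs, finrank_top] at h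

theorem finrank_ker_modelDeriv_β (g : G) :
    Module.finrank ℝ EM + Module.finrank ℝ
      (LinearMap.ker (modelDeriv 𝓘(ℝ, EG) 𝓘(ℝ, EM) Γ.β g).toLinearMap) = Module.finrank ℝ EG := by
  have h := LinearMap.finrank_range_add_finrank_ker
    (modelDeriv 𝓘(ℝ, EG) 𝓘(ℝ, EM) Γ.β g).toLinearMap
  have hs : Function.Surjective (modelDeriv 𝓘(ℝ, EG) 𝓘(ℝ, EM) Γ.β g).toLinearMap :=
    Γ.submersion_β g
  rwa [LinearMap.range_eq_top.2 hs, finrank_top] at h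

end Invariant

section Nondegeneracy

variable {Γ : LieGroupoid EG EM G M}

variable (Γ) in
/-- The mixed derivative of `L` along right- and left-invariant vector fields has trivial kernel
in the right-invariant argument. -/
def MixedNondegenerateAt (L : G → ℝ) (g : G) : Prop :=
  ∀ X : Γ.AlgebroidSection,
    (∀ Y : Γ.AlgebroidSection, modelDeriv 𝓘(ℝ, EG) 𝓘(ℝ, ℝ) (leftDeriv L Y) g (rightVec X g) = 0) →
      rightVec X g = 0

variable [T2Space M] {L : G → ℝ}

/-- `α` and `β` are both submersions onto `M`, so their kernels at `g` have equal dimension. A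
pairing between them has no left kernel iff it has no right kernel. -/
theorem mixedNondegenerateAt_iff_left (hL : ContMDiff 𝓘(ℝ, EG) 𝓘(ℝ, ℝ) ∞ L) (g : G) :
    Γ.MixedNondegenerateAt L g ↔ ∀ Y : Γ.AlgebroidSection,
      (∀ X : Γ.AlgebroidSection, modelDeriv 𝓘(ℝ, EG) 𝓘(ℝ, ℝ) (leftDeriv L Y) g (rightVec X g) = 0) →
        leftVec Y g = 0 := by
  let K := LinearMap.ker (modelDeriv 𝓘(ℝ, EG) 𝓘(ℝ, EM) Γ.β g).toLinearMap
  let H := LinearMap.ker (modelDeriv 𝓘(ℝ, EG) 𝓘(ℝ, EM) Γ.α g).toLinearMap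
  choose ρ hρ using fun k : K => exists_rightVec_eq (Γ := Γ) (LinearMap.mem_ker.1 k.2)
  choose lam hlam using fun k : H => exists_leftVec_eq (Γ := Γ) (LinearMap.mem_ker.1 k.2)
  have hρ' : ∀ X : Γ.AlgebroidSection, rightVec X g ∈ K := fun X => modelDeriv_β_rightVec X g
  have hlam' : ∀ X : Γ.AlgebroidSection, leftVec X g ∈ H := fun X => modelDeriv_α_leftVec X g
  have hcomm : ∀ (k : K) (h : H), modelDeriv 𝓘(ℝ, EG) 𝓘(ℝ, ℝ) (leftDeriv L (lam h)) g k =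
      modelDeriv 𝓘(ℝ, EG) 𝓘(ℝ, ℝ) (rightDeriv L (ρ k)) g h := by
    intro k h
    rw [← hρ k, modelDeriv_leftDeriv_rightVec hL, hlam]
  -- Linearity in `k` is that of a differential. Linearity in `h`, and independence of the chosen
  -- section `lam h`, come from commutation, which rewrites the value as a differential applied to
  -- `h`.
  let B : K →ₗ[ℝ] H →ₗ[ℝ] ℝ := LinearMap.mk₂ ℝ
    (fun k h => modelDeriv 𝓘(ℝ, EG) 𝓘(ℝ, ℝ) (leftDeriv L (lam h)) g k)
    (fun k k' h => by simp) (fun a k h => by simp)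
    (fun k h h' => by simp only [hcomm]; simp) (fun a k h => by simp only [hcomm]; simp)
  have hB : ∀ X Y : Γ.AlgebroidSection, B ⟨_, hρ' X⟩ ⟨_, hlam' Y⟩ =
      modelDeriv 𝓘(ℝ, EG) 𝓘(ℝ, ℝ) (leftDeriv L Y) g (rightVec X g) := by
    intro X Y
    change modelDeriv 𝓘(ℝ, EG) 𝓘(ℝ, ℝ) (leftDeriv L (lam ⟨_, hlam' Y⟩)) g (rightVec X g) = _
    rw [modelDeriv_leftDeriv_rightVec hL, modelDeriv_leftDeriv_rightVec hL, hlam]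
  have hdim : Module.finrank ℝ K = Module.finrank ℝ H := by
    have h1 := finrank_ker_modelDeriv_α (Γ := Γ) g
    have h2 := finrank_ker_modelDeriv_β (Γ := Γ) g
    exact Nat.add_left_cancel (h2.trans h1.symm)
  have hleft : Γ.MixedNondegenerateAt L g ↔ Function.Injective B := by
    rw [injective_iff_map_eq_zero]
    constructor
    · intro h k hk
      have h1 := h (ρ k) fun Y => by
        rw [← hB]
        have : (⟨_, hρ' (ρ k)⟩ : K) = k := Subtype.ext (hρ k)
        rw [this, hk]
        rfl
      exact Subtype.ext ((hρ k).symm.trans h1)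
    · intro h X hX
      refine congrArg Subtype.val (h ⟨_, hρ' X⟩ (LinearMap.ext fun k => ?_))
      have h1 := hX (lam k)
      rw [← hB] at h1
      have : (⟨_, hlam' (lam k)⟩ : H) = k := Subtype.ext (hlam k)
      rwa [this] at h1
  rw [hleft, LinearMap.injective_iff_injective_flip hdim, injective_iff_map_eq_zero]
  constructor
  · intro h Y hY
    refine congrArg Subtype.val (h ⟨_, hlam' Y⟩ (LinearMap.ext fun k => ?_))
    have h1 := hY (ρ k)
    rw [← hB] at h1
    have : (⟨_, hρ' (ρ k)⟩ : K) = k := Subtype.ext (hρ k)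
    rwa [this] at h1
  · intro h k hk
    have h1 := h (lam k) fun X => by
      rw [← hB]
      have : (⟨_, hlam' (lam k)⟩ : H) = k := Subtype.ext (hlam k)
      rw [this]
      exact DFunLike.congr_fun hk _
    exact Subtype.ext ((hlam k).symm.trans h1)

theorem exists_vec_eq_zero (x : M) : ∃ X : Γ.AlgebroidSection, X.vec x = 0 :=
  exists_algebroidSection_vec_eq (map_zero _)

/-- The derivatives of `L` along two left-invariant fields form a commutator, which the bracket term
of the differential cancels. Only mixed derivatives survive. -/
theorem poincareCartan_eq (hL : ContMDiff 𝓘(ℝ, EG) 𝓘(ℝ, ℝ) ∞ L) (ξ η : Γ.PSection) (g : G) :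
    poincareCartan L ξ η g =
      modelDeriv 𝓘(ℝ, EG) 𝓘(ℝ, ℝ) (leftDeriv L ξ.Y) g (rightVec η.X g) -
        modelDeriv 𝓘(ℝ, EG) 𝓘(ℝ, ℝ) (leftDeriv L η.Y) g (rightVec ξ.X g) := by
  have : CompleteSpace EG := FiniteDimensional.complete ℝ EG
  have h1 := modelDeriv_mlieBracket_apply (x := g) (F := L)
    ((contMDiff_leftVF ξ.Y).mdifferentiable (by simp) g)
    ((contMDiff_leftVF η.Y).mdifferentiable (by simp) g) hL
  have h2 : poincareCartan L ξ η g =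
      -(modelDeriv 𝓘(ℝ, EG) 𝓘(ℝ, ℝ) (leftDeriv L η.Y) g (rightVec ξ.X g + leftVec ξ.Y g) -
        modelDeriv 𝓘(ℝ, EG) 𝓘(ℝ, ℝ) (leftDeriv L ξ.Y) g (rightVec η.X g + leftVec η.Y g) -
        modelDeriv 𝓘(ℝ, EG) 𝓘(ℝ, ℝ) L g
          (VectorField.mlieBracket 𝓘(ℝ, EG) (Γ.leftVF ξ.Y) (Γ.leftVF η.Y) g)) := rfl
  have h3 : modelDeriv 𝓘(ℝ, EG) 𝓘(ℝ, ℝ) L g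
      (VectorField.mlieBracket 𝓘(ℝ, EG) (Γ.leftVF ξ.Y) (Γ.leftVF η.Y) g) =
      modelDeriv 𝓘(ℝ, EG) 𝓘(ℝ, ℝ) (leftDeriv L η.Y) g (leftVec ξ.Y g) -
      modelDeriv 𝓘(ℝ, EG) 𝓘(ℝ, ℝ) (leftDeriv L ξ.Y) g (leftVec η.Y g) := h1
  rw [h2, h3, map_add, map_add]
  ring

theorem poincareCartanNondegenerateAt_iff (hL : ContMDiff 𝓘(ℝ, EG) 𝓘(ℝ, ℝ) ∞ L) (g : G) :
    Γ.PoincareCartanNondegenerateAt L g ↔ Γ.MixedNondegenerateAt L g := by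
  -- Test sections vanishing at the relevant point isolate one component of the other argument.
  -- Vanishing of `Y₀` at `β g` does not make its left derivative of `L` vanish near `g`, so
  -- commutation is needed before `hY₀` can be used.
  obtain ⟨X₀, hX₀⟩ := exists_vec_eq_zero (Γ := Γ) (Γ.α g)
  obtain ⟨Y₀, hY₀⟩ := exists_vec_eq_zero (Γ := Γ) (Γ.β g)
  rw [← rightVec_eq_zero_iff] at hX₀
  rw [← leftVec_eq_zero_iff] at hY₀
  constructor
  · intro h X hX
    refine congrArg Prod.fst (h ⟨X, Y₀⟩ fun η => ?_)
    rw [poincareCartan_eq hL, hX, modelDeriv_leftDeriv_rightVec hL]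
    simp [hY₀]
  · intro h ξ hξ
    simp only [poincareCartan_eq hL] at hξ
    refine Prod.ext (h ξ.X fun Y => ?_) ((mixedNondegenerateAt_iff_left hL g).1 h ξ.Y fun X => ?_)
    · simpa [hX₀] using hξ ⟨X₀, Y⟩
    · have h1 := hξ ⟨X, Y₀⟩
      rw [modelDeriv_leftDeriv_rightVec hL _ Y₀] at h1
      simpa [hY₀] using h1

end Nondegeneracy

end LieGroupoid

/-! ### The Legendre transformations in local frames. -/

namespace LieGroupoid

variable {EG : Type*} [NormedAddCommGroup EG] [NormedSpace ℝ EG]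
  {EM : Type*} [NormedAddCommGroup EM] [NormedSpace ℝ EM]
  {G : Type*} [TopologicalSpace G] [ChartedSpace EG G]
  {M : Type*} [TopologicalSpace M] [ChartedSpace EM M]
  [IsManifold 𝓘(ℝ, EG) ∞ G] [FiniteDimensional ℝ EG] [FiniteDimensional ℝ EM]
  [IsManifold 𝓘(ℝ, EM) ∞ M] {Γ : LieGroupoid EG EM G M} {L : G → ℝ}

theorem legendrePlus_apply (hL : ContMDiff 𝓘(ℝ, EG) 𝓘(ℝ, ℝ) ∞ L) (X : Γ.AlgebroidSection)
    (g : G) : (Γ.legendrePlus L g).2 (X.toFun (Γ.β g)) = leftDeriv L X g := by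
  obtain ⟨c, -, hα, hv⟩ := X.exists_curve (Γ.β g)
  have h1 := (hasVelocity_leftVec hv hα).comp (hL.mdifferentiable (by simp) g)
  have hd : MDifferentiableWithinAt 𝓘(ℝ, EG) 𝓘(ℝ, ℝ) (fun h => L (Γ.mul g h))
      (Γ.α ⁻¹' {Γ.β g}) (Γ.ε (Γ.β g)) :=
    (hL.mdifferentiable (by simp) _).comp_mdifferentiableWithinAt _
      (Γ.mdifferentiableWithinAt_mul_left g (Γ.α_ε _))
  have h2 := hv.comp_within hd hα
  rw [Γ.mul_ε] at h2
  exact h2.unique h1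

/-- Two signs cancel: the one in the definition of the transformation and that of the velocity of
`c(t)⁻¹ g`. -/
theorem legendreMinus_apply (hL : ContMDiff 𝓘(ℝ, EG) 𝓘(ℝ, ℝ) ∞ L) (X : Γ.AlgebroidSection)
    (g : G) : (Γ.legendreMinus L g).2 (X.toFun (Γ.α g)) = rightDeriv L X g := by
  obtain ⟨c, -, hα, hv⟩ := X.exists_curve (Γ.α g)
  have h1 := (hasVelocity_rightVec hv hα).comp (hL.mdifferentiable (by simp) g)
  have hd : MDifferentiableWithinAt 𝓘(ℝ, EG) 𝓘(ℝ, ℝ) (fun k => L (Γ.mul (Γ.inv k) g))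
      (Γ.α ⁻¹' {Γ.α g}) (Γ.ε (Γ.α g)) := by
    refine (hL.mdifferentiable (by simp) _).comp_mdifferentiableWithinAt _ ?_
    refine (Γ.mdifferentiableWithinAt_mul_right g (h := Γ.inv (Γ.ε (Γ.α g))) ?_).comp (Γ.ε (Γ.α g))
      (Γ.smooth_inv.mdifferentiable (by simp) _).mdifferentiableWithinAt ?_
    · rw [Γ.β_inv, Γ.α_ε]
    · intro k hk
      exact (Γ.β_inv k).trans hk
  have h2 := hv.comp_within hd hα
  rw [Γ.inv_ε, Γ.ε_mul] at h2
  have h3 := h2.unique h1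
  rw [map_neg] at h3
  exact (congrArg Neg.neg h3).trans (neg_neg _)

theorem isDELSolution_iff {g h : G} : Γ.IsDELSolution L g h ↔
    Γ.β g = Γ.α h ∧ ∀ X : Γ.AlgebroidSection, leftDeriv L X g = rightDeriv L X h :=
  and_congr_right fun _ => forall_congr' fun _ => sub_eq_zero

/-- A family of sections of the Lie algebroid that is a frame of it near `x₁`. -/
def IsFrameNear {k : ℕ} (E : Fin k → Γ.AlgebroidSection) (x₁ : M) : Prop :=
  ∀ᶠ x in 𝓝 x₁, LinearIndependent ℝ (fun γ => (E γ).toFun x) ∧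
    Submodule.span ℝ (range fun γ => (E γ).toFun x) = ⊤

/-- The smooth structure of the dual bundle is tested on local frames, whereas invariant fields come
from global sections. A cutoff identifies the two near the point. -/
theorem exists_isFrameNear [T2Space M] {k : ℕ} {V : Set M} {e : Fin k → ∀ x : M, Γ.algebroidFiber x}
    (hV : IsOpen V) {x₁ : M} (hx₁ : x₁ ∈ V) (hs : ∀ γ, Γ.IsSmoothSectionOn (e γ) V)
    (he : ∀ x ∈ V, LinearIndependent ℝ (fun γ => e γ x) ∧
      Submodule.span ℝ (range fun γ => e γ x) = ⊤) :
    ∃ E : Fin k → Γ.AlgebroidSection, IsFrameNear E x₁ ∧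
      ∀ᶠ x in 𝓝 x₁, ∀ γ, (E γ).toFun x = e γ x := by
  choose E hE using fun γ => exists_algebroidSection_eventuallyEq (hV.mem_nhds hx₁) (hs γ)
  have hE' : ∀ᶠ x in 𝓝 x₁, ∀ γ, (E γ).toFun x = e γ x := eventually_all.2 hE
  refine ⟨E, ?_, hE'⟩
  filter_upwards [hE', hV.mem_nhds hx₁] with x h1 h2
  simp only [h1]
  exact he x h2

section Frame

variable {k : ℕ} {E : Fin k → Γ.AlgebroidSection}

theorem finrank_add_of_frame {x : M} (hli : LinearIndependent ℝ (fun γ => (E γ).toFun x))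
    (hsp : Submodule.span ℝ (range fun γ => (E γ).toFun x) = ⊤) :
    Module.finrank ℝ EM + k = Module.finrank ℝ EG := by
  have h := finrank_ker_modelDeriv_α (Γ := Γ) (Γ.ε x)
  have h2 : Module.finrank ℝ (LinearMap.ker
      (modelDeriv 𝓘(ℝ, EG) 𝓘(ℝ, EM) Γ.α (Γ.ε x)).toLinearMap) = k := by
    have h3 := finrank_span_eq_card hli
    rw [hsp, finrank_top, Fintype.card_fin] at h3
    exact h3
  rwa [h2] at h

theorem vec_mem_span_of_frame {x : M}
    (hsp : Submodule.span ℝ (range fun γ => (E γ).toFun x) = ⊤) (X : Γ.AlgebroidSection) :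
    ∃ a : Fin k → ℝ, X.vec x = ∑ γ, a γ • (E γ).vec x := by
  have h : X.toFun x ∈ Submodule.span ℝ (range fun γ => (E γ).toFun x) := by
    rw [hsp]; trivial
  obtain ⟨a, ha⟩ := (Submodule.mem_span_range_iff_exists_fun ℝ).1 h
  refine ⟨a, ?_⟩
  have h1 := congrArg fiberVec ha
  rw [map_sum] at h1
  simp only [map_smul] at h1
  exact h1.symm

theorem leftVec_eq_sum {g : G} {X : Γ.AlgebroidSection} {a : Fin k → ℝ}
    (h : X.vec (Γ.β g) = ∑ γ, a γ • (E γ).vec (Γ.β g)) :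
    leftVec X g = ∑ γ, a γ • leftVec (E γ) g := by
  simp only [leftVec_eq, h, map_sum, map_smul]

theorem rightVec_eq_sum {g : G} {X : Γ.AlgebroidSection} {a : Fin k → ℝ}
    (h : X.vec (Γ.α g) = ∑ γ, a γ • (E γ).vec (Γ.α g)) :
    rightVec X g = ∑ γ, a γ • rightVec (E γ) g := by
  simp only [rightVec_eq, h, map_sum, map_smul, Finset.sum_neg_distrib, smul_neg]

/-- The discrete Legendre transformation `F⁺L` in the trivialization given by a frame. -/
def framePlus (L : G → ℝ) (E : Fin k → Γ.AlgebroidSection) (g : G) : M × (Fin k → ℝ) :=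
  (Γ.β g, fun γ => leftDeriv L (E γ) g)

/-- The discrete Legendre transformation `F⁻L` in the trivialization given by a frame. -/
def frameMinus (L : G → ℝ) (E : Fin k → Γ.AlgebroidSection) (g : G) : M × (Fin k → ℝ) :=
  (Γ.α g, fun γ => rightDeriv L (E γ) g)

theorem contMDiff_framePlus (hL : ContMDiff 𝓘(ℝ, EG) 𝓘(ℝ, ℝ) ∞ L) :
    ContMDiff 𝓘(ℝ, EG) (𝓘(ℝ, EM).prod 𝓘(ℝ, Fin k → ℝ)) ∞ (framePlus L E) :=
  Γ.smooth_β.prodMk (contMDiff_pi_space.2 fun γ => contMDiff_leftDeriv hL (E γ))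

theorem contMDiff_frameMinus (hL : ContMDiff 𝓘(ℝ, EG) 𝓘(ℝ, ℝ) ∞ L) :
    ContMDiff 𝓘(ℝ, EG) (𝓘(ℝ, EM).prod 𝓘(ℝ, Fin k → ℝ)) ∞ (frameMinus L E) :=
  Γ.smooth_α.prodMk (contMDiff_pi_space.2 fun γ => contMDiff_rightDeriv hL (E γ))

theorem modelDeriv_prodMk_pi {f : G → M} {F : Fin k → G → ℝ} {g : G} (w : EG)
    (hf : MDifferentiableAt 𝓘(ℝ, EG) 𝓘(ℝ, EM) f g)
    (hF : ∀ γ, ContMDiffAt 𝓘(ℝ, EG) 𝓘(ℝ, ℝ) ∞ (F γ) g) :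
    modelDeriv 𝓘(ℝ, EG) (𝓘(ℝ, EM).prod 𝓘(ℝ, Fin k → ℝ)) (fun h => (f h, fun γ => F γ h)) g w =
      (modelDeriv 𝓘(ℝ, EG) 𝓘(ℝ, EM) f g w,
        fun γ => modelDeriv 𝓘(ℝ, EG) 𝓘(ℝ, ℝ) (F γ) g w) := by
  have hq := hasVelocity_chart_line (mem_extChartAt_source (I := 𝓘(ℝ, EG)) g) w
  have hpi : MDifferentiableAt 𝓘(ℝ, EG) 𝓘(ℝ, Fin k → ℝ) (fun h γ => F γ h) g :=
    (contMDiffAt_pi_space.2 hF).mdifferentiableAt (by simp)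
  have h0 := fun γ => hq.comp ((hF γ).mdifferentiableAt (by simp))
  have h1 := hq.comp (hf.prodMk hpi)
  have h2 := (hq.comp hf).prodMk (hasVelocity_iff_hasDerivAt.2
    ⟨funext fun γ => (h0 γ).zero,
      hasDerivAt_pi.2 fun γ => (hasVelocity_iff_hasDerivAt.1 (h0 γ)).2⟩)
  exact h1.unique h2

/-- Source and target have the same dimension, so an injective differential is bijective and the
inverse function theorem applies. -/
theorem isLocalDiffeomorphAt_iff_of_finrank (hdim : Module.finrank ℝ EM + k = Module.finrank ℝ EG)
    {f : G → M × (Fin k → ℝ)} {g : G}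
    (hf : ContMDiff 𝓘(ℝ, EG) (𝓘(ℝ, EM).prod 𝓘(ℝ, Fin k → ℝ)) ∞ f) :
    IsLocalDiffeomorphAt 𝓘(ℝ, EG) (𝓘(ℝ, EM).prod 𝓘(ℝ, Fin k → ℝ)) ∞ f g ↔
      ∀ w, modelDeriv 𝓘(ℝ, EG) (𝓘(ℝ, EM).prod 𝓘(ℝ, Fin k → ℝ)) f g w = 0 → w = 0 := by
  have : CompleteSpace EG := FiniteDimensional.complete ℝ EG
  have : CompleteSpace EM := FiniteDimensional.complete ℝ EM
  rw [← injective_iff_map_eq_zero]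
  refine ⟨fun h => h.modelDeriv_bijective.1, fun h => ?_⟩
  refine isLocalDiffeomorphAt_of_modelDeriv_bijective (Eventually.of_forall fun y => hf y) ⟨h, ?_⟩
  refine (LinearMap.injective_iff_surjective_of_finrank_eq_finrank (f := (modelDeriv 𝓘(ℝ, EG)
    (𝓘(ℝ, EM).prod 𝓘(ℝ, Fin k → ℝ)) f g).toLinearMap) ?_).1 h
  rw [Module.finrank_prod, Module.finrank_fin_fun, hdim]

variable [T2Space M]

/-- The `β`-component restricts the kernel of the differential to right-invariant vectors. On these
the remaining components are the mixed form against the frame, and the frame suffices because the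
form depends linearly on the left-invariant vector at `g`. -/
theorem isLocalDiffeomorphAt_framePlus_iff (hL : ContMDiff 𝓘(ℝ, EG) 𝓘(ℝ, ℝ) ∞ L) {g : G}
    (hE : IsFrameNear E (Γ.β g)) :
    IsLocalDiffeomorphAt 𝓘(ℝ, EG) (𝓘(ℝ, EM).prod 𝓘(ℝ, Fin k → ℝ)) ∞ (framePlus L E) g ↔
      Γ.MixedNondegenerateAt L g := by
  obtain ⟨hli, hsp⟩ := hE.self_of_nhds
  rw [isLocalDiffeomorphAt_iff_of_finrank (finrank_add_of_frame hli hsp) (contMDiff_framePlus hL)]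
  have hD : ∀ w, modelDeriv 𝓘(ℝ, EG) (𝓘(ℝ, EM).prod 𝓘(ℝ, Fin k → ℝ)) (framePlus L E) g w = 0 ↔
      modelDeriv 𝓘(ℝ, EG) 𝓘(ℝ, EM) Γ.β g w = 0 ∧
        ∀ γ, modelDeriv 𝓘(ℝ, EG) 𝓘(ℝ, ℝ) (leftDeriv L (E γ)) g w = 0 := fun w => by
    have := modelDeriv_prodMk_pi w (Γ.smooth_β.mdifferentiable (by simp) g)
      (fun γ => contMDiff_leftDeriv hL (E γ) g)
    have h2 : modelDeriv 𝓘(ℝ, EG) (𝓘(ℝ, EM).prod 𝓘(ℝ, Fin k → ℝ)) (framePlus L E) g w = _ := this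
    rw [h2]
    exact Prod.ext_iff.trans (and_congr_right fun _ => funext_iff)
  simp only [hD]
  constructor
  · intro h X hX
    exact h _ ⟨modelDeriv_β_rightVec X g, fun γ => hX (E γ)⟩
  · rintro h w ⟨h1, h2⟩
    obtain ⟨X, rfl⟩ := exists_rightVec_eq h1
    refine h X fun Y => ?_
    obtain ⟨a, ha⟩ := vec_mem_span_of_frame hsp Y
    rw [modelDeriv_leftDeriv_rightVec hL, leftVec_eq_sum ha, map_sum]
    refine Finset.sum_eq_zero fun γ _ => ?_
    rw [map_smul, ← modelDeriv_leftDeriv_rightVec hL, h2, smul_zero]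

/-- The form read from its left-invariant argument, in the shape shared by the differential of `F⁻L`
and the local matrix. -/
theorem mixedNondegenerateAt_iff_frame (hL : ContMDiff 𝓘(ℝ, EG) 𝓘(ℝ, ℝ) ∞ L) {g : G}
    (hsp : Submodule.span ℝ (range fun γ => (E γ).toFun (Γ.α g)) = ⊤) :
    Γ.MixedNondegenerateAt L g ↔ ∀ w, modelDeriv 𝓘(ℝ, EG) 𝓘(ℝ, EM) Γ.α g w = 0 →
      (∀ γ, modelDeriv 𝓘(ℝ, EG) 𝓘(ℝ, ℝ) (rightDeriv L (E γ)) g w = 0) → w = 0 := by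
  rw [mixedNondegenerateAt_iff_left hL]
  simp only [modelDeriv_leftDeriv_rightVec hL]
  constructor
  · intro h w h1 h2
    obtain ⟨X, rfl⟩ := exists_leftVec_eq h1
    refine h X fun Y => ?_
    obtain ⟨a, ha⟩ := vec_mem_span_of_frame hsp Y
    rw [← modelDeriv_leftDeriv_rightVec hL, rightVec_eq_sum ha, map_sum]
    refine Finset.sum_eq_zero fun γ _ => ?_
    rw [map_smul, modelDeriv_leftDeriv_rightVec hL, h2, smul_zero]
  · intro h X hX
    exact h _ (modelDeriv_α_leftVec X g) fun γ => hX (E γ)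

theorem isLocalDiffeomorphAt_frameMinus_iff (hL : ContMDiff 𝓘(ℝ, EG) 𝓘(ℝ, ℝ) ∞ L) {g : G}
    (hE : IsFrameNear E (Γ.α g)) :
    IsLocalDiffeomorphAt 𝓘(ℝ, EG) (𝓘(ℝ, EM).prod 𝓘(ℝ, Fin k → ℝ)) ∞ (frameMinus L E) g ↔
      Γ.MixedNondegenerateAt L g := by
  obtain ⟨hli, hsp⟩ := hE.self_of_nhds
  rw [isLocalDiffeomorphAt_iff_of_finrank (finrank_add_of_frame hli hsp) (contMDiff_frameMinus hL),
    mixedNondegenerateAt_iff_frame hL hsp]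
  refine forall_congr' fun w => ?_
  have h1 := modelDeriv_prodMk_pi w (Γ.smooth_α.mdifferentiable (by simp) g)
    (fun γ => contMDiff_rightDeriv hL (E γ) g)
  have h2 : modelDeriv 𝓘(ℝ, EG) (𝓘(ℝ, EM).prod 𝓘(ℝ, Fin k → ℝ)) (frameMinus L E) g w = _ := h1
  rw [h2, ← and_imp]
  exact imp_congr_left (Prod.ext_iff.trans (and_congr_right fun _ => funext_iff))

end Frame

theorem leftDeriv_comp_inv (hL : ContMDiff 𝓘(ℝ, EG) 𝓘(ℝ, ℝ) ∞ L) (X : Γ.AlgebroidSection) (g : G) :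
    leftDeriv (fun k => L (Γ.inv k)) X (Γ.inv g) = -rightDeriv L X g := by
  rw [rightDeriv_eq_neg_leftDeriv_inv hL, neg_neg]

/-- Inversion exchanges the two families of fields, each with a sign. The signs cancel, so the form
of `L ∘ i` at `g⁻¹` is the transpose of that of `L` at `g`. -/
theorem mixedNondegenerateAt_comp_inv_iff [T2Space M] (hL : ContMDiff 𝓘(ℝ, EG) 𝓘(ℝ, ℝ) ∞ L)
    (g : G) :
    Γ.MixedNondegenerateAt (fun k => L (Γ.inv k)) (Γ.inv g) ↔ Γ.MixedNondegenerateAt L g := by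
  have hL' : ContMDiff 𝓘(ℝ, EG) 𝓘(ℝ, ℝ) ∞ (fun k => L (Γ.inv k)) := hL.comp Γ.smooth_inv
  rw [mixedNondegenerateAt_iff_left hL]
  refine forall_congr' fun X => ?_
  have h1 : rightVec X (Γ.inv g) = 0 ↔ leftVec X g = 0 := by
    rw [rightVec_eq_zero_iff, leftVec_eq_zero_iff, Γ.α_inv]
  rw [h1]
  refine imp_congr_left (forall_congr' fun Y => ?_)
  have h5 : leftDeriv (fun k => L (Γ.inv k)) Y = fun k => -rightDeriv L Y (Γ.inv k) := by
    funext k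
    rw [← leftDeriv_comp_inv hL, Γ.inv_inv]
  have h6 : modelDeriv 𝓘(ℝ, EG) 𝓘(ℝ, ℝ) (leftDeriv (fun k => L (Γ.inv k)) Y) (Γ.inv g)
      (rightVec X (Γ.inv g)) = modelDeriv 𝓘(ℝ, EG) 𝓘(ℝ, ℝ) (rightDeriv L Y) g (leftVec X g) := by
    have hq := hasVelocity_chart_line (mem_extChartAt_source (I := 𝓘(ℝ, EG)) (Γ.inv g))
      (rightVec X (Γ.inv g))
    have h3 := hq.comp (Γ.smooth_inv.mdifferentiable (by simp) (Γ.inv g))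
    rw [modelDeriv_inv_rightVec, Γ.inv_inv] at h3
    have h4 := h3.comp ((contMDiff_rightDeriv hL Y).mdifferentiable (by simp) g)
    have h7 := hq.comp ((contMDiff_leftDeriv hL' Y).mdifferentiable (by simp) (Γ.inv g))
    rw [map_neg] at h4
    have h8 := (hasVelocity_iff_hasDerivAt.1 h4).2.neg
    rw [neg_neg] at h8
    refine (hasVelocity_iff_hasDerivAt.1 h7).2.unique (h8.congr_of_eventuallyEq ?_)
    filter_upwards with t
    rw [h5]
    rfl
  rw [h6, modelDeriv_leftDeriv_rightVec hL]

section Legendre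

variable [T2Space M] {k : ℕ} {V : Set M} {e : Fin k → ∀ x : M, Γ.algebroidFiber x}

theorem isLocalDiffeoToDualAt_legendrePlus_iff (hL : ContMDiff 𝓘(ℝ, EG) 𝓘(ℝ, ℝ) ∞ L) {g : G}
    (hV : IsOpen V) (hg : Γ.β g ∈ V) (hs : ∀ γ, Γ.IsSmoothSectionOn (e γ) V)
    (he : ∀ x ∈ V, LinearIndependent ℝ (fun γ => e γ x) ∧
      Submodule.span ℝ (range fun γ => e γ x) = ⊤) :
    Γ.IsLocalDiffeoToDualAt (Γ.legendrePlus L) g ↔ Γ.MixedNondegenerateAt L g := by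
  -- Stated for an arbitrary frame: one direction receives an unknown frame from the definition, the
  -- other uses the given one.
  have key : ∀ {k : ℕ} {V : Set M} {e : Fin k → ∀ x : M, Γ.algebroidFiber x}, IsOpen V →
      Γ.β g ∈ V → (∀ γ, Γ.IsSmoothSectionOn (e γ) V) →
      (∀ x ∈ V, LinearIndependent ℝ (fun γ => e γ x) ∧
        Submodule.span ℝ (range fun γ => e γ x) = ⊤) →
      (IsLocalDiffeomorphAt 𝓘(ℝ, EG) (𝓘(ℝ, EM).prod 𝓘(ℝ, Fin k → ℝ)) ∞
        (fun h => ((Γ.legendrePlus L h).1,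
          fun γ => (Γ.legendrePlus L h).2 (e γ (Γ.legendrePlus L h).1))) g ↔
        Γ.MixedNondegenerateAt L g) := by
    intro k V e hV hg hs he
    obtain ⟨E, hE, hEe⟩ := exists_isFrameNear hV hg hs he
    rw [← isLocalDiffeomorphAt_framePlus_iff hL hE]
    have h : (fun h => ((Γ.legendrePlus L h).1,
        fun γ => (Γ.legendrePlus L h).2 (e γ (Γ.legendrePlus L h).1))) =ᶠ[𝓝 g]
        framePlus L E := by
      filter_upwards [Γ.smooth_β.continuous.continuousAt.eventually hEe] with h hh
      refine Prod.ext rfl (funext fun γ => ?_)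
      exact (congrArg (Γ.legendrePlus L h).2 (hh γ).symm).trans (legendrePlus_apply hL (E γ) h)
    exact ⟨fun hf => hf.congr h.symm, fun hf => hf.congr h⟩
  constructor
  · rintro ⟨k, V, e, hV, hg, hs, he, h⟩
    exact (key hV hg hs he).1 h
  · intro h
    exact ⟨k, V, e, hV, hg, hs, he, (key hV hg hs he).2 h⟩

theorem isLocalDiffeoToDualAt_legendreMinus_iff (hL : ContMDiff 𝓘(ℝ, EG) 𝓘(ℝ, ℝ) ∞ L) {g : G}
    (hV : IsOpen V) (hg : Γ.α g ∈ V) (hs : ∀ γ, Γ.IsSmoothSectionOn (e γ) V)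
    (he : ∀ x ∈ V, LinearIndependent ℝ (fun γ => e γ x) ∧
      Submodule.span ℝ (range fun γ => e γ x) = ⊤) :
    Γ.IsLocalDiffeoToDualAt (Γ.legendreMinus L) g ↔ Γ.MixedNondegenerateAt L g := by
  have key : ∀ {k : ℕ} {V : Set M} {e : Fin k → ∀ x : M, Γ.algebroidFiber x}, IsOpen V →
      Γ.α g ∈ V → (∀ γ, Γ.IsSmoothSectionOn (e γ) V) →
      (∀ x ∈ V, LinearIndependent ℝ (fun γ => e γ x) ∧
        Submodule.span ℝ (range fun γ => e γ x) = ⊤) →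
      (IsLocalDiffeomorphAt 𝓘(ℝ, EG) (𝓘(ℝ, EM).prod 𝓘(ℝ, Fin k → ℝ)) ∞
        (fun h => ((Γ.legendreMinus L h).1,
          fun γ => (Γ.legendreMinus L h).2 (e γ (Γ.legendreMinus L h).1))) g ↔
        Γ.MixedNondegenerateAt L g) := by
    intro k V e hV hg hs he
    obtain ⟨E, hE, hEe⟩ := exists_isFrameNear hV hg hs he
    rw [← isLocalDiffeomorphAt_frameMinus_iff hL hE]
    have h : (fun h => ((Γ.legendreMinus L h).1,
        fun γ => (Γ.legendreMinus L h).2 (e γ (Γ.legendreMinus L h).1))) =ᶠ[𝓝 g]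
        frameMinus L E := by
      filter_upwards [Γ.smooth_α.continuous.continuousAt.eventually hEe] with h hh
      refine Prod.ext rfl (funext fun γ => ?_)
      exact (congrArg (Γ.legendreMinus L h).2 (hh γ).symm).trans (legendreMinus_apply hL (E γ) h)
    exact ⟨fun hf => hf.congr h.symm, fun hf => hf.congr h⟩
  constructor
  · rintro ⟨k, V, e, hV, hg, hs, he, h⟩
    exact (key hV hg hs he).1 h
  · intro h
    exact ⟨k, V, e, hV, hg, hs, he, (key hV hg hs he).2 h⟩

end Legendre

end LieGroupoid

/-! ### Translations by local bisections, and the evolution operator. -/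

namespace LieGroupoid

variable {EG : Type*} [NormedAddCommGroup EG] [NormedSpace ℝ EG]
  {EM : Type*} [NormedAddCommGroup EM] [NormedSpace ℝ EM]
  {G : Type*} [TopologicalSpace G] [ChartedSpace EG G]
  {M : Type*} [TopologicalSpace M] [ChartedSpace EM M]

namespace LocalBisection

variable {Γ : LieGroupoid EG EM G M} (S : Γ.LocalBisection)

theorem α_secα {x : M} (hx : x ∈ S.src) : Γ.α (S.secα x) = x := S.invOn_α.2 hx

theorem β_secβ {x : M} (hx : x ∈ S.tgt) : Γ.β (S.secβ x) = x := S.invOn_β.2 hx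

theorem secα_α {g : G} (hg : g ∈ S.carrier) : S.secα (Γ.α g) = g := S.invOn_α.1 hg

theorem secβ_β {g : G} (hg : g ∈ S.carrier) : S.secβ (Γ.β g) = g := S.invOn_β.1 hg

/-- The inverse of a local bisection. -/
def inverse : Γ.LocalBisection where
  carrier := Γ.inv '' S.carrier
  src := S.tgt
  tgt := S.src
  secα x := Γ.inv (S.secβ x)
  secβ x := Γ.inv (S.secα x)
  isOpen_src := S.isOpen_tgt
  isOpen_tgt := S.isOpen_src
  mapsTo_α := by
    rintro _ ⟨g, hg, rfl⟩
    rw [Γ.α_inv]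
    exact S.mapsTo_β hg
  mapsTo_β := by
    rintro _ ⟨g, hg, rfl⟩
    rw [Γ.β_inv]
    exact S.mapsTo_α hg
  mapsTo_secα x hx := mem_image_of_mem _ (S.mapsTo_secβ hx)
  mapsTo_secβ x hx := mem_image_of_mem _ (S.mapsTo_secα hx)
  invOn_α := by
    refine ⟨?_, fun x hx => ?_⟩
    · rintro _ ⟨g, hg, rfl⟩
      simp only [Γ.α_inv, S.secβ_β hg]
    · rw [Γ.α_inv, S.β_secβ hx]
  invOn_β := by
    refine ⟨?_, fun x hx => ?_⟩
    · rintro _ ⟨g, hg, rfl⟩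
      simp only [Γ.β_inv, S.secα_α hg]
    · rw [Γ.β_inv, S.α_secα hx]
  smooth_secα := Γ.smooth_inv.comp_contMDiffOn S.smooth_secβ
  smooth_secβ := Γ.smooth_inv.comp_contMDiffOn S.smooth_secα

theorem α_rightTrans {g : G} (hg : Γ.β g ∈ S.src) : Γ.α (S.rightTrans g) = Γ.α g :=
  Γ.α_mul _ _ (S.α_secα hg).symm

theorem rightTrans_inverse_rightTrans {k : G} (hk : Γ.β k ∈ S.tgt) :
    S.rightTrans (S.inverse.rightTrans k) = k := by
  have h1 : Γ.β k = Γ.α (Γ.inv (S.secβ (Γ.β k))) := by rw [Γ.α_inv, S.β_secβ hk]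
  have h2 : Γ.β (S.inverse.rightTrans k) = Γ.α (S.secβ (Γ.β k)) := by
    exact (Γ.β_mul _ _ h1).trans (Γ.β_inv _)
  rw [rightTrans, h2, S.secα_α (S.mapsTo_secβ hk)]
  exact Γ.inv_mul_cancel_right (S.β_secβ hk).symm

theorem inverse_rightTrans_rightTrans {g : G} (hg : Γ.β g ∈ S.src) :
    S.inverse.rightTrans (S.rightTrans g) = g := by
  have h := S.inverse.rightTrans_inverse_rightTrans (k := g) hg
  have h2 : S.inverse.inverse.rightTrans g = S.rightTrans g := by
    simp only [rightTrans, inverse, Γ.inv_inv]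
  rwa [h2] at h

/-- The rule `(h g)⁻¹ = g⁻¹ h⁻¹` reduces left translations to right ones. -/
theorem leftTrans_eq_inv_rightTrans {g : G} (hg : Γ.α g ∈ S.tgt) :
    S.leftTrans g = Γ.inv (S.inverse.rightTrans (Γ.inv g)) := by
  have h : Γ.β (Γ.inv g) = Γ.α (Γ.inv (S.secβ (Γ.β (Γ.inv g)))) := by
    rw [Γ.α_inv, Γ.β_inv, S.β_secβ hg]
  rw [leftTrans, rightTrans]
  change _ = Γ.inv (Γ.mul _ (Γ.inv (S.secβ (Γ.β (Γ.inv g)))))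
  rw [Γ.inv_mul_rev h, Γ.inv_inv, Γ.inv_inv, Γ.β_inv]

theorem rightTrans_ε {h : G} (hh : h ∈ S.carrier) : S.rightTrans (Γ.ε (Γ.α h)) = h := by
  rw [rightTrans, Γ.β_ε, S.secα_α hh, Γ.ε_mul]

theorem contMDiffAt_rightTrans {g : G} (hg : Γ.β g ∈ S.src) :
    ContMDiffAt 𝓘(ℝ, EG) 𝓘(ℝ, EG) ∞ S.rightTrans g := by
  refine Γ.contMDiffAt_mul contMDiffAt_id ?_ ?_
  · exact (S.smooth_secα.contMDiffAt (S.isOpen_src.mem_nhds hg)).comp g (Γ.smooth_β g)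
  · filter_upwards [Γ.smooth_β.continuous.continuousAt.eventually_mem (S.isOpen_src.mem_nhds hg)]
      with k hk
    exact (S.α_secα hk).symm

/-- Translation by the inverse bisection is a continuous local inverse, so the image contains a
preimage of `W` near `h`. -/
theorem image_rightTrans_mem_nhds {h : G} (hh : h ∈ S.carrier) {W : Set G}
    (hW : W ∈ 𝓝 (Γ.ε (Γ.α h))) : S.rightTrans '' W ∈ 𝓝 h := by
  have hβ : Γ.β h ∈ S.tgt := S.mapsTo_β hh
  have hc := (S.inverse.contMDiffAt_rightTrans hβ).continuousAt
  have h0 : S.inverse.rightTrans h = Γ.ε (Γ.α h) := by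
    conv_lhs => rw [← S.rightTrans_ε hh]
    exact S.inverse_rightTrans_rightTrans (by rw [Γ.β_ε]; exact S.mapsTo_α hh)
  rw [ContinuousAt, h0] at hc
  filter_upwards [hc hW, Γ.smooth_β.continuous.continuousAt.eventually_mem
    (S.isOpen_tgt.mem_nhds hβ)] with k h1 h2
  exact ⟨_, h1, S.rightTrans_inverse_rightTrans h2⟩

theorem image_leftTrans_mem_nhds {g : G} (hg : g ∈ S.carrier) {W : Set G}
    (hW : W ∈ 𝓝 (Γ.ε (Γ.β g))) (hWα : Γ.α '' W ⊆ S.tgt) : S.leftTrans '' W ∈ 𝓝 g := by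
  have hinv : Γ.inv ⁻¹' W ∈ 𝓝 (Γ.ε (Γ.α (Γ.inv g))) := by
    refine Γ.smooth_inv.continuous.continuousAt ?_
    rwa [Γ.inv_ε, Γ.α_inv]
  have h1 := S.inverse.image_rightTrans_mem_nhds (mem_image_of_mem Γ.inv hg) hinv
  filter_upwards [Γ.smooth_inv.continuous.continuousAt h1] with k hk
  obtain ⟨w, hw, hwk⟩ := hk
  refine ⟨_, hw, ?_⟩
  rw [S.leftTrans_eq_inv_rightTrans (hWα (mem_image_of_mem _ hw)), Γ.inv_inv, hwk, Γ.inv_inv]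

end LocalBisection

section Evolution

variable [IsManifold 𝓘(ℝ, EG) ∞ G] [FiniteDimensional ℝ EG] [FiniteDimensional ℝ EM]
  [IsManifold 𝓘(ℝ, EM) ∞ M] {Γ : LieGroupoid EG EM G M} {L : G → ℝ}
  {k : ℕ} {E : Fin k → Γ.AlgebroidSection}

/-- Composability equates the base points, and both sides of the equations depend linearly on the
value of the section there, so the frame sections are enough. -/
theorem isDELSolution_iff_framePlus_eq {g h : G}
    (hsp : Submodule.span ℝ (range fun γ => (E γ).toFun (Γ.β g)) = ⊤) :
    Γ.IsDELSolution L g h ↔ framePlus L E g = frameMinus L E h := by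
  rw [isDELSolution_iff, framePlus, frameMinus, Prod.mk_inj]
  refine and_congr_right fun hgh => ⟨fun H => funext fun γ => H (E γ), fun H X => ?_⟩
  obtain ⟨a, ha⟩ := vec_mem_span_of_frame hsp X
  have ha' := ha
  rw [hgh] at ha'
  rw [leftDeriv, rightDeriv, leftVec_eq_sum ha, rightVec_eq_sum ha', map_sum, map_sum]
  refine Finset.sum_congr rfl fun γ _ => ?_
  rw [map_smul, map_smul]
  exact congrArg (a γ • ·) (congrFun H γ)

/-- With both Legendre maps locally invertible, the equation for `h` in terms of `g` is solved by
`F⁻L⁻¹ ∘ F⁺L`. -/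
theorem exists_evolutionOperator {g₀ h₀ : G} (hsol : Γ.IsDELSolution L g₀ h₀)
    (hE : IsFrameNear E (Γ.β g₀))
    (hp : IsLocalDiffeomorphAt 𝓘(ℝ, EG) (𝓘(ℝ, EM).prod 𝓘(ℝ, Fin k → ℝ)) ∞ (framePlus L E) g₀)
    (hm : IsLocalDiffeomorphAt 𝓘(ℝ, EG) (𝓘(ℝ, EM).prod 𝓘(ℝ, Fin k → ℝ)) ∞ (frameMinus L E) h₀)
    {U₁ U₂ : Set G} (hU₁ : U₁ ∈ 𝓝 g₀) (hU₂ : U₂ ∈ 𝓝 h₀) :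
    ∃ A B : Set G, IsOpen A ∧ g₀ ∈ A ∧ A ⊆ U₁ ∧ IsOpen B ∧ h₀ ∈ B ∧ B ⊆ U₂ ∧
      ∃ Ψ : G → G, Γ.IsEvolutionOperator L A B Ψ ∧ Ψ g₀ = h₀ ∧
        (∀ Ψ' : G → G, Γ.IsEvolutionOperator L A B Ψ' → Ψ' g₀ = h₀ → EqOn Ψ' Ψ A) ∧
        ∃ Ξ : G → G, ContMDiffOn 𝓘(ℝ, EG) 𝓘(ℝ, EG) ∞ Ξ B ∧ MapsTo Ξ B A ∧ InvOn Ξ Ψ A B := by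
  obtain ⟨V, hV, hVo, hxV⟩ := eventually_nhds_iff.1 hE
  obtain ⟨P, hgP, hP⟩ := hp
  obtain ⟨Q, hhQ, hQ⟩ := hm
  obtain ⟨O₁, hO₁, hO₁o, hgO₁⟩ := mem_nhds_iff.1 hU₁
  obtain ⟨O₂, hO₂, hO₂o, hhO₂⟩ := mem_nhds_iff.1 hU₂
  -- The domain is cut down so that arrows lie in the prescribed neighbourhood and the frame is
  -- valid at `β g`.
  let P' := P.toOpenPartialHomeomorph.restrOpen (O₁ ∩ Γ.β ⁻¹' V)
    (hO₁o.inter (hVo.preimage Γ.smooth_β.continuous))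
  let Q' := Q.toOpenPartialHomeomorph.restrOpen O₂ hO₂o
  let R := P'.trans Q'.symm
  have hRA : ∀ g ∈ R.source, g ∈ P.source ∧ g ∈ O₁ ∧ Γ.β g ∈ V ∧ P g ∈ Q.target ∧
      Q.symm (P g) ∈ O₂ := fun g hg => ⟨hg.1.1, hg.1.2.1, hg.1.2.2, hg.2.1, hg.2.2⟩
  have hRB : ∀ h ∈ R.target, h ∈ Q.source ∧ h ∈ O₂ := fun h hh => ⟨hh.1.1, hh.1.2⟩
  have hRB' : ∀ h ∈ R.target, Q h ∈ P.target := fun h hh => hh.2.1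
  have hcoe : ∀ g, R g = Q.symm (P g) := fun g => rfl
  have hcoe' : ∀ g, R.symm g = P.symm (Q g) := fun g => rfl
  have hdel : ∀ g ∈ R.source, ∀ h ∈ Q.source, (Γ.IsDELSolution L g h ↔ P g = Q h) := by
    intro g hg h hh
    rw [isDELSolution_iff_framePlus_eq (hV _ (hRA g hg).2.2.1).2, hP (hRA g hg).1, hQ hh]
  have hsol' : P g₀ = Q h₀ := by
    rw [isDELSolution_iff_framePlus_eq (hV _ hxV).2, hP hgP, hQ hhQ] at hsol
    exact hsol
  have hinv : Q.symm (P g₀) = h₀ := by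
    rw [hsol']
    exact Q.left_inv hhQ
  have hgA : g₀ ∈ R.source := by
    refine ⟨⟨hgP, hgO₁, hxV⟩, ⟨?_, ?_⟩⟩
    · change P g₀ ∈ Q.target
      rw [hsol']
      exact Q.map_source hhQ
    · change Q.symm (P g₀) ∈ O₂
      rwa [hinv]
  refine ⟨R.source, R.target, R.open_source, hgA, fun g hg => hO₁ (hRA g hg).2.1, R.open_target,
    ?_, fun h hh => hO₂ (hRB h hh).2, R, ⟨?_, R.mapsTo, ?_⟩, hinv, ?_, R.symm, ?_,
    R.symm.mapsTo, R.invOn⟩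
  · have := R.map_source hgA
    rwa [hcoe, hinv] at this
  · exact Q.contMDiffOn_invFun.comp (P.contMDiffOn_toFun.mono fun g hg => (hRA g hg).1)
      fun g hg => (hRA g hg).2.2.2.1
  · intro g hg
    rw [hdel g hg _ (hRB _ (R.map_source hg)).1]
    exact (Q.right_inv (hRA g hg).2.2.2.1).symm
  -- A competitor takes values in the domain of injectivity of `Q`, where the equation determines
  -- the second arrow.
  · intro Ψ' hΨ' _ g hg
    have h1 := (hRB _ (hΨ'.2.1 hg)).1
    rw [hcoe, (hdel g hg _ h1).1 (hΨ'.2.2 g hg)]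
    exact (Q.left_inv h1).symm
  · exact P.contMDiffOn_invFun.comp (Q.contMDiffOn_toFun.mono fun g hg => (hRB g hg).1)
      fun g hg => hRB' g hg

end Evolution

end LieGroupoid

/-! ### Adapted coordinates and the coordinate frame of the Lie algebroid. -/

namespace LieGroupoid

variable {EG : Type*} [NormedAddCommGroup EG] [NormedSpace ℝ EG]
  {EM : Type*} [NormedAddCommGroup EM] [NormedSpace ℝ EM]
  {G : Type*} [TopologicalSpace G] [ChartedSpace EG G]
  {M : Type*} [TopologicalSpace M] [ChartedSpace EM M]
  [IsManifold 𝓘(ℝ, EG) ∞ G]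

namespace AdaptedCoordinates

variable {Γ : LieGroupoid EG EM G M} {n m : ℕ} (C : Γ.AdaptedCoordinates n m)

theorem ψ_ε {x : M} (hx : Γ.ε x ∈ C.ψ.source) : C.ψ (Γ.ε x) = (C.φ x, 0) :=
  Prod.ext (by rw [C.fst_ψ _ hx, Γ.α_ε]) (C.snd_ψ_ε x hx)

theorem mem_φ_source {x : M} (hx : Γ.ε x ∈ C.ψ.source) : x ∈ C.φ.source := by
  have := C.mapsTo_α hx
  rwa [Γ.α_ε] at this

theorem mem_ψ_target {x : M} (hx : Γ.ε x ∈ C.ψ.source) : (C.φ x, 0) ∈ C.ψ.target := by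
  rw [← C.ψ_ε hx]
  exact C.ψ.map_source hx

theorem ψ_symm_zero {x : M} (hx : Γ.ε x ∈ C.ψ.source) : C.ψ.symm (C.φ x, 0) = Γ.ε x := by
  rw [← C.ψ_ε hx, C.ψ.left_inv hx]

variable {z : (Fin n → ℝ) × (Fin m → ℝ)}

theorem φ_α (hz : z ∈ C.ψ.target) : C.φ (Γ.α (C.ψ.symm z)) = z.1 := by
  rw [← C.fst_ψ _ (C.ψ.map_target hz), C.ψ.right_inv hz]

theorem α_ψ_symm (hz : z ∈ C.ψ.target) : Γ.α (C.ψ.symm z) = C.φ.symm z.1 := by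
  rw [← C.φ_α hz, C.φ.left_inv (C.mapsTo_α (C.ψ.map_target hz))]

theorem contMDiffAt_φ {x : M} (hx : x ∈ C.φ.source) :
    ContMDiffAt 𝓘(ℝ, EM) 𝓘(ℝ, Fin n → ℝ) ∞ C.φ x :=
  C.smooth_φ.contMDiffAt (C.φ.open_source.mem_nhds hx)

theorem contMDiffAt_ψ {g : G} (hg : g ∈ C.ψ.source) :
    ContMDiffAt 𝓘(ℝ, EG) 𝓘(ℝ, (Fin n → ℝ) × (Fin m → ℝ)) ∞ C.ψ g :=
  C.smooth_ψ.contMDiffAt (C.ψ.open_source.mem_nhds hg)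

theorem contMDiffAt_ψ_symm (hz : z ∈ C.ψ.target) :
    ContMDiffAt 𝓘(ℝ, (Fin n → ℝ) × (Fin m → ℝ)) 𝓘(ℝ, EG) ∞ C.ψ.symm z :=
  C.smooth_ψ_symm.contMDiffAt (C.ψ.open_target.mem_nhds hz)

theorem hasVelocity_ψ_symm {x : M} (hx : Γ.ε x ∈ C.ψ.source) (s : Fin m → ℝ) :
    HasVelocity 𝓘(ℝ, EG) (fun t : ℝ => C.ψ.symm (C.φ x, t • s)) (Γ.ε x)
      (modelDeriv 𝓘(ℝ, (Fin n → ℝ) × (Fin m → ℝ)) 𝓘(ℝ, EG) C.ψ.symm (C.φ x, 0) (0, s)) := by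
  have h1 : HasVelocity 𝓘(ℝ, (Fin n → ℝ) × (Fin m → ℝ))
      (fun t : ℝ => ((C.φ x, t • s) : (Fin n → ℝ) × (Fin m → ℝ))) (C.φ x, 0) (0, s) := by
    refine hasVelocity_iff_hasDerivAt.2 ⟨by simp, ?_⟩
    have h := ((hasDerivAt_id (0 : ℝ)).smul_const s)
    rw [one_smul] at h
    exact (hasDerivAt_const (0 : ℝ) (C.φ x)).prodMk h
  have h2 := h1.comp ((C.contMDiffAt_ψ_symm (C.mem_ψ_target hx)).mdifferentiableAt (by simp))
  rwa [C.ψ_symm_zero hx] at h2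

theorem eventually_line_mem {x : M} (hx : Γ.ε x ∈ C.ψ.source) (s : Fin m → ℝ) :
    ∀ᶠ t : ℝ in 𝓝 0, (C.φ x, t • s) ∈ C.ψ.target := by
  have h : ContinuousAt (fun t : ℝ => ((C.φ x, t • s) : (Fin n → ℝ) × (Fin m → ℝ))) 0 := by
    fun_prop
  refine h.eventually_mem (C.ψ.open_target.mem_nhds ?_)
  simpa using C.mem_ψ_target hx

theorem α_line {x : M} (hx : Γ.ε x ∈ C.ψ.source) {u : Fin m → ℝ} (h : (C.φ x, u) ∈ C.ψ.target) :
    Γ.α (C.ψ.symm (C.φ x, u)) = x := by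
  rw [C.α_ψ_symm h, C.φ.left_inv (C.mem_φ_source hx)]

theorem modelDeriv_α_ψ_symm {x : M} (hx : Γ.ε x ∈ C.ψ.source) (s : Fin m → ℝ) :
    modelDeriv 𝓘(ℝ, EG) 𝓘(ℝ, EM) Γ.α (Γ.ε x)
      (modelDeriv 𝓘(ℝ, (Fin n → ℝ) × (Fin m → ℝ)) 𝓘(ℝ, EG) C.ψ.symm (C.φ x, 0) (0, s)) = 0 := by
  have h := (C.hasVelocity_ψ_symm hx s).comp (Γ.smooth_α.mdifferentiable (by simp) _)
  rw [Γ.α_ε] at h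
  exact (h.congr ((C.eventually_line_mem hx s).mono fun t ht => (C.α_line hx ht).symm)).unique
    (HasVelocity.const (I := 𝓘(ℝ, EM)) x)

open Classical in
/-- The coordinate sections `∂/∂u^γ` of the Lie algebroid. -/
def coordSection (γ : Fin m) (x : M) : Γ.algebroidFiber x :=
  if hx : Γ.ε x ∈ C.ψ.source then
    ⟨modelDeriv 𝓘(ℝ, (Fin n → ℝ) × (Fin m → ℝ)) 𝓘(ℝ, EG) C.ψ.symm (C.φ x, 0) (0, Pi.single γ 1),
      LinearMap.mem_ker.2 (C.modelDeriv_α_ψ_symm hx _)⟩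
  else 0

theorem fiberVec_coordSection {x : M} (hx : Γ.ε x ∈ C.ψ.source) (γ : Fin m) :
    fiberVec (C.coordSection γ x) = modelDeriv 𝓘(ℝ, (Fin n → ℝ) × (Fin m → ℝ)) 𝓘(ℝ, EG)
      C.ψ.symm (C.φ x, 0) (0, Pi.single γ 1) := by
  rw [coordSection, dif_pos hx]
  rfl

theorem isOpen_ε_preimage : IsOpen (Γ.ε ⁻¹' C.ψ.source) :=
  C.ψ.open_source.preimage Γ.smooth_ε.continuous

theorem modelDeriv_ψ_symm_ψ {g : G} (hg : g ∈ C.ψ.source) (v : EG) :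
    modelDeriv 𝓘(ℝ, (Fin n → ℝ) × (Fin m → ℝ)) 𝓘(ℝ, EG) C.ψ.symm (C.ψ g)
      (modelDeriv 𝓘(ℝ, EG) 𝓘(ℝ, (Fin n → ℝ) × (Fin m → ℝ)) C.ψ g v) = v := by
  have h := modelDeriv_comp (x := g) rfl
    ((C.contMDiffAt_ψ_symm (C.ψ.map_source hg)).mdifferentiableAt (by simp))
    ((C.contMDiffAt_ψ hg).mdifferentiableAt (by simp))
  have h2 : (fun z => C.ψ.symm (C.ψ z)) =ᶠ[𝓝 g] fun z => z :=
    eventually_of_mem (C.ψ.open_source.mem_nhds hg) fun y hy => C.ψ.left_inv hy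
  rw [modelDeriv_congr h2, modelDeriv_id] at h
  exact (DFunLike.congr_fun h v).symm

theorem modelDeriv_ψ_ψ_symm (hz : z ∈ C.ψ.target) (v : (Fin n → ℝ) × (Fin m → ℝ)) :
    modelDeriv 𝓘(ℝ, EG) 𝓘(ℝ, (Fin n → ℝ) × (Fin m → ℝ)) C.ψ (C.ψ.symm z)
      (modelDeriv 𝓘(ℝ, (Fin n → ℝ) × (Fin m → ℝ)) 𝓘(ℝ, EG) C.ψ.symm z v) = v := by
  have h := modelDeriv_comp (x := z) rfl
    ((C.contMDiffAt_ψ (C.ψ.map_target hz)).mdifferentiableAt (by simp))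
    ((C.contMDiffAt_ψ_symm hz).mdifferentiableAt (by simp))
  have h2 : (fun y => C.ψ (C.ψ.symm y)) =ᶠ[𝓝 z] fun y => y :=
    eventually_of_mem (C.ψ.open_target.mem_nhds hz) fun y hy => C.ψ.right_inv hy
  rw [modelDeriv_congr h2, modelDeriv_id] at h
  exact (DFunLike.congr_fun h v).symm

theorem fst_modelDeriv_ψ {g : G} (hg : g ∈ C.ψ.source) {v : EG}
    (hv : modelDeriv 𝓘(ℝ, EG) 𝓘(ℝ, EM) Γ.α g v = 0) :
    (modelDeriv 𝓘(ℝ, EG) 𝓘(ℝ, (Fin n → ℝ) × (Fin m → ℝ)) C.ψ g v).1 = 0 := by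
  have hq := hasVelocity_chart_line (mem_extChartAt_source (I := 𝓘(ℝ, EG)) g) v
  have hqc := hq.continuousAt
  rw [ContinuousAt, hq.zero] at hqc
  have h1 := (hasVelocity_iff_hasDerivAt.1
    (hq.comp ((C.contMDiffAt_ψ hg).mdifferentiableAt (by simp)))).2
  have h2 := (hq.comp (Γ.smooth_α.mdifferentiable (by simp) g)).comp
    ((C.contMDiffAt_φ (C.mapsTo_α hg)).mdifferentiableAt (by simp))
  rw [hv, map_zero] at h2
  have h3 : HasDerivAt _ _ (0 : ℝ) := h1.fst
  refine h3.unique ((hasVelocity_iff_hasDerivAt.1 h2).2.congr_of_eventuallyEq ?_)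
  filter_upwards [hqc (C.ψ.open_source.mem_nhds hg)] with t ht
  exact C.fst_ψ _ ht

theorem zero_prodMk_eq_sum (s : Fin m → ℝ) :
    ((0, s) : (Fin n → ℝ) × (Fin m → ℝ)) = ∑ γ, s γ • (0, Pi.single γ 1) := by
  refine Prod.ext ?_ ?_
  · simp [Prod.fst_sum]
  · rw [Prod.snd_sum]
    simp only [Prod.smul_mk]
    conv_lhs => rw [pi_eq_sum_univ' s]

/-- In the coordinates `ψ` the map `α` is the projection to `x`, so the kernel of its differential
at an identity consists of the vectors `(0, s)`. -/
theorem frame_coordSection {x : M} (hx : Γ.ε x ∈ C.ψ.source) :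
    LinearIndependent ℝ (fun γ => C.coordSection γ x) ∧
      Submodule.span ℝ (range fun γ => C.coordSection γ x) = ⊤ := by
  have hz := C.mem_ψ_target hx
  constructor
  · let D : Γ.algebroidFiber x →ₗ[ℝ] (Fin m → ℝ) := (LinearMap.snd ℝ (Fin n → ℝ) (Fin m → ℝ)).comp
      ((modelDeriv 𝓘(ℝ, EG) 𝓘(ℝ, (Fin n → ℝ) × (Fin m → ℝ)) C.ψ
        (C.ψ.symm (C.φ x, 0))).toLinearMap.comp fiberVec)
    refine LinearIndependent.of_comp D ?_
    convert (Pi.basisFun ℝ (Fin m)).linearIndependent using 1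
    funext γ
    rw [Pi.basisFun_apply]
    change (modelDeriv 𝓘(ℝ, EG) 𝓘(ℝ, (Fin n → ℝ) × (Fin m → ℝ)) C.ψ
        (C.ψ.symm (C.φ x, 0)) (fiberVec (C.coordSection γ x))).2 = _
    rw [C.fiberVec_coordSection hx, C.modelDeriv_ψ_ψ_symm hz]
  · rw [eq_top_iff]
    intro v _
    have h1 := C.modelDeriv_ψ_symm_ψ hx (fiberVec v)
    have h2 := C.fst_modelDeriv_ψ hx (v := fiberVec v) (LinearMap.mem_ker.1 v.2)
    set w := modelDeriv 𝓘(ℝ, EG) 𝓘(ℝ, (Fin n → ℝ) × (Fin m → ℝ)) C.ψ (Γ.ε x) (fiberVec v)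
    have h3 : w = (0, w.2) := Prod.ext h2 rfl
    rw [h3, zero_prodMk_eq_sum, map_sum, C.ψ_ε hx] at h1
    refine (Submodule.mem_span_range_iff_exists_fun ℝ).2 ⟨w.2, ?_⟩
    have hinj : Function.Injective (fiberVec (Γ := Γ) (x := x)) := Subtype.val_injective
    apply hinj
    rw [← h1, map_sum]
    refine Finset.sum_congr rfl fun γ _ => ?_
    rw [map_smul, map_smul, C.fiberVec_coordSection hx]

/-- The section is the velocity of the smooth family of coordinate lines starting at the identities.
-/
theorem isSmoothSectionOn_coordSection [IsManifold 𝓘(ℝ, EM) ∞ M]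
    (γ : Fin m) : Γ.IsSmoothSectionOn (C.coordSection γ) (Γ.ε ⁻¹' C.ψ.source) := by
  intro x₁ hx₁
  refine ContMDiffAt.contMDiffWithinAt ?_
  let v : M → EG := fun x => fiberVec (C.coordSection γ x)
  let s : Fin m → ℝ := Pi.single γ 1
  have hV : ∀ᶠ x in 𝓝 x₁, Γ.ε x ∈ C.ψ.source := C.isOpen_ε_preimage.mem_nhds hx₁
  have h5 : ContMDiffAt 𝓘(ℝ, EM) 𝓘(ℝ, EG).tangent ∞
      (fun x => (⟨C.ψ.symm (C.φ x, (0 : ℝ) • s), v x⟩ : TangentBundle 𝓘(ℝ, EG) G)) x₁ := by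
    refine ContMDiffAt.velocity (f := fun x (t : ℝ) => C.ψ.symm (C.φ x, t • s)) ?_ ?_
    · have h1 : ContMDiffAt (𝓘(ℝ, EM).prod 𝓘(ℝ, ℝ)) 𝓘(ℝ, (Fin n → ℝ) × (Fin m → ℝ)) ∞
          (fun p : M × ℝ => (C.φ p.1, p.2 • s)) (x₁, 0) := by
        refine ContMDiffAt.prodMk_space ?_ ?_
        · exact (C.contMDiffAt_φ (C.mem_φ_source hx₁)).comp (x₁, (0 : ℝ)) contMDiffAt_fst
        · exact contMDiffAt_snd.smul contMDiffAt_const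
      have h2 := C.contMDiffAt_ψ_symm (C.mem_ψ_target hx₁)
      rw [← zero_smul ℝ s] at h2
      exact h2.comp (x₁, (0 : ℝ)) h1
    · filter_upwards [hV] with x hx
      have h := C.hasVelocity_ψ_symm hx s
      rwa [← h.zero, ← C.fiberVec_coordSection hx] at h
  refine h5.congr_of_eventuallyEq ?_
  filter_upwards [hV] with x hx
  rw [zero_smul, C.ψ_symm_zero hx]
  rfl

end AdaptedCoordinates

end LieGroupoid

/-! ### Right-invariant vector fields in adapted coordinates. -/

namespace LieGroupoid

variable {EG : Type*} [NormedAddCommGroup EG] [NormedSpace ℝ EG]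
  {EM : Type*} [NormedAddCommGroup EM] [NormedSpace ℝ EM]
  {G : Type*} [TopologicalSpace G] [ChartedSpace EG G]
  {M : Type*} [TopologicalSpace M] [ChartedSpace EM M]
  [IsManifold 𝓘(ℝ, EG) ∞ G] {Γ : LieGroupoid EG EM G M}

/-- Multiplying by `c(t)⁻¹` on the left keeps `β`, hence the arrow of the bisection used on the
right. The two multiplications commute by associativity. -/
theorem rightVec_rightTrans [FiniteDimensional ℝ EG] [FiniteDimensional ℝ EM]
    [IsManifold 𝓘(ℝ, EM) ∞ M] (Y : Γ.LocalBisection) (X : Γ.AlgebroidSection) {g : G}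
    (hg : Γ.β g ∈ Y.src) :
    rightVec X (Y.rightTrans g) =
      modelDeriv 𝓘(ℝ, EG) 𝓘(ℝ, EG) Y.rightTrans g (rightVec X g) := by
  obtain ⟨c, -, hα, hv⟩ := X.exists_curve (Γ.α g)
  have h1 := (hasVelocity_rightVec hv hα).comp
    ((Y.contMDiffAt_rightTrans hg).mdifferentiableAt (by simp))
  have hα' := Y.α_rightTrans hg
  have h2 := hasVelocity_rightVec (X := X) (g := Y.rightTrans g) (by rwa [hα'])
    (by rwa [hα'])
  rw [map_neg] at h1
  refine neg_injective (h2.unique (h1.congr ?_))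
  filter_upwards [hα] with t ht
  have h3 : Γ.β (Γ.inv (c t)) = Γ.α g := by rw [Γ.β_inv, ht]
  rw [LocalBisection.rightTrans, LocalBisection.rightTrans, Γ.β_mul _ _ h3,
    Γ.mul_assoc _ _ _ h3 (Y.α_secα hg).symm]

namespace AdaptedCoordinates

variable {n m : ℕ} (C : Γ.AdaptedCoordinates n m) {z : (Fin n → ℝ) × (Fin m → ℝ)}

theorem contDiffAt_b (hz : z ∈ C.ψ.target) (hβ : Γ.β (C.ψ.symm z) ∈ C.φ.source) :
    ContDiffAt ℝ ∞ C.b z :=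
  contMDiffAt_iff_contDiffAt.1 ((C.contMDiffAt_φ hβ).comp z
    ((Γ.smooth_β _).comp z (C.contMDiffAt_ψ_symm hz)))

theorem b_zero {x : M} (hx : Γ.ε x ∈ C.ψ.source) : C.b (C.φ x, 0) = C.φ x := by
  rw [b, C.ψ_symm_zero hx, Γ.β_ε]

/-- The local expression of the product as a function of all its variables. -/
def pMap (q : ((Fin n → ℝ) × (Fin m → ℝ)) × (Fin m → ℝ)) : Fin m → ℝ := C.p q.1.1 q.1.2 q.2

theorem eventually_contDiffAt_pMap {x : M} (hx : Γ.ε x ∈ C.ψ.source) :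
    ∀ᶠ q in 𝓝 (((C.φ x, 0), 0) : ((Fin n → ℝ) × (Fin m → ℝ)) × (Fin m → ℝ)),
      ContDiffAt ℝ ∞ C.pMap q := by
  let V := ((Fin n → ℝ) × (Fin m → ℝ)) × (Fin m → ℝ)
  let q₀ : V := ((C.φ x, 0), 0)
  have hz := C.mem_ψ_target hx
  have hβ : Γ.β (C.ψ.symm q₀.1) = x := by
    change Γ.β (C.ψ.symm (C.φ x, 0)) = x
    rw [C.ψ_symm_zero hx, Γ.β_ε]
  have hxφ := C.mem_φ_source hx
  have hb : ContDiffAt ℝ ∞ C.b q₀.1 := C.contDiffAt_b hz (by rwa [hβ])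
  have E1 : ∀ᶠ q : V in 𝓝 q₀, q.1 ∈ C.ψ.target :=
    (continuous_fst.tendsto q₀).eventually_mem (C.ψ.open_target.mem_nhds hz)
  have E2 : ∀ᶠ q : V in 𝓝 q₀, Γ.β (C.ψ.symm q.1) ∈ C.φ.source := by
    have h1 : ContinuousAt (fun w => Γ.β (C.ψ.symm w)) q₀.1 :=
      ((Γ.smooth_β _).comp _ (C.contMDiffAt_ψ_symm hz)).continuousAt
    exact (h1.comp continuous_fst.continuousAt).eventually_mem
      (C.φ.open_source.mem_nhds (by simpa only [Function.comp_apply, hβ] using hxφ))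
  have E3 : ∀ᶠ q : V in 𝓝 q₀, (C.b q.1, q.2) ∈ C.ψ.target := by
    have h1 : ContinuousAt (fun q : V => (C.b q.1, q.2)) q₀ :=
      (hb.continuousAt.comp continuous_fst.continuousAt).prodMk continuous_snd.continuousAt
    refine h1.eventually_mem (C.ψ.open_target.mem_nhds ?_)
    change (C.b (C.φ x, 0), 0) ∈ C.ψ.target
    rwa [C.b_zero hx]
  have hcomp : ∀ q : V, Γ.β (C.ψ.symm q.1) ∈ C.φ.source → (C.b q.1, q.2) ∈ C.ψ.target →
      Γ.β (C.ψ.symm q.1) = Γ.α (C.ψ.symm (C.b q.1, q.2)) := by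
    intro q h2 h3
    rw [C.α_ψ_symm h3, b, C.φ.left_inv h2]
  have hmul : ∀ᶠ q : V in 𝓝 q₀, ContMDiffAt 𝓘(ℝ, V) 𝓘(ℝ, EG) ∞
      (fun q : V => Γ.mul (C.ψ.symm q.1) (C.ψ.symm (C.b q.1, q.2))) q := by
    filter_upwards [E1, E2, E3, E2.eventually_nhds, E3.eventually_nhds] with q h1 h2 h3 h4 h5
    refine Γ.contMDiffAt_mul ?_ ?_ ?_
    · exact (C.contMDiffAt_ψ_symm h1).comp q contDiffAt_fst.contMDiffAt
    · refine (C.contMDiffAt_ψ_symm h3).comp q (ContDiffAt.contMDiffAt ?_)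
      exact ((C.contDiffAt_b h1 h2).comp q contDiffAt_fst).prodMk contDiffAt_snd
    · filter_upwards [h4, h5] with q' h6 h7
      exact hcomp q' h6 h7
  have E4 : ∀ᶠ q : V in 𝓝 q₀,
      Γ.mul (C.ψ.symm q.1) (C.ψ.symm (C.b q.1, q.2)) ∈ C.ψ.source := by
    refine hmul.self_of_nhds.continuousAt.eventually_mem (C.ψ.open_source.mem_nhds ?_)
    change Γ.mul (C.ψ.symm (C.φ x, 0)) (C.ψ.symm (C.b (C.φ x, 0), 0)) ∈ C.ψ.source
    rw [C.b_zero hx, C.ψ_symm_zero hx]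
    have h := Γ.mul_ε (Γ.ε x)
    rw [Γ.β_ε] at h
    rwa [h]
  filter_upwards [hmul, E4] with q h1 h2
  have h3 : ContDiffAt ℝ ∞
      (fun q : V => C.ψ (Γ.mul (C.ψ.symm q.1) (C.ψ.symm (C.b q.1, q.2)))) q :=
    contMDiffAt_iff_contDiffAt.1 ((C.contMDiffAt_ψ h2).comp q h1)
  exact contDiffAt_snd.comp q h3

theorem pMap_zero_left {x : M} (hx : Γ.ε x ∈ C.ψ.source) {v : Fin m → ℝ}
    (hv : (C.φ x, v) ∈ C.ψ.target) : C.pMap ((C.φ x, 0), v) = v := by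
  change (C.ψ (Γ.mul (C.ψ.symm (C.φ x, 0)) (C.ψ.symm (C.b (C.φ x, 0), v)))).2 = v
  have h := Γ.ε_mul (C.ψ.symm (C.φ x, v))
  rw [C.α_line hx hv] at h
  rw [C.b_zero hx, C.ψ_symm_zero hx, h, C.ψ.right_inv hv]

/-- An identity acts trivially from the left, so `p(x, 0, v) = v`. This identity block allows `p` to
be solved for the velocity of its last argument. -/
theorem fderiv_pMap_zero_left {x : M} (hx : Γ.ε x ∈ C.ψ.source) {v : Fin m → ℝ}
    (hv : (C.φ x, v) ∈ C.ψ.target) (hp : DifferentiableAt ℝ C.pMap ((C.φ x, 0), v))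
    (w : Fin m → ℝ) : fderiv ℝ C.pMap ((C.φ x, 0), v) (0, w) = w := by
  have hl : HasFDerivAt (fun v : Fin m → ℝ => (((C.φ x, 0), v) :
      ((Fin n → ℝ) × (Fin m → ℝ)) × (Fin m → ℝ))) (ContinuousLinearMap.inr ℝ _ _) v :=
    hasFDerivAt_prodMk_right _ _
  have h1 := (hp.hasFDerivAt (x := ((C.φ x, 0), v))).comp v hl
  have h2 : (fun v : Fin m → ℝ => C.pMap ((C.φ x, 0), v)) =ᶠ[𝓝 v] fun v => v := by
    have hc : ContinuousAt (fun v : Fin m → ℝ => (C.φ x, v)) v := by fun_prop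
    filter_upwards [hc.eventually_mem (C.ψ.open_target.mem_nhds hv)] with v' hv'
    exact C.pMap_zero_left hx hv'
  have h3 := h1.unique ((hasFDerivAt_id v).congr_of_eventuallyEq h2)
  exact DFunLike.congr_fun h3 w

variable [FiniteDimensional ℝ EG] [FiniteDimensional ℝ EM] [IsManifold 𝓘(ℝ, EM) ∞ M]

/-- The coordinate expression of a right-invariant vector field. -/
theorem modelDeriv_ψ_rightVec {X : Γ.AlgebroidSection} {g : G} (hg : g ∈ C.ψ.source)
    (hx : Γ.ε (Γ.α g) ∈ C.ψ.source) {s : Fin m → ℝ}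
    (hX : X.vec (Γ.α g) = modelDeriv 𝓘(ℝ, (Fin n → ℝ) × (Fin m → ℝ)) 𝓘(ℝ, EG) C.ψ.symm
      (C.φ (Γ.α g), 0) (0, s))
    (hp : DifferentiableAt ℝ C.pMap ((C.φ (Γ.α g), 0), (C.ψ g).2)) :
    modelDeriv 𝓘(ℝ, EG) 𝓘(ℝ, (Fin n → ℝ) × (Fin m → ℝ)) C.ψ g (rightVec X g) =
      (-fderiv ℝ C.b (C.φ (Γ.α g), 0) (0, s),
        fderiv ℝ C.pMap ((C.φ (Γ.α g), 0), (C.ψ g).2) ((0, s), 0)) := by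
  set x := Γ.α g with hxdef
  have hψg : C.ψ g = (C.φ x, (C.ψ g).2) := Prod.ext (C.fst_ψ g hg) rfl
  have hmem : (C.φ x, (C.ψ g).2) ∈ C.ψ.target := hψg ▸ C.ψ.map_source hg
  have hline : HasDerivAt (fun t : ℝ => ((C.φ x, t • s) : (Fin n → ℝ) × (Fin m → ℝ))) (0, s) 0 := by
    have h := ((hasDerivAt_id (0 : ℝ)).smul_const s)
    rw [one_smul] at h
    exact (hasDerivAt_const (0 : ℝ) (C.φ x)).prodMk h
  let c : ℝ → G := fun t => C.ψ.symm (C.φ x, t • s)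
  have hc : HasVelocity 𝓘(ℝ, EG) c (Γ.ε x) (X.vec x) := by
    rw [hX]
    exact C.hasVelocity_ψ_symm hx s
  have hcα : ∀ᶠ t in 𝓝 0, Γ.α (c t) = x :=
    (C.eventually_line_mem hx s).mono fun t ht => C.α_line hx ht
  let k : ℝ → G := fun t => Γ.mul (Γ.inv (c t)) g
  have hk : HasVelocity 𝓘(ℝ, EG) k g (-rightVec X g) := hasVelocity_rightVec hc hcα
  have hkψ : ∀ᶠ t in 𝓝 0, k t ∈ C.ψ.source := by
    have := hk.continuousAt
    rw [ContinuousAt, hk.zero] at this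
    exact this.eventually_mem (C.ψ.open_source.mem_nhds hg)
  have h1 := (hasVelocity_iff_hasDerivAt.1
    (hk.comp ((C.contMDiffAt_ψ hg).mdifferentiableAt (by simp))))
  rw [map_neg] at h1
  set ζ := modelDeriv 𝓘(ℝ, EG) 𝓘(ℝ, (Fin n → ℝ) × (Fin m → ℝ)) C.ψ g (rightVec X g)
  have hfst : ∀ᶠ t in 𝓝 0, (C.ψ (k t)).1 = C.b (C.φ x, t • s) := by
    filter_upwards [hkψ, hcα] with t h2 h3
    rw [C.fst_ψ _ h2, Γ.α_mul _ _ (by rw [Γ.β_inv, h3]), Γ.α_inv]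
    rfl
  have hb : ContDiffAt ℝ ∞ C.b (C.φ x, 0) := C.contDiffAt_b (C.mem_ψ_target hx) (by
    rw [C.ψ_symm_zero hx, Γ.β_ε]
    exact C.mem_φ_source hx)
  have hD1 : HasDerivAt (fun t => (C.ψ (k t)).1) (-ζ).1 0 := h1.2.fst
  have hD2 : HasDerivAt (fun t => (C.ψ (k t)).2) (-ζ).2 0 := h1.2.snd
  have e1 : (-ζ).1 = fderiv ℝ C.b (C.φ x, 0) (0, s) := by
    have h2 := (hb.differentiableAt (by simp)).hasFDerivAt.comp_hasDerivAt_of_eq (0 : ℝ) hline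
      (by simp)
    exact hD1.unique (h2.congr_of_eventuallyEq hfst)
  -- The relation `c(t) k(t) = g` says that `p(x, t s, w(t))` is constant, where `w` is the
  -- `u`-coordinate of `k`. Differentiating and using the identity block gives `w'(0) = -R s`; the
  -- curve `k` has velocity minus the right-invariant field, so the component becomes `R s`.
  have e2 : fderiv ℝ C.pMap ((C.φ x, 0), (C.ψ g).2) ((0, s), (-ζ).2) = 0 := by
    have h2 := hp.hasFDerivAt.comp_hasDerivAt_of_eq (0 : ℝ) (hline.prodMk hD2)
      (by rw [hk.zero, zero_smul])
    refine h2.unique ((hasDerivAt_const (0 : ℝ) (C.ψ g).2).congr_of_eventuallyEq ?_)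
    filter_upwards [hfst, hkψ, hcα] with t h3 h4 h5
    change (C.ψ (Γ.mul (c t) (C.ψ.symm (C.b (C.φ x, t • s), (C.ψ (k t)).2)))).2 = _
    rw [← h3, Prod.mk.eta, C.ψ.left_inv h4, Γ.mul_inv_cancel_left h5]
  have h3 : (((0, s), (-ζ).2) : ((Fin n → ℝ) × (Fin m → ℝ)) × (Fin m → ℝ)) =
      ((0, s), 0) + (0, (-ζ).2) := by simp
  rw [h3, map_add, C.fderiv_pMap_zero_left hx hmem hp] at e2
  refine Prod.ext ?_ ?_
  · rw [← e1, Prod.fst_neg, neg_neg]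
  · rw [Prod.snd_neg, add_neg_eq_zero] at e2
    exact e2.symm

end AdaptedCoordinates

end LieGroupoid

/-! ### The local matrices as matrices of the mixed derivative form. -/

namespace LieGroupoid

section Local

variable {n m : ℕ}

theorem fderiv_prod_apply {F : (Fin n → ℝ) × (Fin m → ℝ) → ℝ} {z : (Fin n → ℝ) × (Fin m → ℝ)}
    (w : (Fin n → ℝ) × (Fin m → ℝ)) :
    fderiv ℝ F z w = ∑ i, w.1 i * pdx F i z + ∑ ν, w.2 ν * pdu F ν z := by
  have h : w = ∑ i, w.1 i • ((Pi.single i 1, 0) : (Fin n → ℝ) × (Fin m → ℝ)) +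
      ∑ ν, w.2 ν • ((0, Pi.single ν 1) : (Fin n → ℝ) × (Fin m → ℝ)) := by
    refine Prod.ext ?_ ?_
    · simp only [Prod.fst_add, Prod.fst_sum, Prod.smul_mk, smul_zero, Finset.sum_const_zero,
        add_zero]
      exact pi_eq_sum_univ' w.1
    · simp only [Prod.snd_add, Prod.snd_sum, Prod.smul_mk, smul_zero, Finset.sum_const_zero,
        zero_add]
      exact pi_eq_sum_univ' w.2
  conv_lhs => rw [h]
  simp only [map_add, map_sum, map_smul, smul_eq_mul, pdx, pdu]

theorem hasFDerivAt_fderiv_apply {F : (Fin n → ℝ) × (Fin m → ℝ) → ℝ}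
    {z : (Fin n → ℝ) × (Fin m → ℝ)} (hF : ContDiffAt ℝ ∞ F z) (v : (Fin n → ℝ) × (Fin m → ℝ)) :
    HasFDerivAt (fun y => fderiv ℝ F y v) ((fderiv ℝ (fderiv ℝ F) z).flip v) z := by
  have h : DifferentiableAt ℝ (fderiv ℝ F) z :=
    (hF.fderiv_right (m := 1) (by decide)).differentiableAt (by simp)
  have := h.hasFDerivAt.clm_apply (hasFDerivAt_const v z)
  simpa using this

theorem fderiv_fderiv_apply_comm {F : (Fin n → ℝ) × (Fin m → ℝ) → ℝ}
    {z : (Fin n → ℝ) × (Fin m → ℝ)} (hF : ContDiffAt ℝ ∞ F z) (v w : (Fin n → ℝ) × (Fin m → ℝ)) :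
    fderiv ℝ (fun y => fderiv ℝ F y v) z w = fderiv ℝ (fun y => fderiv ℝ F y w) z v := by
  rw [(hasFDerivAt_fderiv_apply hF v).fderiv, (hasFDerivAt_fderiv_apply hF w).fderiv]
  exact (hF.isSymmSndFDerivAt (by simp; decide)) w v

end Local

variable {EG : Type*} [NormedAddCommGroup EG] [NormedSpace ℝ EG]
  {EM : Type*} [NormedAddCommGroup EM] [NormedSpace ℝ EM]
  {G : Type*} [TopologicalSpace G] [ChartedSpace EG G]
  {M : Type*} [TopologicalSpace M] [ChartedSpace EM M]
  [IsManifold 𝓘(ℝ, EG) ∞ G] {Γ : LieGroupoid EG EM G M}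

namespace AdaptedCoordinates

variable {n m : ℕ} (C : Γ.AdaptedCoordinates n m) {z : (Fin n → ℝ) × (Fin m → ℝ)}

theorem localMatrix_congr {F F' : (Fin n → ℝ) × (Fin m → ℝ) → ℝ} (h : F =ᶠ[𝓝 z] F') :
    C.localMatrix F z = C.localMatrix F' z := by
  have h1 : ∀ γ, pdu F γ =ᶠ[𝓝 z] pdu F' γ := fun γ =>
    h.fderiv.mono fun y hy => by rw [pdu, pdu, hy]
  ext γ μ
  simp only [localMatrix, Matrix.of_apply]
  congr 1
  · congr 1
    · refine Finset.sum_congr rfl fun i _ => ?_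
      rw [pdx, pdx, (h1 γ).fderiv_eq]
    · refine Finset.sum_congr rfl fun ν _ => ?_
      rw [(h1 ν).eq_of_nhds]
  · refine Finset.sum_congr rfl fun ν _ => ?_
    rw [pdu, (h1 γ).fderiv_eq, ← pdu]

/-- The matrix `localMatrix F` collects the derivatives, in the direction of the fibres, of the
functions `ρ^i_μ ∂F/∂x^i - R^ν_μ ∂F/∂u^ν`. -/
theorem localMatrix_eq_of_hasFDerivAt {F : (Fin n → ℝ) × (Fin m → ℝ) → ℝ}
    (hF : ContDiffAt ℝ ∞ F z) {μ : Fin m} (hR : ∀ ν, DifferentiableAt ℝ (C.R ν μ) z)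
    {H : (Fin n → ℝ) × (Fin m → ℝ) → ℝ} {H' : ((Fin n → ℝ) × (Fin m → ℝ)) →L[ℝ] ℝ}
    (hH' : HasFDerivAt H H' z)
    (hH : ∀ᶠ y in 𝓝 z, H y = ∑ i, C.rho i μ y.1 * pdx F i y - ∑ ν, C.R ν μ y * pdu F ν y)
    (γ : Fin m) : C.localMatrix F z γ μ = H' (0, Pi.single γ 1) := by
  let s : Fin m → ℝ := Pi.single γ 1
  -- Only `u` varies along this line, so `ρ(x)` is constant and contributes no derivative term.
  let l : ℝ → (Fin n → ℝ) × (Fin m → ℝ) := fun t => (z.1, z.2 + t • s)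
  have hl : HasDerivAt l (0, s) 0 := by
    have h := ((hasDerivAt_id (0 : ℝ)).smul_const s).const_add z.2
    rw [one_smul] at h
    exact (hasDerivAt_const (0 : ℝ) z.1).prodMk h
  have hl0 : l 0 = z := by simp [l]
  have h1 : HasDerivAt (fun t => H (l t)) (H' (0, s)) 0 :=
    hH'.comp_hasDerivAt_of_eq (0 : ℝ) hl hl0.symm
  have hlc : Tendsto l (𝓝 0) (𝓝 z) := by
    have := hl.continuousAt
    rwa [ContinuousAt, hl0] at this
  have hdx : ∀ i, HasDerivAt (fun t => pdx F i (l t)) (pdx (pdu F γ) i z) 0 := fun i => by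
    have h := (hasFDerivAt_fderiv_apply hF (Pi.single i 1, 0)).comp_hasDerivAt_of_eq
      (0 : ℝ) hl hl0.symm
    rw [← (hasFDerivAt_fderiv_apply hF _).fderiv, fderiv_fderiv_apply_comm hF] at h
    exact h
  have hdu : ∀ ν, HasDerivAt (fun t => pdu F ν (l t)) (pdu (pdu F γ) ν z) 0 := fun ν => by
    have h := (hasFDerivAt_fderiv_apply hF (0, Pi.single ν 1)).comp_hasDerivAt_of_eq
      (0 : ℝ) hl hl0.symm
    rw [← (hasFDerivAt_fderiv_apply hF _).fderiv, fderiv_fderiv_apply_comm hF] at h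
    exact h
  have hdR : ∀ ν, HasDerivAt (fun t => C.R ν μ (l t)) (pdu (C.R ν μ) γ z) 0 := fun ν =>
    (hR ν).hasFDerivAt.comp_hasDerivAt_of_eq (0 : ℝ) hl hl0.symm
  have h2 : HasDerivAt (fun t => ∑ i, C.rho i μ z.1 * pdx F i (l t) -
      ∑ ν, C.R ν μ (l t) * pdu F ν (l t))
      (∑ i, C.rho i μ z.1 * pdx (pdu F γ) i z -
        ∑ ν, (pdu (C.R ν μ) γ z * pdu F ν (l 0) + C.R ν μ (l 0) * pdu (pdu F γ) ν z)) 0 := by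
    refine HasDerivAt.sub ?_ ?_
    · exact HasDerivAt.fun_sum fun i _ => (hdx i).const_mul _
    · exact HasDerivAt.fun_sum fun ν _ => (hdR ν).mul (hdu ν)
  rw [hl0, Finset.sum_add_distrib, ← sub_sub] at h2
  exact h2.unique (h1.congr_of_eventuallyEq ((hlc.eventually hH).mono fun t ht => ht.symm))

theorem R_eq_fderiv_pMap {ν μ : Fin m} (hp : DifferentiableAt ℝ C.pMap ((z.1, 0), z.2)) :
    C.R ν μ z = fderiv ℝ C.pMap ((z.1, 0), z.2) ((0, Pi.single μ 1), 0) ν := by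
  have hl : HasFDerivAt (fun u : Fin m → ℝ => (((z.1, u), z.2) :
      ((Fin n → ℝ) × (Fin m → ℝ)) × (Fin m → ℝ)))
      ((ContinuousLinearMap.prod 0 (ContinuousLinearMap.id ℝ _)).prod 0) 0 :=
    ((hasFDerivAt_const z.1 _).prodMk (hasFDerivAt_id _)).prodMk (hasFDerivAt_const z.2 _)
  have h1 := hp.hasFDerivAt.comp (0 : Fin m → ℝ) hl
  have h2 := hasFDerivAt_pi'.1 h1 ν
  rw [R, show (fun u => C.p z.1 u z.2 ν) =
    fun u => (C.pMap ∘ fun u : Fin m → ℝ => ((z.1, u), z.2)) u ν from rfl, h2.fderiv]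
  rfl

theorem differentiableAt_R {x : M} (hx : Γ.ε x ∈ C.ψ.source) (ν μ : Fin m) :
    DifferentiableAt ℝ (C.R ν μ) (C.φ x, 0) := by
  have hp := C.eventually_contDiffAt_pMap hx
  have hc : Continuous (fun z : (Fin n → ℝ) × (Fin m → ℝ) => (((z.1, 0), z.2) :
      ((Fin n → ℝ) × (Fin m → ℝ)) × (Fin m → ℝ))) := by fun_prop
  have hd : Differentiable ℝ (fun z : (Fin n → ℝ) × (Fin m → ℝ) => (((z.1, 0), z.2) :
      ((Fin n → ℝ) × (Fin m → ℝ)) × (Fin m → ℝ))) := by fun_prop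
  have h1 : DifferentiableAt ℝ (fderiv ℝ C.pMap) ((C.φ x, 0), 0) :=
    (hp.self_of_nhds.fderiv_right (m := 1) (by decide)).differentiableAt (by simp)
  have h2 : DifferentiableAt ℝ (fun z : (Fin n → ℝ) × (Fin m → ℝ) =>
      fderiv ℝ C.pMap ((z.1, 0), z.2) ((0, Pi.single μ 1), 0)) (C.φ x, 0) :=
    (DifferentiableAt.comp (C.φ x, (0 : Fin m → ℝ)) (g := fderiv ℝ C.pMap) h1
      (hd _)).clm_apply (differentiableAt_const _)
  refine (differentiableAt_pi.1 h2 ν).congr_of_eventuallyEq ?_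
  filter_upwards [(hc.tendsto (C.φ x, 0)).eventually hp] with z hz
  exact C.R_eq_fderiv_pMap (hz.differentiableAt (by simp))

theorem rho_eq_fderiv_b {x : M} (hx : Γ.ε x ∈ C.ψ.source) (i : Fin n) (μ : Fin m) :
    C.rho i μ (C.φ x) = fderiv ℝ C.b (C.φ x, 0) (0, Pi.single μ 1) i := by
  have hb : ContDiffAt ℝ ∞ C.b (C.φ x, 0) := C.contDiffAt_b (C.mem_ψ_target hx) (by
    rw [C.ψ_symm_zero hx, Γ.β_ε]
    exact C.mem_φ_source hx)
  have h := hasFDerivAt_pi'.1 (hb.differentiableAt (by simp)).hasFDerivAt i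
  rw [rho, pdu, h.fderiv]
  rfl

variable [FiniteDimensional ℝ EG] [FiniteDimensional ℝ EM] [IsManifold 𝓘(ℝ, EM) ∞ M]
  {L : G → ℝ} {Y : Γ.LocalBisection}

theorem rightDeriv_rightTrans (hL : ContMDiff 𝓘(ℝ, EG) 𝓘(ℝ, ℝ) ∞ L) (X : Γ.AlgebroidSection)
    {g : G} (hg : g ∈ C.ψ.source) (hY : Γ.β g ∈ Y.src) :
    rightDeriv L X (Y.rightTrans g) =
      fderiv ℝ (fun z => L (Y.rightTrans (C.ψ.symm z))) (C.ψ g)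
        (modelDeriv 𝓘(ℝ, EG) 𝓘(ℝ, (Fin n → ℝ) × (Fin m → ℝ)) C.ψ g (rightVec X g)) := by
  have hF : MDifferentiableAt 𝓘(ℝ, (Fin n → ℝ) × (Fin m → ℝ)) 𝓘(ℝ, ℝ)
      (fun z => L (Y.rightTrans (C.ψ.symm z))) (C.ψ g) := by
    refine ((hL _).comp (C.ψ g) (ContMDiffAt.comp (C.ψ g) (g := Y.rightTrans) ?_
      (C.contMDiffAt_ψ_symm (C.ψ.map_source hg)))).mdifferentiableAt (by simp)
    rw [C.ψ.left_inv hg]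
    exact Y.contMDiffAt_rightTrans hY
  have h1 := modelDeriv_comp (x := g) rfl (hL.mdifferentiable (by simp) _)
    ((Y.contMDiffAt_rightTrans hY).mdifferentiableAt (by simp))
  have h2 := modelDeriv_comp (x := g) rfl hF ((C.contMDiffAt_ψ hg).mdifferentiableAt (by simp))
  have h3 : (fun h => L (Y.rightTrans (C.ψ.symm (C.ψ h)))) =ᶠ[𝓝 g] fun h => L (Y.rightTrans h) :=
    eventually_of_mem (C.ψ.open_source.mem_nhds hg) fun h hh => by
      simp only [C.ψ.left_inv hh]
  rw [modelDeriv_congr h3, h1, modelDeriv_eq_fderiv] at h2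
  rw [rightDeriv, rightVec_rightTrans Y X hY]
  exact DFunLike.congr_fun h2 (rightVec X g)

theorem contDiffAt_rightTrans (hL : ContMDiff 𝓘(ℝ, EG) 𝓘(ℝ, ℝ) ∞ L) (hz : z ∈ C.ψ.target)
    (hY : Γ.β (C.ψ.symm z) ∈ Y.src) :
    ContDiffAt ℝ ∞ (fun z => L (Y.rightTrans (C.ψ.symm z))) z :=
  contMDiffAt_iff_contDiffAt.1 ((hL _).comp z
    ((Y.contMDiffAt_rightTrans hY).comp z (C.contMDiffAt_ψ_symm hz)))

/-- Right-invariant fields are preserved by right translation, so the derivative may be taken in the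
coordinates `ψ`, where the field is `(-ρ, R)`. The minus sign matches the convention of the local
matrix. -/
theorem rightDeriv_rightTrans_eq_sum (hL : ContMDiff 𝓘(ℝ, EG) 𝓘(ℝ, ℝ) ∞ L)
    {X : Γ.AlgebroidSection} {g : G} (hg : g ∈ C.ψ.source) (hY : Γ.β g ∈ Y.src)
    (hx : Γ.ε (Γ.α g) ∈ C.ψ.source) {μ : Fin m}
    (hX : X.vec (Γ.α g) = modelDeriv 𝓘(ℝ, (Fin n → ℝ) × (Fin m → ℝ)) 𝓘(ℝ, EG) C.ψ.symm
      (C.φ (Γ.α g), 0) (0, Pi.single μ 1))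
    (hp : DifferentiableAt ℝ C.pMap (((C.ψ g).1, 0), (C.ψ g).2)) :
    -rightDeriv L X (Y.rightTrans g) =
      ∑ i, C.rho i μ (C.ψ g).1 * pdx (fun z => L (Y.rightTrans (C.ψ.symm z))) i (C.ψ g) -
        ∑ ν, C.R ν μ (C.ψ g) * pdu (fun z => L (Y.rightTrans (C.ψ.symm z))) ν (C.ψ g) := by
  have h1 : (C.ψ g).1 = C.φ (Γ.α g) := C.fst_ψ g hg
  rw [C.rightDeriv_rightTrans hL X hg hY, C.modelDeriv_ψ_rightVec hg hx hX (h1 ▸ hp),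
    fderiv_prod_apply]
  simp only [Pi.neg_apply, C.R_eq_fderiv_pMap hp, h1, C.rho_eq_fderiv_b hx, neg_mul,
    Finset.sum_neg_distrib]
  ring

/-- The entries of the matrix `FL` at an identity are mixed derivatives of `L`. -/
theorem FL_apply (hL : ContMDiff 𝓘(ℝ, EG) 𝓘(ℝ, ℝ) ∞ L) {x : M} (hx : Γ.ε x ∈ C.ψ.source)
    (hY : x ∈ Y.src) {X : Γ.AlgebroidSection} {μ : Fin m}
    (hX : ∀ᶠ y in 𝓝 x, X.vec y = modelDeriv 𝓘(ℝ, (Fin n → ℝ) × (Fin m → ℝ)) 𝓘(ℝ, EG) C.ψ.symm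
      (C.φ y, 0) (0, Pi.single μ 1)) (γ : Fin m) :
    C.FL L Y (C.φ x, 0) γ μ =
      -modelDeriv 𝓘(ℝ, EG) 𝓘(ℝ, ℝ) (rightDeriv L X) (Y.rightTrans (Γ.ε x))
        (modelDeriv 𝓘(ℝ, (Fin n → ℝ) × (Fin m → ℝ)) 𝓘(ℝ, EG)
          (fun z => Y.rightTrans (C.ψ.symm z)) (C.φ x, 0) (0, Pi.single γ 1)) := by
  have hz := C.mem_ψ_target hx
  have hβ : Γ.β (C.ψ.symm (C.φ x, 0)) = x := by rw [C.ψ_symm_zero hx, Γ.β_ε]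
  have hα : Γ.α (C.ψ.symm (C.φ x, 0)) = x := by rw [C.ψ_symm_zero hx, Γ.α_ε]
  have hs := C.contMDiffAt_ψ_symm hz
  have hΦ : ContMDiffAt 𝓘(ℝ, (Fin n → ℝ) × (Fin m → ℝ)) 𝓘(ℝ, EG) ∞
      (fun z => Y.rightTrans (C.ψ.symm z)) (C.φ x, 0) :=
    (Y.contMDiffAt_rightTrans (by rwa [hβ])).comp _ hs
  have hH : HasFDerivAt (fun z => -rightDeriv L X (Y.rightTrans (C.ψ.symm z)))
      (-((modelDeriv 𝓘(ℝ, EG) 𝓘(ℝ, ℝ) (rightDeriv L X) (Y.rightTrans (Γ.ε x))).comp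
        (modelDeriv 𝓘(ℝ, (Fin n → ℝ) × (Fin m → ℝ)) 𝓘(ℝ, EG)
          (fun z => Y.rightTrans (C.ψ.symm z)) (C.φ x, 0)))) (C.φ x, 0) := by
    have hd := (contMDiff_rightDeriv hL X).mdifferentiable (by simp) (Y.rightTrans (Γ.ε x))
    rw [← modelDeriv_comp (by rw [C.ψ_symm_zero hx]) hd (hΦ.mdifferentiableAt (by simp)),
      modelDeriv_eq_fderiv]
    refine HasFDerivAt.neg (DifferentiableAt.hasFDerivAt ?_)
    exact (contMDiffAt_iff_contDiffAt.1
      (((contMDiff_rightDeriv hL X) _).comp _ hΦ)).differentiableAt (by simp)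
  have hβc : ContinuousAt (fun z => Γ.β (C.ψ.symm z)) (C.φ x, 0) :=
    ((Γ.smooth_β _).comp _ hs).continuousAt
  have hαc : ContinuousAt (fun z => Γ.α (C.ψ.symm z)) (C.φ x, 0) :=
    ((Γ.smooth_α _).comp _ hs).continuousAt
  rw [ContinuousAt, hβ] at hβc
  rw [ContinuousAt, hα] at hαc
  have hc : Continuous (fun z : (Fin n → ℝ) × (Fin m → ℝ) => (((z.1, 0), z.2) :
      ((Fin n → ℝ) × (Fin m → ℝ)) × (Fin m → ℝ))) := by fun_prop
  refine C.localMatrix_eq_of_hasFDerivAt (C.contDiffAt_rightTrans hL hz (by rwa [hβ]))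
    (fun ν => C.differentiableAt_R hx ν μ) hH ?_ γ
  filter_upwards [C.ψ.open_target.mem_nhds hz, hβc (Y.isOpen_src.mem_nhds hY),
    hαc (C.isOpen_ε_preimage.mem_nhds hx), hαc.eventually hX,
    (hc.tendsto (C.φ x, 0)).eventually (C.eventually_contDiffAt_pMap hx)] with z h1 h2 h3 h4 h5
  have h6 := C.rightDeriv_rightTrans_eq_sum hL (X := X) (C.ψ.map_target h1) h2 h3 h4
    (by rw [C.ψ.right_inv h1]; exact h5.differentiableAt (by simp))
  rwa [C.ψ.right_inv h1] at h6

/-- The kernel of `Tα` in the coordinates transported by a right translation. -/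
theorem ker_modelDeriv_α_rightTrans {x : M} (hx : Γ.ε x ∈ C.ψ.source) (hY : x ∈ Y.src) :
    ∃ T : (Fin m → ℝ) →ₗ[ℝ] EG,
      (∀ s, T s = modelDeriv 𝓘(ℝ, (Fin n → ℝ) × (Fin m → ℝ)) 𝓘(ℝ, EG)
        (fun z => Y.rightTrans (C.ψ.symm z)) (C.φ x, 0) (0, s)) ∧
      Function.Injective T ∧
      ∀ w, modelDeriv 𝓘(ℝ, EG) 𝓘(ℝ, EM) Γ.α (Y.rightTrans (Γ.ε x)) w = 0 ↔ ∃ s, T s = w := by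
  have hz := C.mem_ψ_target hx
  have hβ : Γ.β (C.ψ.symm (C.φ x, 0)) = x := by rw [C.ψ_symm_zero hx, Γ.β_ε]
  have hs := C.contMDiffAt_ψ_symm hz
  -- `Φ` and `Φ'` are mutually inverse near the base points. Right translation preserves `α`, so
  -- `ker Tα` at the translated arrow corresponds to the coordinate vectors `(0, s)`.
  let Φ := fun z => Y.rightTrans (C.ψ.symm z)
  let Φ' := fun k => C.ψ (Y.inverse.rightTrans k)
  let h₀ := Y.rightTrans (Γ.ε x)
  have hΦ0 : Φ (C.φ x, 0) = h₀ := by simp only [Φ, h₀, C.ψ_symm_zero hx]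
  have hβε : Γ.β (Γ.ε x) ∈ Y.src := by rwa [Γ.β_ε]
  have hβh₀ : Γ.β h₀ ∈ Y.tgt := by
    have : Γ.β h₀ = Γ.β (Y.secα x) := by
      simp only [h₀, LocalBisection.rightTrans, Γ.β_ε]
      rw [Γ.β_mul _ _ (by rw [Γ.β_ε, Y.α_secα hY])]
    rw [this]
    exact Y.mapsTo_β (Y.mapsTo_secα hY)
  have hinv0 : Y.inverse.rightTrans h₀ = Γ.ε x := Y.inverse_rightTrans_rightTrans hβε
  have hΦ : ContMDiffAt 𝓘(ℝ, (Fin n → ℝ) × (Fin m → ℝ)) 𝓘(ℝ, EG) ∞ Φ (C.φ x, 0) :=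
    (Y.contMDiffAt_rightTrans (by rwa [hβ])).comp _ hs
  have hR' : ContMDiffAt 𝓘(ℝ, EG) 𝓘(ℝ, EG) ∞ Y.inverse.rightTrans h₀ :=
    Y.inverse.contMDiffAt_rightTrans hβh₀
  have hΦ' : ContMDiffAt 𝓘(ℝ, EG) 𝓘(ℝ, (Fin n → ℝ) × (Fin m → ℝ)) ∞ Φ' h₀ :=
    ContMDiffAt.comp h₀ (by rw [hinv0]; exact C.contMDiffAt_ψ hx) hR'
  have hΦ'0 : Φ' h₀ = (C.φ x, 0) := by simp only [Φ', hinv0, C.ψ_ε hx]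
  have hβc : ContinuousAt (fun z => Γ.β (C.ψ.symm z)) (C.φ x, 0) :=
    ((Γ.smooth_β _).comp _ hs).continuousAt
  rw [ContinuousAt, hβ] at hβc
  have hsrc : ∀ᶠ z in 𝓝 (C.φ x, 0), z ∈ C.ψ.target ∧ Γ.β (C.ψ.symm z) ∈ Y.src :=
    Filter.Eventually.and (C.ψ.open_target.mem_nhds hz) (hβc (Y.isOpen_src.mem_nhds hY))
  have hR'c := hR'.continuousAt
  rw [ContinuousAt, hinv0] at hR'c
  have htgt : ∀ᶠ k in 𝓝 h₀, Γ.β k ∈ Y.tgt ∧ Y.inverse.rightTrans k ∈ C.ψ.source :=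
    Filter.Eventually.and (Γ.smooth_β.continuous.continuousAt (Y.isOpen_tgt.mem_nhds hβh₀))
      (hR'c (C.ψ.open_source.mem_nhds hx))
  have hl : (fun z => Φ' (Φ z)) =ᶠ[𝓝 (C.φ x, 0)] fun z => z := by
    filter_upwards [hsrc] with z h1
    simp only [Φ, Φ', Y.inverse_rightTrans_rightTrans h1.2, C.ψ.right_inv h1.1]
  have hr : (fun k => Φ (Φ' k)) =ᶠ[𝓝 h₀] fun k => k := by
    filter_upwards [htgt] with k h1
    simp only [Φ, Φ', C.ψ.left_inv h1.2, Y.rightTrans_inverse_rightTrans h1.1]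
  let D := modelDeriv 𝓘(ℝ, (Fin n → ℝ) × (Fin m → ℝ)) 𝓘(ℝ, EG) Φ (C.φ x, 0)
  let D' := modelDeriv 𝓘(ℝ, EG) 𝓘(ℝ, (Fin n → ℝ) × (Fin m → ℝ)) Φ' h₀
  have hDl : ∀ w, D' (D w) = w := fun w => by
    have h := modelDeriv_comp hΦ0 (hΦ'.mdifferentiableAt (by simp))
      (hΦ.mdifferentiableAt (by simp))
    rw [modelDeriv_congr hl, modelDeriv_id] at h
    exact (DFunLike.congr_fun h w).symm
  have hDr : ∀ w, D (D' w) = w := fun w => by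
    have h := modelDeriv_comp hΦ'0 (hΦ.mdifferentiableAt (by simp))
      (hΦ'.mdifferentiableAt (by simp))
    rw [modelDeriv_congr hr, modelDeriv_id] at h
    exact (DFunLike.congr_fun h w).symm
  have hα : ∀ w, modelDeriv 𝓘(ℝ, EG) 𝓘(ℝ, EM) Γ.α (Γ.ε x)
      (modelDeriv 𝓘(ℝ, EG) 𝓘(ℝ, EG) Y.inverse.rightTrans h₀ w) =
        modelDeriv 𝓘(ℝ, EG) 𝓘(ℝ, EM) Γ.α h₀ w := fun w => by
    have h := modelDeriv_comp hinv0 (Γ.smooth_α.mdifferentiable (by simp) _)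
      (hR'.mdifferentiableAt (by simp))
    have h2 : (fun k => Γ.α (Y.inverse.rightTrans k)) =ᶠ[𝓝 h₀] Γ.α := by
      filter_upwards [htgt] with k hk
      exact Y.inverse.α_rightTrans hk.1
    rw [modelDeriv_congr h2] at h
    exact (DFunLike.congr_fun h w).symm
  have hD'eq : ∀ w, D' w = modelDeriv 𝓘(ℝ, EG) 𝓘(ℝ, (Fin n → ℝ) × (Fin m → ℝ)) C.ψ (Γ.ε x)
      (modelDeriv 𝓘(ℝ, EG) 𝓘(ℝ, EG) Y.inverse.rightTrans h₀ w) := fun w =>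
    DFunLike.congr_fun (modelDeriv_comp hinv0 ((C.contMDiffAt_ψ hx).mdifferentiableAt (by simp))
      (hR'.mdifferentiableAt (by simp))) w
  refine ⟨D.toLinearMap.comp (LinearMap.inr ℝ _ _), fun s => rfl, fun s s' h => ?_, fun w => ?_⟩
  · have h1 := congrArg (fun w => (D' w).2) h
    change (D' (D (0, s))).2 = (D' (D (0, s'))).2 at h1
    rwa [hDl, hDl] at h1
  constructor
  · intro hw
    rw [← hα] at hw
    have h1 := C.fst_modelDeriv_ψ hx hw
    rw [← hD'eq] at h1
    refine ⟨(D' w).2, ?_⟩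
    change D (0, (D' w).2) = w
    conv_rhs => rw [← hDr w]
    rw [← h1]
  · rintro ⟨s, rfl⟩
    change modelDeriv 𝓘(ℝ, EG) 𝓘(ℝ, EM) Γ.α h₀ (D (0, s)) = 0
    rw [← hα, ← C.modelDeriv_ψ_symm_ψ hx (modelDeriv 𝓘(ℝ, EG) 𝓘(ℝ, EG) Y.inverse.rightTrans h₀
      (D (0, s))), ← hD'eq, hDl, C.ψ_ε hx]
    exact C.modelDeriv_α_ψ_symm hx s

variable [T2Space M]

/-- Regularity of the matrix `FL` at an identity. -/
theorem isUnit_FL_iff (hL : ContMDiff 𝓘(ℝ, EG) 𝓘(ℝ, ℝ) ∞ L) {h : G}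
    (hx : Γ.ε (Γ.α h) ∈ C.ψ.source) (hh : h ∈ Y.carrier) :
    IsUnit (C.FL L Y (C.φ (Γ.α h), 0)) ↔ Γ.MixedNondegenerateAt L h := by
  obtain ⟨E, hE, hEe⟩ := exists_isFrameNear C.isOpen_ε_preimage hx
    C.isSmoothSectionOn_coordSection fun x hx => C.frame_coordSection hx
  have hY := Y.mapsTo_α hh
  obtain ⟨T, hT, hTi, hTr⟩ := C.ker_modelDeriv_α_rightTrans hx hY
  have hEv : ∀ μ, ∀ᶠ y in 𝓝 (Γ.α h), (E μ).vec y = modelDeriv 𝓘(ℝ, (Fin n → ℝ) × (Fin m → ℝ))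
      𝓘(ℝ, EG) C.ψ.symm (C.φ y, 0) (0, Pi.single μ 1) := fun μ => by
    filter_upwards [hEe, C.isOpen_ε_preimage.mem_nhds hx] with y h1 h2
    rw [← C.fiberVec_coordSection h2, ← h1 μ]
    rfl
  have hFL := fun γ μ => C.FL_apply hL hx hY (hEv μ) γ
  simp only [← hT, Y.rightTrans_ε hh] at hFL
  rw [Y.rightTrans_ε hh] at hTr
  -- Rows are indexed by the direction of differentiation and columns by the frame section. The
  -- kernel to compare is therefore that of multiplication by row vectors.
  rw [mixedNondegenerateAt_iff_frame hL hE.self_of_nhds.2, ← Matrix.vecMul_injective_iff_isUnit]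
  have key : ∀ s μ, Matrix.vecMul s (C.FL L Y (C.φ (Γ.α h), 0)) μ =
      -modelDeriv 𝓘(ℝ, EG) 𝓘(ℝ, ℝ) (rightDeriv L (E μ)) h (T s) := fun s μ => by
    have h1 : s = ∑ γ, s γ • (Pi.single γ 1 : Fin m → ℝ) := pi_eq_sum_univ' s
    conv_rhs => rw [h1, map_sum, map_sum]
    simp only [Matrix.vecMul, dotProduct, hFL, map_smul, smul_eq_mul, mul_neg,
      Finset.sum_neg_distrib]
  constructor
  · intro hinj w hw hw'
    obtain ⟨s, rfl⟩ := (hTr w).1 hw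
    have h1 : s = 0 := hinj (by
      funext μ
      simp only [key, hw', map_zero, neg_zero])
    rw [h1, map_zero]
  · intro H s s' hss
    have h1 : T (s - s') = 0 := by
      refine H _ ((hTr _).2 ⟨_, rfl⟩) fun μ => ?_
      have h2 := key (s - s') μ
      have h3 : Matrix.vecMul s (C.FL L Y (C.φ (Γ.α h), 0)) =
        Matrix.vecMul s' (C.FL L Y (C.φ (Γ.α h), 0)) := hss
      rw [Matrix.sub_vecMul, h3, sub_self, Pi.zero_apply] at h2
      exact neg_eq_zero.1 h2.symm
    exact sub_eq_zero.1 (hTi (h1.trans (map_zero T).symm))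

/-- Regularity of the matrix `FLbar` at an identity. -/
theorem isUnit_FLbar_iff (hL : ContMDiff 𝓘(ℝ, EG) 𝓘(ℝ, ℝ) ∞ L) {S : Γ.LocalBisection} {g : G}
    (hx : Γ.ε (Γ.β g) ∈ C.ψ.source) (hg : g ∈ S.carrier) :
    IsUnit (C.FLbar L S (C.φ (Γ.β g), 0)) ↔ Γ.MixedNondegenerateAt L g := by
  -- Inversion turns the left translation into a right translation by the inverse bisection. The
  -- barred matrix at `g` becomes the unbarred matrix of `L ∘ i` at `g⁻¹`.
  have hα : Γ.α (Γ.inv g) = Γ.β g := Γ.α_inv g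
  have h1 := C.isUnit_FL_iff (Y := S.inverse) (hL.comp Γ.smooth_inv) (h := Γ.inv g)
    (by rwa [hα]) (mem_image_of_mem _ hg)
  have h2 : (fun z => L (S.leftTrans (Γ.inv (C.ψ.symm z)))) =ᶠ[𝓝 (C.φ (Γ.β g), 0)]
      fun z => L (Γ.inv (S.inverse.rightTrans (C.ψ.symm z))) := by
    have hz := C.mem_ψ_target hx
    have hβc : ContinuousAt (fun z => Γ.β (C.ψ.symm z)) (C.φ (Γ.β g), 0) :=
      ((Γ.smooth_β _).comp _ (C.contMDiffAt_ψ_symm hz)).continuousAt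
    rw [ContinuousAt, C.ψ_symm_zero hx, Γ.β_ε] at hβc
    filter_upwards [hβc (S.isOpen_tgt.mem_nhds (S.mapsTo_β hg))] with z hz'
    rw [S.leftTrans_eq_inv_rightTrans (by rw [Γ.α_inv]; exact hz'), Γ.inv_inv]
  rw [← mixedNondegenerateAt_comp_inv_iff hL, ← hα, FLbar, hα, C.localMatrix_congr h2, ← hα]
  exact h1

end AdaptedCoordinates

end LieGroupoid

end

/-! ### The equivalence and the evolution operator. -/

theorem mainTheorem1
    {EG : Type*} [NormedAddCommGroup EG] [NormedSpace ℝ EG] [FiniteDimensional ℝ EG]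
    {EM : Type*} [NormedAddCommGroup EM] [NormedSpace ℝ EM] [FiniteDimensional ℝ EM]
    {G : Type*} [TopologicalSpace G] [ChartedSpace EG G] [IsManifold 𝓘(ℝ, EG) ∞ G] [T2Space G]
    {M : Type*} [TopologicalSpace M] [ChartedSpace EM M] [IsManifold 𝓘(ℝ, EM) ∞ M] [T2Space M]
    (Γ : LieGroupoid EG EM G M)
    (L : G → ℝ) (hL : ContMDiff 𝓘(ℝ, EG) 𝓘(ℝ, ℝ) ∞ L)
    (g₀ h₀ : G) (hsol : Γ.IsDELSolution L g₀ h₀)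
    (x₀ : M) (hx₀ : x₀ = Γ.β g₀)
    (n m : ℕ) (C : Γ.AdaptedCoordinates n m)
    (W : Set G) (hW : Γ.IsSymmetricNeighborhood C.ψ.source x₀ W)
    (S Y : Γ.LocalBisection)
    (hg₀ : g₀ ∈ S.carrier) (hh₀ : h₀ ∈ Y.carrier)
    (hS : Γ.α '' W ⊆ S.tgt) (hY : Γ.α '' W ⊆ Y.src) :
    List.TFAE
      [ IsUnit (C.FL L Y (C.φ x₀, 0)) ∧ IsUnit (C.FLbar L S (C.φ x₀, 0)),
        Γ.PoincareCartanNondegenerateAt L g₀ ∧ Γ.PoincareCartanNondegenerateAt L h₀,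
        Γ.IsLocalDiffeoToDualAt (Γ.legendrePlus L) g₀ ∧
          Γ.IsLocalDiffeoToDualAt (Γ.legendreMinus L) h₀ ] ∧
    ((IsUnit (C.FL L Y (C.φ x₀, 0)) ∧ IsUnit (C.FLbar L S (C.φ x₀, 0))) ∨
        (Γ.PoincareCartanNondegenerateAt L g₀ ∧ Γ.PoincareCartanNondegenerateAt L h₀) ∨
        (Γ.IsLocalDiffeoToDualAt (Γ.legendrePlus L) g₀ ∧
          Γ.IsLocalDiffeoToDualAt (Γ.legendreMinus L) h₀) →
      ∃ A B : Set G,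
        IsOpen A ∧ g₀ ∈ A ∧ A ⊆ S.leftTrans '' W ∧
        IsOpen B ∧ h₀ ∈ B ∧ B ⊆ Y.rightTrans '' W ∧
        ∃ Ψ : G → G,
          -- existence of the evolution operator `Ψ : A → B` with `Ψ(g₀) = h₀`
          Γ.IsEvolutionOperator L A B Ψ ∧ Ψ g₀ = h₀ ∧
          -- its uniqueness
          (∀ Ψ' : G → G, Γ.IsEvolutionOperator L A B Ψ' → Ψ' g₀ = h₀ → EqOn Ψ' Ψ A) ∧
          -- `Ψ : A → B` is a diffeomorphism
          ∃ Ξ : G → G, ContMDiffOn 𝓘(ℝ, EG) 𝓘(ℝ, EG) ∞ Ξ B ∧ MapsTo Ξ B A ∧ InvOn Ξ Ψ A B) := by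
  subst hx₀
  have hβα : Γ.β g₀ = Γ.α h₀ := hsol.1
  have hx : Γ.ε (Γ.β g₀) ∈ C.ψ.source := hW.subset hW.mem
  have hx' : Γ.ε (Γ.α h₀) ∈ C.ψ.source := hβα ▸ hx
  have hsec := C.isSmoothSectionOn_coordSection
  have hframe := fun x (hx : x ∈ Γ.ε ⁻¹' C.ψ.source) => C.frame_coordSection hx
  have h1 : (IsUnit (C.FL L Y (C.φ (Γ.β g₀), 0)) ∧ IsUnit (C.FLbar L S (C.φ (Γ.β g₀), 0))) ↔
      Γ.MixedNondegenerateAt L g₀ ∧ Γ.MixedNondegenerateAt L h₀ := by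
    -- The unbarred matrix belongs to `h₀` and the barred one to `g₀`, hence the swap.
    rw [C.isUnit_FLbar_iff hL hx hg₀, hβα, C.isUnit_FL_iff hL hx' hh₀, and_comm]
  have h2 : (Γ.PoincareCartanNondegenerateAt L g₀ ∧ Γ.PoincareCartanNondegenerateAt L h₀) ↔
      Γ.MixedNondegenerateAt L g₀ ∧ Γ.MixedNondegenerateAt L h₀ := by
    rw [LieGroupoid.poincareCartanNondegenerateAt_iff hL,
      LieGroupoid.poincareCartanNondegenerateAt_iff hL]
  have h3 : (Γ.IsLocalDiffeoToDualAt (Γ.legendrePlus L) g₀ ∧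
      Γ.IsLocalDiffeoToDualAt (Γ.legendreMinus L) h₀) ↔
      Γ.MixedNondegenerateAt L g₀ ∧ Γ.MixedNondegenerateAt L h₀ := by
    rw [LieGroupoid.isLocalDiffeoToDualAt_legendrePlus_iff hL C.isOpen_ε_preimage hx hsec hframe,
      LieGroupoid.isLocalDiffeoToDualAt_legendreMinus_iff hL C.isOpen_ε_preimage hx' hsec hframe]
  constructor
  · rw [h1, h2, h3]
    tfae_finish
  rw [h1, h2, h3, or_self, or_self]
  rintro ⟨hg, hh⟩
  obtain ⟨E, hE, -⟩ := LieGroupoid.exists_isFrameNear C.isOpen_ε_preimage hx hsec hframe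
  have hE' : LieGroupoid.IsFrameNear E (Γ.α h₀) := hβα ▸ hE
  have hWx : W ∈ 𝓝 (Γ.ε (Γ.β g₀)) := hW.isOpen.mem_nhds hW.mem
  exact LieGroupoid.exists_evolutionOperator hsol hE
    ((LieGroupoid.isLocalDiffeomorphAt_framePlus_iff hL hE).2 hg)
    ((LieGroupoid.isLocalDiffeomorphAt_frameMinus_iff hL hE').2 hh)
    (S.image_leftTrans_mem_nhds hg₀ hWx hS)
    (Y.image_rightTrans_mem_nhds hh₀ (hβα ▸ hWx))
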